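/- Let $M$ be a smooth $n$-dimensional manifold (Hausdorff, second countable, without boundary), let $X_0,X_1,\dots,X_d$ be smooth vector fields on $M$, let $x\in M$, let $I=[0,1]$ and let $1<p<\infty$. A control $u=(u_1,\dots,u_d)\in L^p(I,\mathbb{R}^d)$ is called admissible if there is an absolutely continuous curve $\gamma_u:I\to M$, defined on the whole of $I$, with $$\dot\gamma_u(t)=X_0(\gamma_u(t))+\sum_{i=1}^d u_i(t)\,X_i(\gamma_u(t))\quad\text{for a.e. }t\in I,\qquad \gamma_u(0)=x.$$ Let $\Omega\subset L^p(I,\mathbb{R}^d)$ be the set of admissible controls, let $F:\Omega\to M$, $F(u)=\gamma_u(1)$, be the endpoint map, and for $y\in M$ put $\Omega(y)=F^{-1}(y)$, with the topology induced by $L^p(I,\mathbb{R}^d)$. Assume that $M$ is compact or, more generally, that every control is admissible, i.e. $\Omega=L^p(I,\mathbb{R}^d)$. Let $y\in M$ be a regular value of $F$, i.e. $d_uF:L^p(I,\mathbb{R}^d)\to T_yM$ is surjective for every $u\in\Omega(y)$, and write $T_u\Omega(y)=\ker d_uF$. Let $J_p(u)=\sum_{i=1}^d\|u_i\|_p^p$,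 and let $f=J_p|_{\Omega(y)}$, whose differential at $u\in\Omega(y)$ is $d_uf=d_uJ_p|_{T_u\Omega(y)}\in (T_u\Omega(y))^*$, where $T_u\Omega(y)$ carries the norm of $L^p(I,\mathbb{R}^d)$. Then $f$ satisfies the Palais–Smale condition: every sequence $(u_k)_{k\in\mathbb{N}}$ in $\Omega(y)$ such that $(f(u_k))_k$ is bounded and $\|d_{u_k}f\|\to0$ has a subsequence which converges in $L^p(I,\mathbb{R}^d)$ to an element of $\Omega(y)$. -/

import Mathlib

open MeasureTheory Set Filter Topology
open scoped ENNReal Manifold ContDiff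

noncomputable section

namespace ControlSystem

/-- The space `L^p(I, ℝ^d)` of controls, where `I = [0, 1]` carries Lebesgue measure. -/
abbrev Control (d : ℕ) (p : ℝ≥0∞) : Type :=
  Lp (EuclideanSpace ℝ (Fin d)) p (volume.restrict (Icc (0 : ℝ) 1))

/-- The `p`-energy `J_p(u) = ∑ i, ‖u_i‖_p ^ p`. -/
def energy {d : ℕ} {p : ℝ≥0∞} (u : Control d p) : ℝ :=
  ∑ i : Fin d, ∫ t in Icc (0 : ℝ) 1, |u t i| ^ p.toReal

section

variable {n : ℕ} {M : Type*} [TopologicalSpace M] [ChartedSpace (EuclideanSpace ℝ (Fin n)) M]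

/-- A vector field `V` on `M` is smooth, as a section of the tangent bundle. -/
def IsSmoothField [IsManifold (𝓡 n) ∞ M] (V : (q : M) → TangentSpace (𝓡 n) q) : Prop :=
  ContMDiff (𝓡 n) (𝓡 n).tangent ∞ (fun q => (⟨q, V q⟩ : TangentBundle (𝓡 n) M))

/-- A curve in `M`, considered on `[0, 1]` only, is absolutely continuous: it is continuous, and
on every compact subinterval which it maps into a coordinate chart its coordinate expression is
absolutely continuous. -/
def IsAbsolutelyContinuousCurve (n : ℕ) {M : Type*} [TopologicalSpace M]
    [ChartedSpace (EuclideanSpace ℝ (Fin n)) M] (γ : ℝ → M) : Prop :=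
  ContinuousOn γ (Icc 0 1) ∧
    ∀ (c : M) (a b : ℝ), a ≤ b → Icc a b ⊆ Icc 0 1 →
      MapsTo γ (Icc a b) (chartAt (EuclideanSpace ℝ (Fin n)) c).source →
      AbsolutelyContinuousOnInterval (fun t => extChartAt (𝓡 n) c (γ t)) a b

variable {d : ℕ} {p : ℝ≥0∞}

/-- `γ`, on `[0, 1]`, is a trajectory of the control `u` starting at `x`: it is absolutely
continuous, `γ 0 = x`, and `γ' = X₀(γ) + ∑ i, u_i X_i(γ)` almost everywhere on `[0, 1]`. -/
structure IsTrajectory (X₀ : (q : M) → TangentSpace (𝓡 n) q)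
    (X : Fin d → (q : M) → TangentSpace (𝓡 n) q) (x : M) (u : Control d p) (γ : ℝ → M) :
    Prop where
  absolutelyContinuous : IsAbsolutelyContinuousCurve n γ
  initial : γ 0 = x
  velocity : ∀ᵐ t ∂(volume.restrict (Icc (0 : ℝ) 1)),
    HasMFDerivAt 𝓘(ℝ, ℝ) (𝓡 n) γ t
      (ContinuousLinearMap.toSpanSingleton ℝ (X₀ (γ t) + ∑ i : Fin d, u t i • X i (γ t)))

/-- The domain `Ω` of the endpoint map: the controls whose trajectory from `x` is defined on the
whole interval `[0, 1]`. -/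
def admissible (p : ℝ≥0∞) (X₀ : (q : M) → TangentSpace (𝓡 n) q)
    (X : Fin d → (q : M) → TangentSpace (𝓡 n) q) (x : M) : Set (Control d p) :=
  {u | ∃ γ : ℝ → M, IsTrajectory X₀ X x u γ}

open Classical in
/-- The endpoint map `F`, sending an admissible control to `γ 1`, where `γ` is its trajectory from
`x` (the trajectory is unique on `[0, 1]` for smooth fields on a Hausdorff manifold). Outside
`admissible p X₀ X x` it has the irrelevant value `x`. -/
def endpoint (X₀ : (q : M) → TangentSpace (𝓡 n) q)
    (X : Fin d → (q : M) → TangentSpace (𝓡 n) q) (x : M) (u : Control d p) : M :=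
  if h : ∃ γ : ℝ → M, IsTrajectory X₀ X x u γ then h.choose 1 else x

/-- `Ω(y) = F⁻¹(y)`, the admissible controls which steer `x` to `y`. -/
def fiber (p : ℝ≥0∞) (X₀ : (q : M) → TangentSpace (𝓡 n) q)
    (X : Fin d → (q : M) → TangentSpace (𝓡 n) q) (x y : M) : Set (Control d p) :=
  {u | u ∈ admissible p X₀ X x ∧ endpoint X₀ X x u = y}

variable [Fact (1 ≤ p)]

/-- The differential `d_u F` of the endpoint map, from `L^p(I, ℝ^d)` to the tangent space of `M`
at the endpoint `F(u)`. -/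
def endpointDifferential (X₀ : (q : M) → TangentSpace (𝓡 n) q)
    (X : Fin d → (q : M) → TangentSpace (𝓡 n) q) (x : M) (u : Control d p) :
    Control d p →L[ℝ] TangentSpace (𝓡 n) (endpoint X₀ X x u) :=
  mfderiv 𝓘(ℝ, Control d p) (𝓡 n) (endpoint X₀ X x : Control d p → M) u

/-- `y` is a regular value of the endpoint map: `d_u F` is surjective at every `u ∈ Ω(y)`. -/
def IsRegularValue (p : ℝ≥0∞) [Fact (1 ≤ p)] (X₀ : (q : M) → TangentSpace (𝓡 n) q)
    (X : Fin d → (q : M) → TangentSpace (𝓡 n) q) (x y : M) : Prop :=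
  ∀ u ∈ fiber p X₀ X x y,
    Function.Surjective (endpointDifferential X₀ X x u)

/-- The tangent space `T_u Ω(y) = ker d_u F` at `u` of the fibre `Ω(y)` through `u`. -/
def tangentFiber (X₀ : (q : M) → TangentSpace (𝓡 n) q)
    (X : Fin d → (q : M) → TangentSpace (𝓡 n) q) (x : M) (u : Control d p) :
    Submodule ℝ (Control d p) :=
  LinearMap.ker (endpointDifferential X₀ X x u).toLinearMap

/-- The differential at `u` of the restriction `f` of the energy to the fibre `Ω(y)` through `u`:
the restriction of `d_u J_p` to `T_u Ω(y)`, an element of the dual of `T_u Ω(y)`, the latter normed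
as a subspace of `L^p(I, ℝ^d)`. -/
def restrictedEnergyDifferential (X₀ : (q : M) → TangentSpace (𝓡 n) q)
    (X : Fin d → (q : M) → TangentSpace (𝓡 n) q) (x : M) (u : Control d p) :
    tangentFiber X₀ X x u →L[ℝ] ℝ :=
  (fderiv ℝ (energy : Control d p → ℝ) u).comp (tangentFiber X₀ X x u).subtypeL

end

end ControlSystem

end

/-! Bounded energy means bounded in `L^p`, so a subsequence of the `u k` converges weakly to some
`v`. The task is to upgrade this to strong convergence. By uniform convexity of the energy `J` it
suffices that the midpoint defect `J(u)/2 + J(u')/2 - J((u + u')/2)` tends to zero along pairs from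
the subsequence. Adding the tangent inequalities at `u` and `u'` bounds this defect by `(d_u J -
d_{u'} J)(u - u') / 4` (`energy_midpoint_le`), so everything reduces to `d_{u k} J (u k - u j) → 0`
for the double index (`tendsto_fderiv_energy_sub`).

The Palais–Smale hypothesis controls `d_{u k} J` only on `ker d_{u k} F`. The gap is closed by a
compactness property of the endpoint map: `d_u F w` is sequentially continuous for weak convergence
of both `u` and `w` (`tendsto_endpointDerivative`). Hence `d_{u k} F (u k - u j) → 0`. Moreover `v`
lies in the fibre by weak continuity of `F`, so `d_v F` is onto, and the `d_{u k} F` have right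
inverses bounded uniformly for large `k` (`exists_uniform_preimage`). Subtracting a small vector
puts `u k - u j` into the kernel, and the error is small because `d J` is bounded on bounded sets.

The weak continuity of `d F` is obtained without a formula for it. Weak convergence is encoded as
uniform convergence of primitives, and Gronwall estimates in charts, glued along the limit
trajectory, give weak continuity of `F` (`tendsto_solution`) and second differences of size `O(s ^
2)`, uniformly over weakly convergent families (`smallDifferencesAt_solution`). The latter make
difference quotients of `F` approximate `d F` with a uniform error
(`norm_sub_smul_le_of_second_difference`); for a fixed step the quotients converge by weak
continuity of `F`, hence so do the derivatives.

The exponent `p > 1` enters through uniform convexity and through the positive Hölder exponent `1 -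
1/p` of primitives. On a compact manifold every control is admissible, by Picard iteration in charts
with a uniform existence time. -/

namespace ControlSystem

/-! ### Pointwise inequalities for real powers -/

section PowerInequalities

/-- Uniform strict convexity of `|·| ^ P`, by homogeneity and compactness of the unit sphere. -/
theorem exists_abs_sub_rpow_le {P : ℝ} (hP : 1 < P) {ε : ℝ} (hε : 0 < ε) :
    ∃ C, 0 ≤ C ∧ ∀ a b : ℝ, |a - b| ^ P ≤ ε * (|a| ^ P + |b| ^ P) +
      C * (|a| ^ P / 2 + |b| ^ P / 2 - |(a + b) / 2| ^ P) := by
  have hP0 : 0 < P := by linarith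
  have hcont : Continuous fun x : ℝ => |x| ^ P := continuous_abs.rpow_const fun _ => Or.inr hP0.le
  have hmono : ∀ x y : ℝ, 0 ≤ x → x ≤ y → x ^ P ≤ y ^ P := fun x y hx hxy =>
    Real.rpow_le_rpow hx hxy hP0.le
  set h : ℝ × ℝ → ℝ := fun z => |z.1| ^ P / 2 + |z.2| ^ P / 2 - |(z.1 + z.2) / 2| ^ P with hh
  have hstrict := strictConvexOn_rpow hP
  have h_nonneg : ∀ z, 0 ≤ h z := by
    intro z
    have h1 := (convexOn_rpow hP.le).2 (mem_Ici.2 (abs_nonneg z.1)) (mem_Ici.2 (abs_nonneg z.2))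
      (show (0 : ℝ) ≤ 1 / 2 by norm_num) (show (0 : ℝ) ≤ 1 / 2 by norm_num) (by norm_num)
    have h2 : |(z.1 + z.2) / 2| ≤ |z.1| / 2 + |z.2| / 2 := by
      rw [abs_div, abs_of_pos (two_pos (α := ℝ))]
      linarith [abs_add_le z.1 z.2]
    have h3 := hmono _ _ (abs_nonneg _) h2
    simp only [smul_eq_mul] at h1
    have : (1 / 2 * |z.1| + 1 / 2 * |z.2|) = |z.1| / 2 + |z.2| / 2 := by ring
    rw [this] at h1
    simp only [hh]; linarith
  have h_pos : ∀ z, z.1 ≠ z.2 → 0 < h z := by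
    intro z hz
    simp only [hh]
    have h2 : |(z.1 + z.2) / 2| ≤ |z.1| / 2 + |z.2| / 2 := by
      rw [abs_div, abs_of_pos (two_pos (α := ℝ))]
      linarith [abs_add_le z.1 z.2]
    -- Strict convexity of the power on `[0, ∞)` separates only different moduli. Distinct points of
    -- equal modulus are opposite, and then the midpoint term vanishes.
    by_cases hab : |z.1| = |z.2|
    · have hneg : z.1 = -z.2 := (abs_eq_abs.1 hab).resolve_left hz
      have hz2 : z.2 ≠ 0 := by rintro h0; apply hz; rw [hneg, h0]; simp
      rw [hab, hneg]
      simp only [neg_add_cancel, zero_div, abs_zero, Real.zero_rpow hP0.ne']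
      have := Real.rpow_pos_of_pos (abs_pos.2 hz2) P
      linarith
    · have h1 := hstrict.2 (mem_Ici.2 (abs_nonneg z.1)) (mem_Ici.2 (abs_nonneg z.2)) hab
        (show (0 : ℝ) < 1 / 2 by norm_num) (show (0 : ℝ) < 1 / 2 by norm_num) (by norm_num)
      have h3 := hmono _ _ (abs_nonneg _) h2
      simp only [smul_eq_mul] at h1
      have : (1 / 2 * |z.1| + 1 / 2 * |z.2|) = |z.1| / 2 + |z.2| / 2 := by ring
      rw [this] at h1
      linarith
  have h_cont : Continuous h := by
    have h1 := hcont.comp (continuous_fst (X := ℝ) (Y := ℝ))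
    have h2 := hcont.comp (continuous_snd (X := ℝ) (Y := ℝ))
    have h3 := hcont.comp ((continuous_fst.add continuous_snd).div_const 2 :
      Continuous fun z : ℝ × ℝ => (z.1 + z.2) / 2)
    exact ((h1.div_const 2).add (h2.div_const 2)).sub h3
  have key : ∃ C, 0 ≤ C ∧ ∀ z : ℝ × ℝ, ‖z‖ = 1 → |z.1 - z.2| ^ P ≤ ε + C * h z := by
    -- Off `S` the term `ε` alone suffices. On the compact set `S` the two coordinates differ, so
    -- `h` has a positive minimum, and `|a - b| ≤ 2` on the unit sphere gives the constant `2 ^ P /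
    -- min h`.
    set S := Metric.sphere (0 : ℝ × ℝ) 1 ∩ {z | ε ≤ |z.1 - z.2| ^ P} with hS
    have hScomp : IsCompact S := (isCompact_sphere _ _).inter_right
      (isClosed_le continuous_const (hcont.comp (continuous_fst.sub continuous_snd)))
    rcases S.eq_empty_or_nonempty with he | hne
    · refine ⟨0, le_rfl, fun z hz => ?_⟩
      by_contra hcon
      have : z ∈ S := ⟨by simpa using hz, by simp only [mem_ofPred_eq]; linarith⟩
      rw [he] at this
      exact this
    · obtain ⟨z0, hz0, hmin⟩ := hScomp.exists_isMinOn hne h_cont.continuousOn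
      have hpos : 0 < h z0 := by
        apply h_pos
        intro heq
        have := hz0.2
        simp only [mem_ofPred_eq, heq, sub_self, abs_zero, Real.zero_rpow hP0.ne'] at this
        linarith
      refine ⟨2 ^ P / h z0, by positivity, fun z hz => ?_⟩
      by_cases hzS : ε ≤ |z.1 - z.2| ^ P
      · have hzm : h z0 ≤ h z := hmin (show z ∈ S from ⟨by simpa using hz, hzS⟩)
        have h1 : |z.1| ≤ 1 := by rw [← hz]; exact norm_fst_le z
        have h2 : |z.2| ≤ 1 := by rw [← hz]; exact norm_snd_le z
        have h3 : |z.1 - z.2| ^ P ≤ 2 ^ P := hmono _ _ (abs_nonneg _) (by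
          linarith [abs_sub z.1 z.2])
        have h4 : 2 ^ P ≤ 2 ^ P / h z0 * h z := by
          rw [div_mul_eq_mul_div, le_div_iff₀ hpos]
          gcongr
        linarith
      · have := mul_nonneg (show 0 ≤ 2 ^ P / h z0 by positivity) (h_nonneg z)
        linarith
  obtain ⟨C, hC0, hC⟩ := key
  refine ⟨C, hC0, fun a b => ?_⟩
  by_cases hz : ((a, b) : ℝ × ℝ) = 0
  · obtain ⟨rfl, rfl⟩ : a = 0 ∧ b = 0 := by simpa using hz
    simp [Real.zero_rpow hP0.ne']
  · set lam := ‖((a, b) : ℝ × ℝ)‖ with hlam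
    have hlpos : 0 < lam := norm_pos_iff.2 hz
    have hscale : ∀ x : ℝ, |x| ^ P = lam ^ P * |lam⁻¹ * x| ^ P := by
      intro x
      rw [abs_mul, abs_of_pos (inv_pos.2 hlpos),
        Real.mul_rpow (inv_nonneg.2 hlpos.le) (abs_nonneg _), Real.inv_rpow hlpos.le,
        mul_inv_cancel_left₀ (Real.rpow_pos_of_pos hlpos P).ne']
    have hn : ‖((lam⁻¹ * a, lam⁻¹ * b) : ℝ × ℝ)‖ = 1 := by
      have : ((lam⁻¹ * a, lam⁻¹ * b) : ℝ × ℝ) = lam⁻¹ • (a, b) := rfl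
      rw [this, norm_smul, norm_inv, Real.norm_of_nonneg hlpos.le, ← hlam,
        inv_mul_cancel₀ hlpos.ne']
    have hkey := hC _ hn
    have hlP := Real.rpow_pos_of_pos hlpos P
    have hge : lam ^ P ≤ |a| ^ P + |b| ^ P := by
      have ha := Real.rpow_nonneg (abs_nonneg a) P
      have hb := Real.rpow_nonneg (abs_nonneg b) P
      rw [hlam, Prod.norm_def]
      simp only [Real.norm_eq_abs]
      rcases max_choice |a| |b| with h | h <;> rw [h] <;> linarith
    simp only [hh] at hkey
    have e1 : lam⁻¹ * a - lam⁻¹ * b = lam⁻¹ * (a - b) := by ring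
    have e2 : (lam⁻¹ * a + lam⁻¹ * b) / 2 = lam⁻¹ * ((a + b) / 2) := by ring
    rw [e1, e2] at hkey
    have hmul := mul_le_mul_of_nonneg_left hkey hlP.le
    have hfin : |a - b| ^ P ≤ lam ^ P * ε +
        C * (|a| ^ P / 2 + |b| ^ P / 2 - |(a + b) / 2| ^ P) := by
      rw [hscale (a - b), hscale a, hscale b, hscale ((a + b) / 2)]
      refine hmul.trans_eq ?_
      ring
    nlinarith

/-- First-order Taylor estimate for `|·| ^ P`, with a remainder which is homogeneous of degree
`P`. -/
theorem exists_abs_taylor_rpow_le {P : ℝ} (hP : 1 < P) {ε : ℝ} (hε : 0 < ε) :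
    ∃ C, 0 ≤ C ∧ ∀ a b : ℝ, |(|a + b| ^ P - |a| ^ P - P * |a| ^ (P - 2) * a * b)| ≤
      ε * (|a| ^ (P - 1) * |b|) + C * |b| ^ P := by
  have hP0 : 0 < P := by linarith
  have hmono : ∀ x y : ℝ, 0 ≤ x → x ≤ y → x ^ P ≤ y ^ P := fun x y hx hxy =>
    Real.rpow_le_rpow hx hxy hP0.le
  have hder := hasDerivAt_abs_rpow 1 hP
  rw [hasDerivAt_iff_isLittleO_nhds_zero] at hder
  obtain ⟨δ, hδ, hball⟩ := Metric.eventually_nhds_iff.1 (hder.def hε)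
  -- The case `a = 1`, to which homogeneity reduces. For `|τ| < δ` this is differentiability at `1`;
  -- for `|τ| ≥ δ` each of the terms `|1 + τ| ^ P`, `1` and `P * |τ|` is absorbed by a multiple of
  -- `|τ| ^ P`.
  have hone : ∀ τ : ℝ, |(|1 + τ| ^ P - 1 - P * τ)| ≤
      ε * |τ| + ((δ⁻¹ + 1) ^ P + δ⁻¹ ^ P + P * δ * δ⁻¹ ^ P) * |τ| ^ P := by
    intro τ
    have hτP := Real.rpow_nonneg (abs_nonneg τ) P
    by_cases hτ : |τ| < δ
    · have := hball (y := τ) (by simpa using hτ)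
      simp only [abs_one, Real.one_rpow, Real.norm_eq_abs, smul_eq_mul, mul_one] at this
      rw [mul_comm τ P] at this
      have : 0 ≤ ((δ⁻¹ + 1) ^ P + δ⁻¹ ^ P + P * δ * δ⁻¹ ^ P) * |τ| ^ P := by positivity
      linarith
    · push Not at hτ
      have h1 : 1 ≤ δ⁻¹ * |τ| := by
        rw [inv_mul_eq_div, le_div_iff₀ hδ]; linarith
      have hδi : 0 ≤ δ⁻¹ := by positivity
      have h2 : |1 + τ| ^ P ≤ (δ⁻¹ + 1) ^ P * |τ| ^ P := by
        rw [← Real.mul_rpow (by positivity) (abs_nonneg _)]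
        apply hmono _ _ (abs_nonneg _)
        have := abs_add_le 1 τ
        rw [abs_one] at this
        linarith
      have h3 : 1 ≤ δ⁻¹ ^ P * |τ| ^ P := by
        rw [← Real.mul_rpow (by positivity) (abs_nonneg _)]
        exact Real.one_le_rpow h1 hP0.le
      have h4 : |τ| ≤ δ * δ⁻¹ ^ P * |τ| ^ P := by
        have := Real.rpow_le_rpow_of_exponent_le h1 hP.le
        rw [Real.rpow_one, Real.mul_rpow hδi (abs_nonneg _)] at this
        calc |τ| = δ * (δ⁻¹ * |τ|) := by field_simp
          _ ≤ δ * (δ⁻¹ ^ P * |τ| ^ P) := by gcongr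
          _ = _ := by ring
      have h5 : |(|1 + τ| ^ P - 1 - P * τ)| ≤ |1 + τ| ^ P + 1 + P * |τ| := by
        have := abs_nonneg τ
        have h6 := Real.rpow_nonneg (abs_nonneg (1 + τ)) P
        rw [abs_le]
        constructor <;> nlinarith [neg_abs_le τ, le_abs_self τ]
      have h6 : P * |τ| ≤ P * (δ * δ⁻¹ ^ P * |τ| ^ P) := by gcongr
      have h7 : 0 ≤ ε * |τ| := by positivity
      nlinarith
  -- The maximum with `1` serves the case `a = 0`, where the left side is exactly `|b| ^ P`.
  refine ⟨max ((δ⁻¹ + 1) ^ P + δ⁻¹ ^ P + P * δ * δ⁻¹ ^ P) 1, by positivity, fun a b => ?_⟩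
  have hbP := Real.rpow_nonneg (abs_nonneg b) P
  by_cases ha : a = 0
  · subst ha
    simp only [zero_add, abs_zero, Real.zero_rpow hP0.ne', mul_zero, zero_mul, sub_zero]
    rw [Real.zero_rpow (by linarith), zero_mul, mul_zero, zero_add, abs_of_nonneg hbP]
    nlinarith [le_max_right ((δ⁻¹ + 1) ^ P + δ⁻¹ ^ P + P * δ * δ⁻¹ ^ P) 1]
  · have hapos : 0 < |a| := abs_pos.2 ha
    have haP := Real.rpow_pos_of_pos hapos P
    have e1 : |a + b| ^ P = |a| ^ P * |1 + b / a| ^ P := by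
      rw [← Real.mul_rpow (abs_nonneg _) (abs_nonneg _), ← abs_mul]
      congr 2; field_simp
    have e2 : |a| ^ (P - 2) * a = |a| ^ P / a := by
      rw [Real.rpow_sub hapos, Real.rpow_two, sq_abs]
      field_simp
    have e3 : |a| ^ (P - 1) = |a| ^ P / |a| := by
      rw [Real.rpow_sub hapos, Real.rpow_one]
    have e4 : |a + b| ^ P - |a| ^ P - P * |a| ^ (P - 2) * a * b =
        |a| ^ P * (|1 + b / a| ^ P - 1 - P * (b / a)) := by
      rw [e1, mul_assoc P, e2]; ring
    have e5 : |b / a| = |b| / |a| := abs_div b a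
    have e6 : |a| ^ P * |b / a| ^ P = |b| ^ P := by
      rw [e5, Real.div_rpow (abs_nonneg _) (abs_nonneg _)]
      field_simp
    rw [e4, abs_mul, abs_of_pos haP]
    calc _ ≤ |a| ^ P * _ := mul_le_mul_of_nonneg_left (hone (b / a)) haP.le
      _ = ε * (|a| ^ (P - 1) * |b|) +
          ((δ⁻¹ + 1) ^ P + δ⁻¹ ^ P + P * δ * δ⁻¹ ^ P) * (|a| ^ P * |b / a| ^ P) := by
        rw [e3, e5]; ring
      _ ≤ _ := by
        rw [e6]
        gcongr
        exact le_max_left _ _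

end PowerInequalities

/-! ### The `p`-th power of the norm on scalar `L^p` -/

section LpNormPower

variable {α : Type*} {m : MeasurableSpace α} {μ : Measure α} {p : ℝ≥0∞}

theorem one_lt_toReal {p : ℝ≥0∞} (hp : 1 < p) (hp_top : p ≠ ⊤) : 1 < p.toReal := by
  have := (ENNReal.toReal_lt_toReal ENNReal.one_ne_top hp_top).2 hp
  simpa using this

theorem integrable_abs_rpow (hp : 1 < p) (hp_top : p ≠ ⊤) (g : Lp ℝ p μ) :
    Integrable (fun t => |g t| ^ p.toReal) μ := by
  simpa using (Lp.memLp g).integrable_norm_rpow (by positivity) hp_top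

theorem norm_rpow_eq_integral (hp : 1 < p) (hp_top : p ≠ ⊤) (g : Lp ℝ p μ) :
    ‖g‖ ^ p.toReal = ∫ t, |g t| ^ p.toReal ∂μ := by
  have hP := one_lt_toReal hp hp_top
  have h0 : 0 ≤ ∫ t, |g t| ^ p.toReal ∂μ :=
    integral_nonneg fun t => Real.rpow_nonneg (abs_nonneg _) _
  rw [Lp.norm_def, (Lp.memLp g).eLpNorm_eq_integral_rpow_norm (by positivity) hp_top,
    ENNReal.toReal_ofReal (Real.rpow_nonneg (by simpa using h0) _)]
  simp only [Real.norm_eq_abs]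
  rw [Real.rpow_inv_rpow h0 (by linarith)]

/-- A crude Young inequality, by replacing both factors with the larger modulus. Only finiteness of
the constant matters later. -/
theorem abs_rpow_sub_one_mul_le {P : ℝ} (hP : 1 < P) (a b : ℝ) :
    |a| ^ (P - 1) * |b| ≤ |a| ^ P + |b| ^ P := by
  have hP1 : 0 ≤ P - 1 := by linarith
  have key : ∀ x y : ℝ, 0 ≤ x → 0 ≤ y → x ^ (P - 1) * y ≤ max x y ^ P := by
    intro x y hx hy
    have hm : 0 ≤ max x y := le_max_of_le_left hx
    calc x ^ (P - 1) * y ≤ max x y ^ (P - 1) * max x y := by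
          gcongr
          · exact le_max_left _ _
          · exact le_max_right _ _
      _ = max x y ^ P := by
          rcases hm.eq_or_lt with h | h
          · rw [← h, Real.zero_rpow (by linarith), mul_zero, Real.zero_rpow (by linarith)]
          · rw [Real.rpow_sub h, Real.rpow_one]; field_simp
  refine (key _ _ (abs_nonneg a) (abs_nonneg b)).trans ?_
  have ha := Real.rpow_nonneg (abs_nonneg a) P
  have hb := Real.rpow_nonneg (abs_nonneg b) P
  rcases max_choice |a| |b| with h | h <;> rw [h] <;> linarith

theorem integrable_abs_rpow_mul (hp : 1 < p) (hp_top : p ≠ ⊤) (u w : Lp ℝ p μ) :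
    Integrable (fun t => |u t| ^ (p.toReal - 1) * |w t|) μ := by
  have hP := one_lt_toReal hp hp_top
  refine ((integrable_abs_rpow hp hp_top u).add (integrable_abs_rpow hp hp_top w)).mono'
    ?_ (ae_of_all _ fun t => ?_)
  · have h1 := (Lp.aestronglyMeasurable u).aemeasurable
    have h2 := (Lp.aestronglyMeasurable w).aemeasurable
    exact ((h1.abs.pow_const _).mul h2.abs).aestronglyMeasurable
  · rw [Real.norm_of_nonneg (mul_nonneg (Real.rpow_nonneg (abs_nonneg _) _) (abs_nonneg _))]
    exact abs_rpow_sub_one_mul_le hP _ _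

/-- A weak form of Hölder's inequality: integrate the crude Young inequality for `w` normalised to
norm one and rescale. Linearity in `‖w‖` is what continuity of the derivative of the norm power
requires. -/
theorem integral_abs_rpow_mul_le (hp : 1 < p) (hp_top : p ≠ ⊤) [Fact (1 ≤ p)] (u w : Lp ℝ p μ) :
    ∫ t, |u t| ^ (p.toReal - 1) * |w t| ∂μ ≤ (‖u‖ ^ p.toReal + 1) * ‖w‖ := by
  have hP := one_lt_toReal hp hp_top
  rcases eq_or_ne w 0 with rfl | hw
  · have : (fun t => |u t| ^ (p.toReal - 1) * |(0 : Lp ℝ p μ) t|) =ᵐ[μ] fun _ => 0 := by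
      filter_upwards [Lp.coeFn_zero ℝ p μ] with t ht
      rw [ht]; simp
    rw [integral_congr_ae this]; simp
  · have hw0 : 0 < ‖w‖ := norm_pos_iff.2 hw
    set w' : Lp ℝ p μ := ‖w‖⁻¹ • w with hw'
    have hn : ‖w'‖ = 1 := by
      rw [hw', norm_smul, norm_inv, norm_norm, inv_mul_cancel₀ hw0.ne']
    have h1 : ∫ t, |u t| ^ (p.toReal - 1) * |w t| ∂μ =
        ‖w‖ * ∫ t, |u t| ^ (p.toReal - 1) * |w' t| ∂μ := by
      rw [← integral_const_mul]
      apply integral_congr_ae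
      filter_upwards [Lp.coeFn_smul ‖w‖⁻¹ w] with t ht
      rw [hw', ht, Pi.smul_apply, smul_eq_mul, abs_mul, abs_of_pos (inv_pos.2 hw0)]
      field_simp
    have h2 : ∫ t, |u t| ^ (p.toReal - 1) * |w' t| ∂μ ≤ ‖u‖ ^ p.toReal + ‖w'‖ ^ p.toReal := by
      rw [norm_rpow_eq_integral hp hp_top, norm_rpow_eq_integral hp hp_top, ← integral_add
        (integrable_abs_rpow hp hp_top u) (integrable_abs_rpow hp hp_top w')]
      exact integral_mono (integrable_abs_rpow_mul hp hp_top u w')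
        ((integrable_abs_rpow hp hp_top u).add (integrable_abs_rpow hp hp_top w'))
        fun t => abs_rpow_sub_one_mul_le hP _ _
    rw [hn, Real.one_rpow] at h2
    rw [h1, mul_comm]
    gcongr

/-- Uniform convexity of `L^p` for all `1 < p < ∞` at once, by integrating `exists_abs_sub_rpow_le`;
it takes the place of Clarkson's inequalities. -/
theorem norm_rpow_convex_estimate (hp : 1 < p) (hp_top : p ≠ ⊤) {ε : ℝ} (hε : 0 < ε) :
    ∃ C, 0 ≤ C ∧ ∀ u v : Lp ℝ p μ, ‖u - v‖ ^ p.toReal ≤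
      ε * (‖u‖ ^ p.toReal + ‖v‖ ^ p.toReal) + C * (‖u‖ ^ p.toReal / 2 + ‖v‖ ^ p.toReal / 2 -
        ‖(2⁻¹ : ℝ) • (u + v)‖ ^ p.toReal) := by
  obtain ⟨C, hC0, hC⟩ := exists_abs_sub_rpow_le (one_lt_toReal hp hp_top) hε
  refine ⟨C, hC0, fun u v => ?_⟩
  have hu := integrable_abs_rpow hp hp_top u
  have hv := integrable_abs_rpow hp hp_top v
  have hm := integrable_abs_rpow hp hp_top ((2⁻¹ : ℝ) • (u + v))
  have huv : Integrable (fun t => |u t| ^ p.toReal / 2 + |v t| ^ p.toReal / 2) μ :=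
    (hu.div_const 2).add (hv.div_const 2)
  have hsum : Integrable (fun t => ε * (|u t| ^ p.toReal + |v t| ^ p.toReal)) μ :=
    (hu.add hv).const_mul ε
  have hdef : Integrable (fun t => C * (|u t| ^ p.toReal / 2 + |v t| ^ p.toReal / 2 -
      |((2⁻¹ : ℝ) • (u + v)) t| ^ p.toReal)) μ := (huv.sub hm).const_mul C
  simp only [norm_rpow_eq_integral hp hp_top]
  rw [← integral_add hu hv, ← integral_div, ← integral_div, ← integral_add (hu.div_const 2)
    (hv.div_const 2), ← integral_sub huv hm,
    ← integral_const_mul, ← integral_const_mul, ← integral_add hsum hdef]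
  apply integral_mono_ae (integrable_abs_rpow hp hp_top (u - v))
    (hsum.add hdef)
  filter_upwards [Lp.coeFn_sub u v, Lp.coeFn_add u v, Lp.coeFn_smul (2⁻¹ : ℝ) (u + v)]
    with t h1 h2 h3
  have := hC (u t) (v t)
  simp only [Pi.add_apply]
  rw [h1, h3, Pi.smul_apply, h2, Pi.sub_apply, Pi.add_apply, smul_eq_mul, inv_mul_eq_div]
  exact this

/-- The derivative is `w ↦ ∫ P |u| ^ (P - 2) u w`. Integrating the pointwise Taylor estimate leaves
an arbitrarily small multiple of `‖w‖` plus `C ‖w‖ ^ P`, which is `o(‖w‖)` since `P > 1`. -/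
theorem differentiable_norm_rpow_Lp (hp : 1 < p) (hp_top : p ≠ ⊤) [Fact (1 ≤ p)] :
    Differentiable ℝ (fun u : Lp ℝ p μ => ‖u‖ ^ p.toReal) := by
  intro u
  set P := p.toReal with hPdef
  have hP : 1 < P := one_lt_toReal hp hp_top
  have hmeas : AEMeasurable u μ := (Lp.aestronglyMeasurable u).aemeasurable
  have habs : ∀ a b : ℝ, |P * |a| ^ (P - 2) * a * b| = P * (|a| ^ (P - 1) * |b|) := by
    intro a b
    rw [abs_mul, abs_mul, abs_mul, abs_of_pos (by linarith : 0 < P),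
      abs_of_nonneg (Real.rpow_nonneg (abs_nonneg _) _)]
    rcases eq_or_ne a 0 with rfl | ha
    · simp [Real.zero_rpow (by linarith : P - 1 ≠ 0)]
    · have : |a| ^ (P - 1) = |a| ^ (P - 2) * |a| := by
        rw [← Real.rpow_add_one (abs_pos.2 ha).ne']; congr 1; ring
      rw [this]; ring
  have hint : ∀ w : Lp ℝ p μ, Integrable (fun t => P * |u t| ^ (P - 2) * u t * w t) μ := by
    intro w
    refine ((integrable_abs_rpow_mul hp hp_top u w).const_mul P).mono' ?_
      (ae_of_all _ fun t => (habs _ _).le)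
    have h2 := (Lp.aestronglyMeasurable w).aemeasurable
    exact ((((hmeas.abs.pow_const _).const_mul P).mul hmeas).mul h2).aestronglyMeasurable
  let l : Lp ℝ p μ →ₗ[ℝ] ℝ :=
    { toFun := fun w => ∫ t, P * |u t| ^ (P - 2) * u t * w t ∂μ
      map_add' := fun w w' => by
        rw [← integral_add (hint w) (hint w')]
        apply integral_congr_ae
        filter_upwards [Lp.coeFn_add w w'] with t ht
        rw [ht, Pi.add_apply]; ring
      map_smul' := fun c w => by
        rw [RingHom.id_apply, smul_eq_mul, ← integral_const_mul]
        apply integral_congr_ae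
        filter_upwards [Lp.coeFn_smul c w] with t ht
        rw [ht, Pi.smul_apply, smul_eq_mul]; ring }
  have hl : ∀ w, ‖l w‖ ≤ (P * (‖u‖ ^ P + 1)) * ‖w‖ := by
    intro w
    calc ‖l w‖ ≤ ∫ t, ‖P * |u t| ^ (P - 2) * u t * w t‖ ∂μ := norm_integral_le_integral_norm _
      _ = P * ∫ t, |u t| ^ (P - 1) * |w t| ∂μ := by
        rw [← integral_const_mul]
        exact integral_congr_ae (ae_of_all _ fun t => habs _ _)
      _ ≤ P * ((‖u‖ ^ P + 1) * ‖w‖) := by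
        gcongr
        exact integral_abs_rpow_mul_le hp hp_top u w
      _ = _ := by ring
  refine ⟨l.mkContinuous _ hl, ?_⟩
  rw [hasFDerivAt_iff_isLittleO_nhds_zero, Asymptotics.isLittleO_iff]
  intro c hc
  set K := ‖u‖ ^ P + 1 with hK
  have hKpos : 0 < K := by positivity
  -- Since `∫ |u| ^ (P - 1) |w| ≤ K ‖w‖`, this choice makes the linear error `c / 2 * ‖w‖`; the
  -- other half of `c` pays for `C ‖w‖ ^ (P - 1)`.
  obtain ⟨C, hC0, hC⟩ := exists_abs_taylor_rpow_le hP (show 0 < c / (2 * K) by positivity)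
  have hbound : ∀ w : Lp ℝ p μ, |‖u + w‖ ^ P - ‖u‖ ^ P - l w| ≤
      c / 2 * ‖w‖ + C * ‖w‖ ^ P := by
    intro w
    have i1 := integrable_abs_rpow hp hp_top (u + w)
    have i2 := integrable_abs_rpow hp hp_top u
    have i3 := integrable_abs_rpow hp hp_top w
    have i4 := integrable_abs_rpow_mul hp hp_top u w
    rw [← hPdef] at i1 i2 i3 i4
    have e : ‖u + w‖ ^ P - ‖u‖ ^ P - l w =
        ∫ t, (|(u + w) t| ^ P - |u t| ^ P - P * |u t| ^ (P - 2) * u t * w t) ∂μ := by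
      have i5 : Integrable (fun t => |(u + w) t| ^ P - |u t| ^ P) μ := i1.sub i2
      rw [integral_sub i5 (hint w), integral_sub i1 i2,
        ← norm_rpow_eq_integral hp hp_top, ← norm_rpow_eq_integral hp hp_top]
      rfl
    rw [e]
    calc _ ≤ ∫ t, |(|(u + w) t| ^ P - |u t| ^ P - P * |u t| ^ (P - 2) * u t * w t)| ∂μ :=
          abs_integral_le_integral_abs
      _ ≤ ∫ t, (c / (2 * K) * (|u t| ^ (P - 1) * |w t|) + C * |w t| ^ P) ∂μ := by
          apply integral_mono_ae (((i1.sub i2).sub (hint w)).abs)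
            ((i4.const_mul _).add (i3.const_mul C))
          filter_upwards [Lp.coeFn_add u w] with t ht
          simp only [ht, Pi.add_apply, Pi.sub_apply]
          exact hC _ _
      _ = c / (2 * K) * ∫ t, |u t| ^ (P - 1) * |w t| ∂μ + C * ‖w‖ ^ P := by
          rw [integral_add (i4.const_mul _) (i3.const_mul C), integral_const_mul,
            integral_const_mul, norm_rpow_eq_integral hp hp_top]
      _ ≤ c / (2 * K) * (K * ‖w‖) + C * ‖w‖ ^ P := by
          gcongr
          exact integral_abs_rpow_mul_le hp hp_top u w
      _ = _ := by field_simp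
  have hsmall : Tendsto (fun w : Lp ℝ p μ => C * ‖w‖ ^ (P - 1)) (𝓝 0) (𝓝 0) := by
    have : ContinuousAt (fun w : Lp ℝ p μ => C * ‖w‖ ^ (P - 1)) 0 :=
      (continuous_norm.continuousAt.rpow_const (Or.inr (by linarith))).const_mul C
    simpa [ContinuousAt, Real.zero_rpow (by linarith : P - 1 ≠ 0)] using this
  filter_upwards [hsmall.eventually (gt_mem_nhds (show 0 < c / 2 by positivity))] with w hw
  refine (hbound w).trans ?_
  have hsplit : ‖w‖ ^ P = ‖w‖ ^ (P - 1) * ‖w‖ := by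
    rcases (norm_nonneg w).eq_or_lt with h | h
    · rw [← h, Real.zero_rpow (by linarith), mul_zero]
    · rw [← Real.rpow_add_one h.ne']; congr 1; ring
  rw [hsplit]
  nlinarith [norm_nonneg w]

end LpNormPower

/-! ### The energy: differentiability, convexity and uniform convexity -/

section Energy

variable {d : ℕ} {p : ℝ≥0∞}

/-- The `i`-th component of a control. -/
noncomputable def component [Fact (1 ≤ p)] (i : Fin d) :
    Control d p →L[ℝ] Lp ℝ p (volume.restrict (Icc (0 : ℝ) 1)) :=
  (EuclideanSpace.proj i : EuclideanSpace ℝ (Fin d) →L[ℝ] ℝ).compLpL p _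

theorem component_apply [Fact (1 ≤ p)] (i : Fin d) (u : Control d p) :
    ∀ᵐ t ∂(volume.restrict (Icc (0 : ℝ) 1)), component i u t = u t i :=
  (EuclideanSpace.proj i : EuclideanSpace ℝ (Fin d) →L[ℝ] ℝ).coeFn_compLpL u

/-- Compares the norm of controls, built from the Euclidean norm of `ℝ^d`, with the componentwise
norms that enter the energy: `u` is the sum of its components times unit vectors. -/
theorem norm_le_sum_component [Fact (1 ≤ p)] (u : Control d p) :
    ‖u‖ ≤ ∑ i, ‖component i u‖ := by
  let inj : Fin d → ℝ →L[ℝ] EuclideanSpace ℝ (Fin d) := fun i =>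
    ContinuousLinearMap.toSpanSingleton ℝ (EuclideanSpace.single i (1 : ℝ))
  have hu : u = ∑ i, (inj i).compLpL p _ (component i u) := by
    apply Lp.ext
    have h1 : ∀ᵐ t ∂(volume.restrict (Icc (0 : ℝ) 1)), ∀ i : Fin d,
        ((inj i).compLpL p (volume.restrict (Icc (0 : ℝ) 1)) (component i u)) t =
          inj i (component i u t) :=
      ae_all_iff.2 fun i => (inj i).coeFn_compLpL _
    have h2 : ∀ᵐ t ∂(volume.restrict (Icc (0 : ℝ) 1)), ∀ i : Fin d, component i u t = u t i :=
      ae_all_iff.2 fun i => component_apply i u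
    filter_upwards [h1, h2, Lp.coeFn_finsetSum Finset.univ fun i =>
      (inj i).compLpL p (volume.restrict (Icc (0 : ℝ) 1)) (component i u)] with t k1 k2 k3
    rw [k3, Finset.sum_apply]
    simp only [k1, k2, inj]
    ext j
    simp [Pi.single_apply]
  conv_lhs => rw [hu]
  refine (norm_sum_le _ _).trans (Finset.sum_le_sum fun i _ => ?_)
  refine (((inj i).compLpL p _).le_opNorm _).trans ?_
  refine mul_le_of_le_one_left (norm_nonneg _) (((inj i).norm_compLpL_le).trans ?_)
  simp [inj]

theorem norm_component_le [Fact (1 ≤ p)] (i : Fin d) (u : Control d p) :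
    ‖component i u‖ ≤ ‖u‖ := by
  refine Lp.norm_le_norm_of_ae_le ?_
  filter_upwards [component_apply i u] with t ht
  rw [ht]
  exact PiLp.norm_apply_le _ _

theorem energy_eq_sum_norm_rpow [Fact (1 ≤ p)] (hp : 1 < p) (hp_top : p ≠ ⊤) (u : Control d p) :
    energy u = ∑ i, ‖component i u‖ ^ p.toReal := by
  refine Finset.sum_congr rfl fun i _ => ?_
  rw [norm_rpow_eq_integral hp hp_top]
  apply integral_congr_ae
  filter_upwards [component_apply i u] with t ht
  rw [ht]

/-- Ensures that `fderiv ℝ energy` is the true differential and not the default value zero, so that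
it supplies tangent inequalities. -/
theorem differentiable_energy [Fact (1 ≤ p)] (hp : 1 < p) (hp_top : p ≠ ⊤) :
    Differentiable ℝ (energy : Control d p → ℝ) := by
  have : (energy : Control d p → ℝ) = fun u => ∑ i, ‖component i u‖ ^ p.toReal :=
    funext fun u => energy_eq_sum_norm_rpow hp hp_top u
  rw [this]
  exact Differentiable.fun_sum fun i _ =>
    (differentiable_norm_rpow_Lp hp hp_top).comp (component i).differentiable

theorem convexOn_energy [Fact (1 ≤ p)] (hp : 1 < p) (hp_top : p ≠ ⊤) :
    ConvexOn ℝ univ (energy : Control d p → ℝ) := by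
  have hP := one_lt_toReal hp hp_top
  have : (energy : Control d p → ℝ) = fun u => ∑ i, ‖component i u‖ ^ p.toReal :=
    funext fun u => energy_eq_sum_norm_rpow hp hp_top u
  rw [this]
  refine ⟨convex_univ, fun u _ v _ a b ha hb hab => ?_⟩
  simp only [smul_eq_mul, Finset.mul_sum, ← Finset.sum_add_distrib]
  refine Finset.sum_le_sum fun i _ => ?_
  have h1 : ‖component i (a • u + b • v)‖ ≤ a * ‖component i u‖ + b * ‖component i v‖ := by
    rw [map_add, map_smul, map_smul]
    refine (norm_add_le _ _).trans_eq ?_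
    rw [norm_smul, norm_smul, Real.norm_of_nonneg ha, Real.norm_of_nonneg hb]
  refine (Real.rpow_le_rpow (norm_nonneg _) h1 (by linarith)).trans ?_
  exact (convexOn_rpow hP.le).2 (mem_Ici.2 (norm_nonneg _)) (mem_Ici.2 (norm_nonneg _)) ha hb hab

theorem energy_nonneg (u : Control d p) : 0 ≤ energy u :=
  Finset.sum_nonneg fun _ _ => integral_nonneg fun _ => Real.rpow_nonneg (abs_nonneg _) _

theorem energy_le_of_norm_le [Fact (1 ≤ p)] (hp : 1 < p) (hp_top : p ≠ ⊤) {R : ℝ}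
    {u : Control d p} (hu : ‖u‖ ≤ R) : energy u ≤ d * R ^ p.toReal := by
  have hP := one_lt_toReal hp hp_top
  rw [energy_eq_sum_norm_rpow hp hp_top]
  calc ∑ i, ‖component i u‖ ^ p.toReal ≤ ∑ _i : Fin d, R ^ p.toReal :=
        Finset.sum_le_sum fun i _ => Real.rpow_le_rpow (norm_nonneg _)
          ((norm_component_le i u).trans hu) (by linarith)
    _ = d * R ^ p.toReal := by simp

theorem exists_norm_le_of_energy_le [Fact (1 ≤ p)] (hp : 1 < p) (hp_top : p ≠ ⊤) (C : ℝ) :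
    ∃ R, ∀ u : Control d p, energy u ≤ C → ‖u‖ ≤ R := by
  have hP := one_lt_toReal hp hp_top
  refine ⟨∑ _i : Fin d, C ^ p.toReal⁻¹, fun u hu => (norm_le_sum_component u).trans ?_⟩
  refine Finset.sum_le_sum fun i _ => ?_
  have h0 : ‖component i u‖ ^ p.toReal ≤ C := by
    refine le_trans ?_ hu
    rw [energy_eq_sum_norm_rpow hp hp_top]
    exact Finset.single_le_sum (f := fun i => ‖component i u‖ ^ p.toReal)
      (fun i _ => Real.rpow_nonneg (norm_nonneg _) _) (Finset.mem_univ i)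
  have := Real.rpow_le_rpow (Real.rpow_nonneg (norm_nonneg _) _) h0
    (inv_nonneg.2 (zero_le_one.trans hP.le))
  rwa [Real.rpow_rpow_inv (norm_nonneg _) (by linarith)] at this

/-- On bounded sets, a small midpoint convexity defect of the energy forces two controls to be
close. -/
theorem tendsto_norm_sub_of_energy_midpoint [Fact (1 ≤ p)] (hp : 1 < p) (hp_top : p ≠ ⊤)
    {ι : Type*} {l : Filter ι} {u v : ι → Control d p} {R : ℝ} (hu : ∀ i, ‖u i‖ ≤ R)
    (hv : ∀ i, ‖v i‖ ≤ R) (h : ∀ ε > 0, ∀ᶠ i in l,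
      energy (u i) / 2 + energy (v i) / 2 - energy ((2⁻¹ : ℝ) • (u i + v i)) ≤ ε) :
    Tendsto (fun i => ‖u i - v i‖) l (𝓝 0) := by
  have hP := one_lt_toReal hp hp_top
  set P := p.toReal with hPd
  rcases isEmpty_or_nonempty ι with hι | ⟨⟨i0⟩⟩
  · rw [Filter.filter_eq_bot_of_isEmpty l]; exact tendsto_bot
  have hR : 0 ≤ R := (norm_nonneg _).trans (hu i0)
  have hcomp : ∀ j : Fin d, Tendsto (fun i => ‖component j (u i) - component j (v i)‖ ^ P) l
      (𝓝 0) := by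
    intro j
    rw [tendsto_order]
    refine ⟨fun a ha => Eventually.of_forall fun i =>
      ha.trans_le (Real.rpow_nonneg (norm_nonneg _) _), fun ε hε => ?_⟩
    -- The constants split the budget: the term with `R ^ P` will cost at most `ε / 2`, and the
    -- defect, required below to be at most `ε / (4 * (C + 1))`, at most `ε / 4`.
    obtain ⟨C, hC0, hC⟩ := norm_rpow_convex_estimate (μ := volume.restrict (Icc (0 : ℝ) 1))
      hp hp_top (show 0 < ε / (4 * (R ^ P + 1)) by positivity)
    -- Each component has a nonnegative defect, so the defect of one component is bounded by the
    -- total.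
    have hnn : ∀ (i : ι) (k : Fin d), 0 ≤ ‖component k (u i)‖ ^ P / 2 +
        ‖component k (v i)‖ ^ P / 2 - ‖component k ((2⁻¹ : ℝ) • (u i + v i))‖ ^ P := by
      intro i k
      have h1 : ‖component k ((2⁻¹ : ℝ) • (u i + v i))‖ ≤
          (1 / 2) * ‖component k (u i)‖ + (1 / 2) * ‖component k (v i)‖ := by
        rw [map_smul, map_add, norm_smul, Real.norm_of_nonneg (by norm_num)]
        linarith [norm_add_le (component k (u i)) (component k (v i))]
      have h2 := Real.rpow_le_rpow (norm_nonneg _) h1 (by linarith : 0 ≤ P)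
      have h3 := (convexOn_rpow hP.le).2 (mem_Ici.2 (norm_nonneg (component k (u i))))
        (mem_Ici.2 (norm_nonneg (component k (v i)))) (show (0 : ℝ) ≤ 1 / 2 by norm_num)
        (show (0 : ℝ) ≤ 1 / 2 by norm_num) (by norm_num)
      simp only [smul_eq_mul] at h3
      linarith
    filter_upwards [h (ε / (4 * (C + 1))) (by positivity)] with i hi
    have hle : ‖component j (u i)‖ ^ P / 2 + ‖component j (v i)‖ ^ P / 2 -
        ‖component j ((2⁻¹ : ℝ) • (u i + v i))‖ ^ P ≤ ε / (4 * (C + 1)) := by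
      refine le_trans ?_ hi
      rw [energy_eq_sum_norm_rpow hp hp_top, energy_eq_sum_norm_rpow hp hp_top,
        energy_eq_sum_norm_rpow hp hp_top, Finset.sum_div, Finset.sum_div,
        ← Finset.sum_add_distrib, ← Finset.sum_sub_distrib]
      exact Finset.single_le_sum (f := fun k => ‖component k (u i)‖ ^ P / 2 +
        ‖component k (v i)‖ ^ P / 2 - ‖component k ((2⁻¹ : ℝ) • (u i + v i))‖ ^ P)
        (fun k _ => hnn i k) (Finset.mem_univ j)
    have hmain := hC (component j (u i)) (component j (v i))
    rw [← map_add, ← map_smul] at hmain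
    have b1 : ‖component j (u i)‖ ^ P ≤ R ^ P := Real.rpow_le_rpow (norm_nonneg _)
      ((norm_component_le j _).trans (hu i)) (by linarith)
    have b2 : ‖component j (v i)‖ ^ P ≤ R ^ P := Real.rpow_le_rpow (norm_nonneg _)
      ((norm_component_le j _).trans (hv i)) (by linarith)
    calc _ ≤ _ := hmain
      _ ≤ ε / (4 * (R ^ P + 1)) * (R ^ P + R ^ P) + C * (ε / (4 * (C + 1))) := by gcongr
      _ ≤ ε / 2 + ε / 4 := by
        have hRP : 0 ≤ R ^ P := Real.rpow_nonneg hR P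
        gcongr
        · rw [div_mul_eq_mul_div, div_le_iff₀ (by positivity)]; nlinarith
        · rw [mul_div_assoc', div_le_iff₀ (by positivity)]; nlinarith
      _ < ε := by linarith
  have hcomp' : ∀ j : Fin d, Tendsto (fun i => ‖component j (u i) - component j (v i)‖) l
      (𝓝 0) := by
    intro j
    have := (hcomp j).rpow_const (p := P⁻¹) (Or.inr (by positivity))
    rw [Real.zero_rpow (by positivity)] at this
    refine this.congr fun i => ?_
    rw [Real.rpow_rpow_inv (norm_nonneg _) (by linarith)]
  have hsum := tendsto_finsetSum Finset.univ fun j _ => hcomp' j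
  rw [Finset.sum_const_zero] at hsum
  refine squeeze_zero (fun _ => norm_nonneg _) (fun i => ?_) hsum
  refine (norm_le_sum_component _).trans_eq ?_
  simp only [map_sub]

end Energy

/-! ### Differentials of convex functions -/

section ConvexDifferential

variable {X : Type*} [NormedAddCommGroup X] [NormedSpace ℝ X] {f : X → ℝ} {f' : X →L[ℝ] ℝ} {x : X}

theorem add_apply_sub_le_of_convexOn (hf : ConvexOn ℝ univ f) (hx : HasFDerivAt f f' x) (y : X) :
    f x + f' (y - x) ≤ f y := by
  have hline : HasDerivAt (fun s : ℝ => f (x + s • (y - x))) (f' (y - x)) 0 := by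
    have h0 : HasDerivAt (fun s : ℝ => x + s • (y - x)) (y - x) 0 := by
      simpa using ((hasDerivAt_id (0 : ℝ)).smul_const (y - x)).const_add x
    have hx' : HasFDerivAt f f' (x + (0 : ℝ) • (y - x)) := by simpa using hx
    exact hx'.comp_hasDerivAt 0 h0
  have hconv : ConvexOn ℝ univ (fun s : ℝ => f (x + s • (y - x))) := by
    refine ⟨convex_univ, fun s _ t _ a b ha hb hab => ?_⟩
    have : x + (a • s + b • t) • (y - x) = a • (x + s • (y - x)) + b • (x + t • (y - x)) := by
      have hxx : x = (a + b) • x := by rw [hab, one_smul]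
      nth_rewrite 1 [hxx]
      simp only [smul_eq_mul]
      module
    simp only [this]
    exact hf.2 (mem_univ _) (mem_univ _) ha hb hab
  have := hconv.le_slope_of_hasDerivAt (mem_univ 0) (mem_univ 1) zero_lt_one hline
  rw [slope_def_field] at this
  simp only [one_smul, zero_smul, add_zero, sub_zero, div_one, add_sub_cancel] at this
  linarith

/-- The tangent inequality gives `f' w ≤ f (x + w) - f x`; applying this to `w` and `-w` turns a
one-sided bound on increments into a norm bound. -/
theorem norm_le_of_convexOn (hf : ConvexOn ℝ univ f) (hx : HasFDerivAt f f' x) {C : ℝ}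
    (hC : ∀ w, ‖w‖ ≤ 1 → f (x + w) - f x ≤ C) : ‖f'‖ ≤ C := by
  have hC0 : 0 ≤ C := by simpa using hC 0 (by simp)
  refine ContinuousLinearMap.opNorm_le_of_unit_norm hC0 fun w hw => ?_
  have h1 : ∀ w, ‖w‖ ≤ 1 → f' w ≤ C := by
    intro w hw
    have := add_apply_sub_le_of_convexOn hf hx (x + w)
    rw [add_sub_cancel_left] at this
    linarith [hC w hw]
  rw [Real.norm_eq_abs, abs_le]
  constructor
  · have := h1 (-w) (by rw [norm_neg, hw])
    rw [map_neg] at this; linarith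
  · exact h1 w hw.le

end ConvexDifferential

/-! ### Primitives of controls and their Hölder continuity -/

section Primitive

variable {d : ℕ} {p : ℝ≥0∞} [Fact (1 ≤ p)]

theorem integrable_control (u : Control d p) :
    Integrable (fun t => u t) (volume.restrict (Icc (0 : ℝ) 1)) :=
  (Lp.memLp u).integrable Fact.out

theorem intervalIntegrable_control (u : Control d p) {a b : ℝ} (ha : a ∈ Icc (0 : ℝ) 1)
    (hb : b ∈ Icc (0 : ℝ) 1) : IntervalIntegrable (fun t => u t) volume a b := by
  have h : IntegrableOn (fun t => u t) (Icc (0 : ℝ) 1) := integrable_control u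
  exact (h.mono_set (uIcc_subset_Icc ha hb)).intervalIntegrable

theorem ae_interval_of_ae_restrict {P : ℝ → Prop} {a b : ℝ} (ha : a ∈ Icc (0 : ℝ) 1)
    (hb : b ∈ Icc (0 : ℝ) 1) (h : ∀ᵐ t ∂(volume.restrict (Icc (0 : ℝ) 1)), P t) :
    ∀ᵐ t, t ∈ uIoc a b → P t := by
  filter_upwards [(ae_restrict_iff' measurableSet_Icc).1 h] with t ht hmem
  exact ht (uIcc_subset_Icc ha hb (uIoc_subset_uIcc hmem))

/-- On subintervals of `[0, 1]`, the `L¹` norm of a control is bounded by its `L^p` norm, with a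
power of the length of the interval as a factor. -/
theorem integral_norm_control_le (hp_top : p ≠ ⊤) (u : Control d p) {a b : ℝ}
    (ha : 0 ≤ a) (hab : a ≤ b) (hb : b ≤ 1) :
    ∫ t in a..b, ‖u t‖ ≤ (b - a) ^ (1 - p.toReal⁻¹) * ‖u‖ := by
  have hsub : Ioc a b ⊆ Icc 0 1 := fun t ht => ⟨ha.trans ht.1.le, ht.2.trans hb⟩
  have hle : volume.restrict (Ioc a b) ≤ volume.restrict (Icc (0 : ℝ) 1) :=
    Measure.restrict_mono hsub le_rfl
  have hmeas : AEStronglyMeasurable u (volume.restrict (Ioc a b)) :=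
    (Lp.aestronglyMeasurable u).mono_measure hle
  have h1p : (1 : ℝ≥0∞) ≤ p := Fact.out
  have hexp : 0 ≤ 1 - p.toReal⁻¹ := by
    have : 1 ≤ p.toReal := by
      simpa using (ENNReal.toReal_le_toReal ENNReal.one_ne_top hp_top).2 h1p
    linarith [inv_le_one_of_one_le₀ this]
  have h1 := eLpNorm_le_eLpNorm_mul_rpow_measure_univ h1p hmeas
  have h2 : eLpNorm u p (volume.restrict (Ioc a b)) ≤ eLpNorm u p (volume.restrict (Icc 0 1)) :=
    eLpNorm_mono_measure _ hle
  rw [intervalIntegral.integral_of_le hab, integral_norm_eq_lintegral_enorm hmeas,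
    ← eLpNorm_one_eq_lintegral_enorm, Lp.norm_def]
  have h3 := h1.trans (mul_le_mul_left h2 _)
  have hfin : eLpNorm u p (volume.restrict (Icc 0 1)) ≠ ⊤ := (Lp.eLpNorm_lt_top u).ne
  have hvol : (volume.restrict (Ioc a b)) univ = ENNReal.ofReal (b - a) := by simp
  rw [hvol, ENNReal.ofReal_rpow_of_nonneg (by linarith) (by simpa using hexp)] at h3
  have h4 := ENNReal.toReal_mono (ENNReal.mul_ne_top hfin ENNReal.ofReal_ne_top) h3
  rw [ENNReal.toReal_mul, ENNReal.toReal_ofReal (Real.rpow_nonneg (by linarith) _)] at h4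
  rw [mul_comm]
  simpa using h4

theorem integral_norm_control_le_norm (hp_top : p ≠ ⊤) (u : Control d p) {a b : ℝ}
    (ha : 0 ≤ a) (hab : a ≤ b) (hb : b ≤ 1) : ∫ t in a..b, ‖u t‖ ≤ ‖u‖ := by
  have h1p : (1 : ℝ≥0∞) ≤ p := Fact.out
  have : 1 ≤ p.toReal := by
    simpa using (ENNReal.toReal_le_toReal ENNReal.one_ne_top hp_top).2 h1p
  refine (integral_norm_control_le hp_top u ha hab hb).trans ?_
  refine mul_le_of_le_one_left (norm_nonneg _) (Real.rpow_le_one (by linarith) (by linarith) ?_)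
  linarith [inv_le_one_of_one_le₀ this]

/-- The primitive `t ↦ ∫₀ᵗ u` of a control. -/
noncomputable def primitive (u : Control d p) (t : ℝ) : EuclideanSpace ℝ (Fin d) :=
  ∫ s in (0 : ℝ)..t, u s

theorem primitive_add (u v : Control d p) {t : ℝ} (ht : t ∈ Icc (0 : ℝ) 1) :
    primitive (u + v) t = primitive u t + primitive v t := by
  have h0 : (0 : ℝ) ∈ Icc (0 : ℝ) 1 := by simp
  rw [primitive, primitive, primitive, ← intervalIntegral.integral_add
    (intervalIntegrable_control u h0 ht) (intervalIntegrable_control v h0 ht)]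
  exact intervalIntegral.integral_congr_ae
    (ae_interval_of_ae_restrict h0 ht (Lp.coeFn_add u v))

theorem primitive_smul (c : ℝ) (u : Control d p) {t : ℝ} (ht : t ∈ Icc (0 : ℝ) 1) :
    primitive (c • u) t = c • primitive u t := by
  have h0 : (0 : ℝ) ∈ Icc (0 : ℝ) 1 := by simp
  rw [primitive, primitive, ← intervalIntegral.integral_smul]
  exact intervalIntegral.integral_congr_ae
    (ae_interval_of_ae_restrict h0 ht (Lp.coeFn_smul c u))

theorem primitive_sub (u v : Control d p) {t : ℝ} (ht : t ∈ Icc (0 : ℝ) 1) :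
    primitive (u - v) t = primitive u t - primitive v t := by
  have : u - v = u + (-1 : ℝ) • v := by module
  rw [this, primitive_add _ _ ht, primitive_smul _ _ ht]; module

theorem norm_primitive_le (hp_top : p ≠ ⊤) (u : Control d p) {t : ℝ} (ht : t ∈ Icc (0 : ℝ) 1) :
    ‖primitive u t‖ ≤ ‖u‖ :=
  (intervalIntegral.norm_integral_le_integral_norm ht.1).trans
    (integral_norm_control_le_norm hp_top u le_rfl ht.1 ht.2)

theorem norm_primitive_sub_le (hp_top : p ≠ ⊤) (u : Control d p) {s t : ℝ}
    (hs : s ∈ Icc (0 : ℝ) 1) (ht : t ∈ Icc (0 : ℝ) 1) :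
    ‖primitive u t - primitive u s‖ ≤ |t - s| ^ (1 - p.toReal⁻¹) * ‖u‖ := by
  have h0 : (0 : ℝ) ∈ Icc (0 : ℝ) 1 := by simp
  wlog hst : s ≤ t generalizing s t
  · rw [norm_sub_rev, abs_sub_comm]
    exact this ht hs (le_of_not_ge hst)
  rw [primitive, primitive, intervalIntegral.integral_interval_sub_left
    (intervalIntegrable_control u h0 ht) (intervalIntegrable_control u h0 hs),
    abs_of_nonneg (by linarith)]
  exact (intervalIntegral.norm_integral_le_integral_norm hst).trans
    (integral_norm_control_le hp_top u hs.1 hst ht.2)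

end Primitive

/-! ### Weak convergence through primitives -/

section WeakConvergence

variable {d : ℕ} {p : ℝ≥0∞} [Fact (1 ≤ p)] {ι : Type*} {l : Filter ι}

/-- The primitives of `u i` converge uniformly on `[0, 1]` to the primitive of `v`, along `l`. For
families bounded in `L^p` this is weak convergence. -/
def PrimitiveTendsto (l : Filter ι) (u : ι → Control d p) (v : Control d p) : Prop :=
  ∀ ε > 0, ∀ᶠ i in l, ∀ t ∈ Icc (0 : ℝ) 1, ‖primitive (u i - v) t‖ ≤ ε

theorem PrimitiveTendsto.of_tendsto (hp_top : p ≠ ⊤) {u : ι → Control d p} {v : Control d p}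
    (h : Tendsto u l (𝓝 v)) : PrimitiveTendsto l u v := by
  intro ε hε
  have := (tendsto_iff_norm_sub_tendsto_zero.1 h).eventually (gt_mem_nhds hε)
  filter_upwards [this] with i hi t ht
  exact (norm_primitive_le hp_top _ ht).trans hi.le

theorem PrimitiveTendsto.comp {κ : Type*} {l' : Filter κ} {u : ι → Control d p} {v : Control d p}
    (h : PrimitiveTendsto l u v) {φ : κ → ι} (hφ : Tendsto φ l' l) :
    PrimitiveTendsto l' (fun k => u (φ k)) v :=
  fun ε hε => hφ.eventually (h ε hε)

theorem PrimitiveTendsto.sub {u u' : ι → Control d p} {v v' : Control d p}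
    (h : PrimitiveTendsto l u v) (h' : PrimitiveTendsto l u' v') :
    PrimitiveTendsto l (fun i => u i - u' i) (v - v') := by
  intro ε hε
  filter_upwards [h (ε / 2) (by positivity), h' (ε / 2) (by positivity)] with i h1 h2 t ht
  have : u i - u' i - (v - v') = (u i - v) - (u' i - v') := by abel
  rw [this, primitive_sub _ _ ht]
  linarith [norm_sub_le (primitive (u i - v) t) (primitive (u' i - v') t), h1 t ht, h2 t ht]

theorem PrimitiveTendsto.add {u u' : ι → Control d p} {v v' : Control d p}
    (h : PrimitiveTendsto l u v) (h' : PrimitiveTendsto l u' v') :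
    PrimitiveTendsto l (fun i => u i + u' i) (v + v') := by
  intro ε hε
  filter_upwards [h (ε / 2) (by positivity), h' (ε / 2) (by positivity)] with i h1 h2 t ht
  have : u i + u' i - (v + v') = (u i - v) + (u' i - v') := by abel
  rw [this, primitive_add _ _ ht]
  linarith [norm_add_le (primitive (u i - v) t) (primitive (u' i - v') t), h1 t ht, h2 t ht]

theorem PrimitiveTendsto.const_smul {u : ι → Control d p} {v : Control d p}
    (h : PrimitiveTendsto l u v) (c : ℝ) : PrimitiveTendsto l (fun i => c • u i) (c • v) := by
  intro ε hε
  filter_upwards [h (ε / (|c| + 1)) (by positivity)] with i h1 t ht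
  rw [← smul_sub, primitive_smul _ _ ht, norm_smul, Real.norm_eq_abs]
  have := h1 t ht
  rw [le_div_iff₀ (by positivity)] at this
  nlinarith [norm_nonneg (primitive (u i - v) t)]

/-- A decreasing sequence of bounded nonempty convex sets of controls has a convergent sequence
of elements. -/
theorem exists_tendsto_mem_of_antitone_convex (hp : 1 < p) (hp_top : p ≠ ⊤)
    {K : ℕ → Set (Control d p)} (hanti : Antitone K) (hconv : ∀ m, Convex ℝ (K m))
    (hne : ∀ m, (K m).Nonempty) {R : ℝ} (hR : ∀ m, ∀ z ∈ K m, ‖z‖ ≤ R) :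
    ∃ (z : ℕ → Control d p) (v : Control d p), (∀ m, z m ∈ K m) ∧ Tendsto z atTop (𝓝 v) := by
  -- The infima of the energy over the `K m` increase to a finite limit. Almost minimisers `z k`, `z
  -- l` with `k, l ≥ m` have their midpoint in `K m`, of energy at least `e m`; the midpoint defect
  -- is therefore small and uniform convexity makes `z` Cauchy.
  set e : ℕ → ℝ := fun m => sInf (energy '' K m) with he
  have hbdd : ∀ m, BddBelow (energy '' K m) := fun m =>
    ⟨0, by rintro _ ⟨z, -, rfl⟩; exact energy_nonneg z⟩
  have hmono : Monotone e := fun m m' h =>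
    csInf_le_csInf (hbdd m) ((hne m').image _) (image_mono (hanti h))
  have hup : BddAbove (range e) := by
    refine ⟨d * R ^ p.toReal, ?_⟩
    rintro _ ⟨m, rfl⟩
    obtain ⟨z, hz⟩ := hne m
    exact (csInf_le (hbdd m) (mem_image_of_mem _ hz)).trans
      (energy_le_of_norm_le hp hp_top (hR m z hz))
  have hlim : Tendsto e atTop (𝓝 (⨆ m, e m)) := tendsto_atTop_ciSup hmono hup
  have hex : ∀ m : ℕ, ∃ z ∈ K m, energy z < e m + 1 / ((m : ℝ) + 1) := by
    intro m
    obtain ⟨_, ⟨z, hz, rfl⟩, hlt⟩ := exists_lt_of_csInf_lt ((hne m).image energy)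
      (lt_add_of_pos_right (e m) (show 0 < 1 / ((m : ℝ) + 1) by positivity))
    exact ⟨z, hz, hlt⟩
  choose z hz hze using hex
  have hcauchy : CauchySeq z := by
    rw [cauchySeq_iff_tendsto_dist_atTop_0]
    simp only [dist_eq_norm]
    refine tendsto_norm_sub_of_energy_midpoint (u := fun q : ℕ × ℕ => z q.1)
      (v := fun q : ℕ × ℕ => z q.2) hp hp_top (fun q => hR _ _ (hz q.1)) (fun q => hR _ _ (hz q.2))
      fun ε hε => ?_
    have hev : ∀ᶠ m in atTop, (⨆ m, e m) - ε / 2 < e m :=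
      hlim.eventually (lt_mem_nhds (by linarith))
    have hev2 : ∀ᶠ m : ℕ in atTop, 1 / ((m : ℝ) + 1) < ε / 2 :=
      tendsto_one_div_add_atTop_nhds_zero_nat.eventually (gt_mem_nhds (by positivity))
    obtain ⟨m, hm1, hm2⟩ := (hev.and hev2).exists
    rw [← prod_atTop_atTop_eq]
    have hge : ∀ᶠ k in atTop, m ≤ k := eventually_ge_atTop m
    filter_upwards [hge.prod_mk hge] with q ⟨hq1, hq2⟩
    have hmid : (2⁻¹ : ℝ) • (z q.1 + z q.2) ∈ K m := by
      rw [smul_add]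
      exact hconv m (hanti hq1 (hz _)) (hanti hq2 (hz _)) (by norm_num) (by norm_num) (by norm_num)
    have h1 : e m ≤ energy ((2⁻¹ : ℝ) • (z q.1 + z q.2)) :=
      csInf_le (hbdd m) (mem_image_of_mem _ hmid)
    have h2 : ∀ k, m ≤ k → energy (z k) ≤ (⨆ m, e m) + ε / 2 := by
      intro k hk
      have hk' : (m : ℝ) ≤ k := by exact_mod_cast hk
      have : 1 / ((k : ℝ) + 1) ≤ 1 / ((m : ℝ) + 1) := by gcongr
      linarith [hze k, le_ciSup hup k]
    linarith [h2 _ hq1, h2 _ hq2]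
  obtain ⟨v, hv⟩ := cauchySeq_tendsto_of_complete hcauchy
  exact ⟨z, v, hz, hv⟩

/-- Weak sequential compactness of bounded sets of controls. -/
theorem exists_subseq_primitiveTendsto (hp : 1 < p) (hp_top : p ≠ ⊤) {u : ℕ → Control d p} {R : ℝ}
    (hu : ∀ k, ‖u k‖ ≤ R) :
    ∃ (v : Control d p) (φ : ℕ → ℕ), StrictMono φ ∧ PrimitiveTendsto atTop (fun k => u (φ k)) v := by
  have hP := one_lt_toReal hp hp_top
  have hexp : 0 < 1 - p.toReal⁻¹ := by
    linarith [inv_lt_one_of_one_lt₀ hP]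
  have hR : 0 ≤ R := (norm_nonneg _).trans (hu 0)
  -- A common Hölder modulus, of exponent `1 - 1/p > 0`, gives the equicontinuity needed for
  -- Arzelà–Ascoli.
  have hmod : ∀ (k : ℕ) (s t : Icc (0 : ℝ) 1),
      ‖primitive (u k) t - primitive (u k) s‖ ≤ |(t : ℝ) - s| ^ (1 - p.toReal⁻¹) * R := by
    intro k s t
    refine (norm_primitive_sub_le hp_top (u k) s.2 t.2).trans ?_
    gcongr
    exact hu k
  have hlim0 : ∀ s : Icc (0 : ℝ) 1, Tendsto
      (fun t : Icc (0 : ℝ) 1 => |(t : ℝ) - s| ^ (1 - p.toReal⁻¹) * R) (𝓝 s) (𝓝 0) := by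
    intro s
    have h1 : Tendsto (fun t : Icc (0 : ℝ) 1 => |(t : ℝ) - s|) (𝓝 s) (𝓝 0) := by
      have : Continuous fun t : Icc (0 : ℝ) 1 => |(t : ℝ) - s| := by fun_prop
      simpa using this.tendsto s
    have h2 := (h1.rpow_const (p := 1 - p.toReal⁻¹) (Or.inr hexp.le)).mul_const R
    rwa [Real.zero_rpow hexp.ne', zero_mul] at h2
  have hcont : ∀ k, Continuous fun t : Icc (0 : ℝ) 1 => primitive (u k) t := by
    intro k
    rw [continuous_iff_continuousAt]
    intro s
    exact tendsto_iff_norm_sub_tendsto_zero.2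
      (squeeze_zero (fun _ => norm_nonneg _) (fun t => hmod k s t) (hlim0 s))
  let U : ℕ → BoundedContinuousFunction (Icc (0 : ℝ) 1) (EuclideanSpace ℝ (Fin d)) := fun k =>
    BoundedContinuousFunction.mkOfCompact ⟨_, hcont k⟩
  have hcpt : IsCompact (closure (range U)) := by
    refine BoundedContinuousFunction.arzela_ascoli (Metric.closedBall 0 R)
      (isCompact_closedBall _ _) (range U) ?_ ?_
    · rintro _ t ⟨k, rfl⟩
      rw [mem_closedBall_zero_iff]
      exact (norm_primitive_le hp_top (u k) t.2).trans (hu k)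
    · intro s
      rw [Metric.equicontinuousAt_iff_right]
      intro ε hε
      filter_upwards [(hlim0 s).eventually (gt_mem_nhds hε)] with t ht
      rintro ⟨_, k, rfl⟩
      rw [dist_comm, dist_eq_norm]
      exact (hmod k s t).trans_lt ht
  obtain ⟨U0, -, φ, hφ, hU⟩ := hcpt.tendsto_subseq (x := U)
    fun k => subset_closure (mem_range_self k)
  have hunif : ∀ ε > 0, ∃ m, ∀ k, m ≤ k → ∀ t : Icc (0 : ℝ) 1,
      ‖primitive (u (φ k)) t - U0 t‖ ≤ ε := by
    intro ε hε
    obtain ⟨m, hm⟩ := Metric.tendsto_atTop.1 hU ε hε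
    refine ⟨m, fun k hk t => ?_⟩
    rw [← dist_eq_norm]
    exact (BoundedContinuousFunction.dist_coe_le_dist t).trans (hm k hk).le
  -- The uniform limit `U0` is so far only continuous and must be recognised as the primitive of a
  -- control. Convex combinations of the tail still have primitives near `U0`, and a strongly
  -- convergent selection from the hulls of the tails has as limit a control `v` with primitive
  -- `U0`, in the spirit of Mazur's lemma.
  set K : ℕ → Set (Control d p) := fun m => convexHull ℝ ((fun k => u (φ k)) '' Ici m) with hK
  obtain ⟨z, v, hzK, hzv⟩ := exists_tendsto_mem_of_antitone_convex hp hp_top (K := K) (R := R)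
    (fun m m' h => convexHull_mono (image_mono (Ici_subset_Ici.2 h)))
    (fun m => convex_convexHull ℝ _)
    (fun m => ⟨u (φ m), subset_convexHull ℝ _ ⟨m, self_mem_Ici, rfl⟩⟩)
    (fun m z hz => by
      have : convexHull ℝ ((fun k => u (φ k)) '' Ici m) ⊆ Metric.closedBall 0 R := by
        refine convexHull_min ?_ (convex_closedBall _ _)
        rintro _ ⟨k, -, rfl⟩
        simpa using hu (φ k)
      simpa using this hz)
  have hKU : ∀ ε > 0, ∃ m, ∀ k, m ≤ k → ∀ t : Icc (0 : ℝ) 1, ‖primitive (z k) t - U0 t‖ ≤ ε := by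
    intro ε hε
    obtain ⟨m, hm⟩ := hunif ε hε
    refine ⟨m, fun k hk t => ?_⟩
    have hc : Convex ℝ {w : Control d p | ‖primitive w t - U0 t‖ ≤ ε} := by
      intro w hw w' hw' a b ha hb hab
      simp only [mem_ofPred_eq] at hw hw' ⊢
      rw [primitive_add _ _ t.2, primitive_smul _ _ t.2, primitive_smul _ _ t.2]
      have e : a • primitive w t + b • primitive w' t - U0 t =
          a • (primitive w t - U0 t) + b • (primitive w' t - U0 t) := by
        have : U0 t = (a + b) • U0 t := by rw [hab, one_smul]
        nth_rewrite 1 [this]; module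
      rw [e]
      refine (norm_add_le _ _).trans ?_
      rw [norm_smul, norm_smul, Real.norm_of_nonneg ha, Real.norm_of_nonneg hb]
      calc _ ≤ a * ε + b * ε := by gcongr
        _ = ε := by rw [← add_mul, hab, one_mul]
    have : K k ⊆ {w : Control d p | ‖primitive w t - U0 t‖ ≤ ε} := by
      refine convexHull_min ?_ hc
      rintro _ ⟨j, hj, rfl⟩
      exact hm j (hk.trans hj) t
    exact this (hzK k)
  have hvU : ∀ t : Icc (0 : ℝ) 1, primitive v t = U0 t := by
    intro t
    rw [← sub_eq_zero, ← norm_le_zero_iff]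
    refine le_of_forall_pos_le_add fun ε hε => ?_
    obtain ⟨m, hm⟩ := hKU (ε / 2) (by positivity)
    have hev := (tendsto_iff_norm_sub_tendsto_zero.1 hzv).eventually
      (gt_mem_nhds (show 0 < ε / 2 by positivity))
    obtain ⟨k, hk1, hk2⟩ := (hev.and (eventually_ge_atTop m)).exists
    have h1 := norm_primitive_le hp_top (z k - v) t.2
    rw [primitive_sub _ _ t.2] at h1
    have h2 := hm k hk2 t
    have e : primitive v t - U0 t = (primitive (z k) t - U0 t) -
      (primitive (z k) t - primitive v t) := by abel
    rw [e]
    linarith [norm_sub_le (primitive (z k) t - U0 t) (primitive (z k) t - primitive v t)]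
  refine ⟨v, φ, hφ, fun ε hε => ?_⟩
  obtain ⟨m, hm⟩ := hunif ε hε
  filter_upwards [eventually_ge_atTop m] with k hk t ht
  rw [primitive_sub _ _ ht, hvU ⟨t, ht⟩]
  exact hm k hk ⟨t, ht⟩

end WeakConvergence

/-! ### Absolutely continuous curves and integrals against continuous kernels -/

section AbsoluteContinuity

variable {E F : Type*} [NormedAddCommGroup E] [NormedSpace ℝ E] [NormedAddCommGroup F]
  [NormedSpace ℝ F]

theorem absolutelyContinuous_of_dist_le {X Y : Type*} [PseudoMetricSpace X] [PseudoMetricSpace Y]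
    {f : ℝ → X} {g : ℝ → Y} {a b C : ℝ} (hg : AbsolutelyContinuousOnInterval g a b)
    (h : ∀ s ∈ uIcc a b, ∀ t ∈ uIcc a b, dist (f s) (f t) ≤ C * dist (g s) (g t)) :
    AbsolutelyContinuousOnInterval f a b := by
  unfold AbsolutelyContinuousOnInterval at hg ⊢
  have h0 := Filter.Tendsto.const_mul C hg
  rw [mul_zero] at h0
  refine squeeze_zero' (Eventually.of_forall fun _ => Finset.sum_nonneg fun _ _ => dist_nonneg)
    ?_ h0
  have : ∀ᶠ I in AbsolutelyContinuousOnInterval.totalLengthFilter ⊓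
      𝓟 (AbsolutelyContinuousOnInterval.disjWithin a b),
      I ∈ AbsolutelyContinuousOnInterval.disjWithin a b := mem_inf_of_right (mem_principal_self _)
  filter_upwards [this] with I hI
  rw [Finset.mul_sum]
  exact Finset.sum_le_sum fun i hi => h _ (hI.1 i hi).1 _ (hI.1 i hi).2

theorem absolutelyContinuous_integral [CompleteSpace E] {g : ℝ → E} {a b : ℝ}
    (hg : IntervalIntegrable g volume a b) :
    AbsolutelyContinuousOnInterval (fun t => ∫ s in a..t, g s) a b := by
  refine absolutelyContinuous_of_dist_le (C := 1)
    (hg.norm.absolutelyContinuousOnInterval_intervalIntegral left_mem_uIcc) ?_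
  have hsub : ∀ s ∈ uIcc a b, ∀ t ∈ uIcc a b, IntervalIntegrable g volume s t :=
    fun s hs t ht => hg.mono_set (uIcc_subset_uIcc hs ht)
  intro s hs t ht
  rw [dist_eq_norm, Real.dist_eq, one_mul, intervalIntegral.integral_interval_sub_left
    (hsub a left_mem_uIcc s hs) (hsub a left_mem_uIcc t ht),
    intervalIntegral.integral_interval_sub_left
    (hsub a left_mem_uIcc s hs).norm (hsub a left_mem_uIcc t ht).norm]
  exact intervalIntegral.norm_integral_le_abs_integral_norm

/-- The difference of `f` and the primitive of `g` is absolutely continuous with derivative zero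
almost everywhere, hence constant. -/
theorem eq_add_integral_of_absolutelyContinuous [CompleteSpace E] {f g : ℝ → E} {a b : ℝ}
    (hab : a ≤ b) (hf : AbsolutelyContinuousOnInterval f a b)
    (hg : IntervalIntegrable g volume a b)
    (hder : ∀ᵐ t, t ∈ Ioo a b → HasDerivAt f (g t) t) :
    ∀ t ∈ Icc a b, f t = f a + ∫ s in a..t, g s := by
  have hG := absolutelyContinuous_integral hg
  have hne : ∀ c : ℝ, ∀ᵐ x : ℝ, x ≠ c := fun c => by simp [ae_iff, measure_singleton]
  have h0 : ∀ᵐ x, x ∈ uIcc a b → HasDerivAt (f - fun t => ∫ s in a..t, g s) 0 x := by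
    filter_upwards [hder, hg.ae_hasDerivAt_integral, hne a, hne b] with x h1 h2 h3 h4 hx
    have hx' : x ∈ Ioo a b := by
      rw [uIcc_of_le hab] at hx
      exact ⟨lt_of_le_of_ne hx.1 (Ne.symm h3), lt_of_le_of_ne hx.2 h4⟩
    simpa using (h1 hx').sub (h2 hx a left_mem_uIcc)
  obtain ⟨C, hC⟩ := (hf.sub hG).const_of_ae_hasDerivAt_zero h0
  intro t ht
  have h1 := hC a left_mem_uIcc
  have h2 := hC t (by rwa [uIcc_of_le hab])
  simp only [Pi.sub_apply, intervalIntegral.integral_same, sub_zero] at h1 h2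
  rw [h1, ← h2]; abel

theorem intervalIntegrable_clm_apply {A : ℝ → E →L[ℝ] F} {u : ℝ → E} {a b : ℝ} (hab : a ≤ b)
    (hA : ContinuousOn A (Icc a b)) (hu : IntervalIntegrable u volume a b) :
    IntervalIntegrable (fun s => A s (u s)) volume a b := by
  obtain ⟨C, hC⟩ := isCompact_Icc.exists_bound_of_continuousOn hA
  rw [intervalIntegrable_iff_integrableOn_Icc_of_le hab] at hu ⊢
  refine Integrable.mono' (g := fun s => C * ‖u s‖) (hu.norm.const_mul C) ?_ ?_
  · exact (ContinuousLinearMap.id ℝ (E →L[ℝ] F)).aestronglyMeasurable_comp₂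
      (hA.aestronglyMeasurable_of_isCompact isCompact_Icc measurableSet_Icc) hu.1
  · filter_upwards [ae_restrict_mem measurableSet_Icc] with s hs
    refine ((A s).le_opNorm _).trans ?_
    gcongr
    exact hC s hs

/-- Integrals against a fixed continuous kernel of bounded families with small primitives are
small. -/
theorem exists_norm_integral_clm_apply_le [CompleteSpace E] [CompleteSpace F] {A : ℝ → E →L[ℝ] F} {a b : ℝ}
    (hab : a ≤ b) (hA : ContinuousOn A (Icc a b)) {ε R : ℝ} (hε : 0 < ε) (hR : 0 ≤ R) :
    ∃ κ > 0, ∀ h : ℝ → E, IntervalIntegrable h volume a b → ∫ s in a..b, ‖h s‖ ≤ R →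
      (∀ t ∈ Icc a b, ‖∫ s in a..t, h s‖ ≤ κ) → ∀ t ∈ Icc a b, ‖∫ s in a..t, A s (h s)‖ ≤ ε := by
  obtain ⟨C, hC⟩ := isCompact_Icc.exists_bound_of_continuousOn hA
  have hC0 : 0 ≤ C := (norm_nonneg _).trans (hC a (left_mem_Icc.2 hab))
  -- Subdivide into at most `N` steps of length `δ` and freeze `A` at the left end of each. The
  -- freezing error is at most `η * R ≤ ε / 2` in total; each frozen piece is `A c` applied to a
  -- difference of two primitives, at most `2 * C * κ`, and `κ` is chosen so that `N` of these stay
  -- below `ε / 2`.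
  set η := ε / (2 * (R + 1)) with hη
  have hη0 : 0 < η := by positivity
  obtain ⟨δ, hδ, hunif⟩ := Metric.uniformContinuousOn_iff_le.1
    (isCompact_Icc.uniformContinuousOn_of_continuous hA) η hη0
  obtain ⟨N, hN⟩ := exists_nat_gt ((b - a) / δ)
  set κ := ε / (4 * (N + 1) * (C + 1)) with hκ
  have hκ0 : 0 < κ := by positivity
  refine ⟨κ, hκ0, fun h hint hnorm hprim => ?_⟩
  have hII : ∀ s ∈ Icc a b, ∀ t ∈ Icc a b, IntervalIntegrable h volume s t := fun s hs t ht =>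
    hint.mono_set (by rw [uIcc_of_le hab]; exact uIcc_subset_Icc hs ht)
  have hIA : ∀ s ∈ Icc a b, ∀ t ∈ Icc a b,
      IntervalIntegrable (fun r => A r (h r)) volume s t := fun s hs t ht =>
    (intervalIntegrable_clm_apply hab hA hint).mono_set
      (by rw [uIcc_of_le hab]; exact uIcc_subset_Icc hs ht)
  have haI : a ∈ Icc a b := left_mem_Icc.2 hab
  have hclaim : ∀ j : ℕ, ∀ t ∈ Icc a b, t ≤ a + j * δ →
      ‖∫ s in a..t, A s (h s)‖ ≤ η * (∫ s in a..t, ‖h s‖) + 2 * j * C * κ := by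
    intro j
    induction j with
    | zero =>
      intro t ht htj
      have : t = a := le_antisymm (by simpa using htj) ht.1
      simp [this]
    | succ j ih =>
      intro t ht htj
      push_cast at htj ⊢
      by_cases hcase : t ≤ a + j * δ
      · refine (ih t ht hcase).trans ?_
        have : 0 ≤ C * κ := by positivity
        nlinarith
      · push Not at hcase
        set c := a + j * δ with hc
        have hcI : c ∈ Icc a b := ⟨by rw [hc]; have : 0 ≤ (j : ℝ) * δ := by positivity
                                      linarith, hcase.le.trans ht.2⟩
        have hct : c ≤ t := hcase.le
        have hI1 : IntervalIntegrable (fun r => (A r - A c) (h r)) volume c t := by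
          refine intervalIntegrable_clm_apply hct ((hA.mono ?_).sub continuousOn_const)
            (hII c hcI t ht)
          exact Icc_subset_Icc hcI.1 ht.2
        have hI2 : IntervalIntegrable (fun r => A c (h r)) volume c t :=
          intervalIntegrable_clm_apply hct continuousOn_const (hII c hcI t ht)
        have hsplit : ∫ s in c..t, A s (h s) =
            (∫ s in c..t, (A s - A c) (h s)) + A c (∫ s in c..t, h s) := by
          rw [← ContinuousLinearMap.intervalIntegral_comp_comm _ (hII c hcI t ht),
            ← intervalIntegral.integral_add hI1 hI2]
          simp
        have hb1 : ‖∫ s in c..t, (A s - A c) (h s)‖ ≤ η * ∫ s in c..t, ‖h s‖ := by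
          rw [← intervalIntegral.integral_const_mul]
          refine intervalIntegral.norm_integral_le_of_norm_le hct ?_
            ((hII c hcI t ht).norm.const_mul η)
          refine ae_of_all _ fun s hs => ((A s - A c).le_opNorm _).trans ?_
          gcongr
          rw [← dist_eq_norm]
          refine hunif s ⟨hcI.1.trans hs.1.le, hs.2.trans ht.2⟩ c hcI ?_
          rw [Real.dist_eq, abs_of_nonneg (by linarith [hs.1])]
          have := hs.2
          linarith
        have hb2 : ‖A c (∫ s in c..t, h s)‖ ≤ C * (2 * κ) := by
          refine ((A c).le_opNorm _).trans ?_
          gcongr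
          · exact hC c hcI
          · rw [← intervalIntegral.integral_interval_sub_left (hII a haI t ht) (hII a haI c hcI)]
            linarith [norm_sub_le (∫ s in a..t, h s) (∫ s in a..c, h s), hprim t ht, hprim c hcI]
        have hadd := intervalIntegral.integral_add_adjacent_intervals (hIA a haI c hcI)
          (hIA c hcI t ht)
        have haddn := intervalIntegral.integral_add_adjacent_intervals (hII a haI c hcI).norm
          (hII c hcI t ht).norm
        have hj := ih c hcI le_rfl
        rw [← hadd, ← haddn, hsplit]
        have n1 := norm_add_le (∫ s in a..c, A s (h s))
          ((∫ s in c..t, (A s - A c) (h s)) + A c (∫ s in c..t, h s))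
        have n2 := norm_add_le (∫ s in c..t, (A s - A c) (h s)) (A c (∫ s in c..t, h s))
        nlinarith
  intro t ht
  have htN : t ≤ a + N * δ := by
    have := (div_lt_iff₀ hδ).1 hN
    linarith [ht.2]
  have hfin := hclaim N t ht htN
  have hle : ∫ s in a..t, ‖h s‖ ≤ R := by
    refine le_trans ?_ hnorm
    exact intervalIntegral.integral_mono_interval le_rfl ht.1 ht.2
      (ae_of_all _ fun s => norm_nonneg _) hint.norm
  have e1 : η * (∫ s in a..t, ‖h s‖) ≤ ε / 2 := by
    calc η * (∫ s in a..t, ‖h s‖) ≤ η * R := by gcongr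
      _ ≤ ε / 2 := by
        rw [hη, div_mul_eq_mul_div, div_le_iff₀ (by positivity)]; nlinarith
  have e2 : 2 * N * C * κ ≤ ε / 2 := by
    rw [hκ, mul_div_assoc', div_le_iff₀ (by positivity)]
    have h1 : (0 : ℝ) ≤ N := Nat.cast_nonneg N
    nlinarith [mul_nonneg h1 hC0, mul_nonneg hε.le h1, mul_nonneg hε.le hC0]
  linarith

end AbsoluteContinuity

/-! ### Second differences of `C²` maps -/

section SecondOrder

variable {E F : Type*} [NormedAddCommGroup E] [NormedSpace ℝ E] [NormedAddCommGroup F]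
  [NormedSpace ℝ F]

/-- `g` is bounded and Lipschitz on `K`, and its second differences are controlled by those of the
argument and by the square of its first differences, all with constant `L`. -/
structure SecondOrderBounded (g : E → F) (K : Set E) (L : ℝ) : Prop where
  bound : ∀ x ∈ K, ‖g x‖ ≤ L
  lipschitz : ∀ x ∈ K, ∀ y ∈ K, ‖g x - g y‖ ≤ L * ‖x - y‖
  second : ∀ x ∈ K, ∀ y ∈ K, ∀ z ∈ K, ‖g z - (2 : ℝ) • g y + g x‖ ≤
    L * (‖z - (2 : ℝ) • y + x‖ + (‖z - y‖ + ‖y - x‖) ^ 2)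

theorem SecondOrderBounded.continuousOn {g : E → F} {K : Set E} {L : ℝ}
    (h : SecondOrderBounded g K L) : ContinuousOn g K := by
  rcases K.eq_empty_or_nonempty with rfl | ⟨x, hx⟩
  · exact continuousOn_empty g
  have hL : 0 ≤ L := (norm_nonneg _).trans (h.bound x hx)
  refine (LipschitzOnWith.of_dist_le_mul (K := ⟨L, hL⟩) fun x hx y hy => ?_).continuousOn
  rw [dist_eq_norm, dist_eq_norm]
  exact h.lipschitz x hx y hy

/-- On a compact ball the derivative is bounded and Lipschitz. The second difference is the sum of
two first-order Taylor remainders at the middle point `y`, which are quadratic, and of the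
derivative at `y` applied to the second difference of the arguments. -/
theorem exists_secondOrderBounded [FiniteDimensional ℝ E] {g : E → F} {U : Set E} (hU : IsOpen U)
    (hg : ContDiffOn ℝ 2 g U) {z : E} {r : ℝ} (hr : Metric.closedBall z r ⊆ U) :
    ∃ L, 0 ≤ L ∧ SecondOrderBounded g (Metric.closedBall z r) L := by
  set K := Metric.closedBall z r with hK
  have hcpt : IsCompact K := isCompact_closedBall z r
  have hcv : Convex ℝ K := convex_closedBall z r
  have hdg : ContDiffOn ℝ 1 (fderiv ℝ g) U := hg.fderiv_of_isOpen hU (by norm_num)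
  obtain ⟨L0, hL0⟩ := hcpt.exists_bound_of_continuousOn (hg.continuousOn.mono hr)
  obtain ⟨L1, hL1⟩ := hcpt.exists_bound_of_continuousOn (hdg.continuousOn.mono hr)
  obtain ⟨L2, hL2⟩ := (hdg.mono hr).exists_lipschitzOnWith one_ne_zero hcv hcpt
  have hder : ∀ x ∈ K, HasFDerivWithinAt g (fderiv ℝ g x) K x := fun x hx =>
    ((hg.contDiffAt (hU.mem_nhds (hr hx))).differentiableAt
      (by norm_num)).hasFDerivAt.hasFDerivWithinAt
  have htaylor : ∀ x ∈ K, ∀ y ∈ K, ‖g y - g x - fderiv ℝ g x (y - x)‖ ≤ L2 * ‖y - x‖ ^ 2 := by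
    intro x hx y hy
    have hseg : segment ℝ x y ⊆ K := hcv.segment_subset hx hy
    have := (convex_segment (𝕜 := ℝ) x y).norm_image_sub_le_of_norm_hasFDerivWithin_le'
      (f := g) (f' := fderiv ℝ g) (φ := fderiv ℝ g x) (C := L2 * ‖y - x‖)
      (fun w hw => (hder w (hseg hw)).mono hseg) (fun w hw => ?_)
      (left_mem_segment ℝ x y) (right_mem_segment ℝ x y)
    · exact this.trans_eq (by ring)
    · have h1 := hL2.dist_le_mul w (hseg hw) x hx
      rw [dist_eq_norm, dist_eq_norm] at h1
      refine h1.trans ?_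
      gcongr
      obtain ⟨θ, hθ, rfl⟩ := (segment_eq_image' ℝ x y ▸ hw : w ∈ (fun θ : ℝ => x + θ • (y - x)) '' Icc 0 1)
      rw [add_sub_cancel_left, norm_smul, Real.norm_of_nonneg hθ.1]
      exact mul_le_of_le_one_left (norm_nonneg _) hθ.2
  refine ⟨|L0| + |L1| + L2, by positivity, fun x hx => ?_, fun x hx y hy => ?_,
    fun x hx y hy w hw => ?_⟩
  · refine (hL0 x hx).trans ((le_abs_self _).trans ?_)
    have : 0 ≤ |L1| + (L2 : ℝ) := by positivity
    linarith
  · refine (hcv.norm_image_sub_le_of_norm_hasFDerivWithin_le hder hL1 hy hx).trans ?_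
    gcongr
    have : 0 ≤ |L0| + (L2 : ℝ) := by positivity
    linarith [le_abs_self L1]
  · have e : g w - (2 : ℝ) • g y + g x = (g w - g y - fderiv ℝ g y (w - y)) +
        (g x - g y - fderiv ℝ g y (x - y)) + fderiv ℝ g y (w - (2 : ℝ) • y + x) := by
      have : w - (2 : ℝ) • y + x = (w - y) + (x - y) := by module
      rw [this, map_add]; module
    rw [e]
    have h1 := htaylor y hy w hw
    have h2 := htaylor y hy x hx
    have h3 := ((fderiv ℝ g y).le_opNorm (w - (2 : ℝ) • y + x)).trans
      (mul_le_mul_of_nonneg_right (hL1 y hy) (norm_nonneg _))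
    have h4 := norm_add₃_le (a := g w - g y - fderiv ℝ g y (w - y))
      (b := g x - g y - fderiv ℝ g y (x - y)) (c := fderiv ℝ g y (w - (2 : ℝ) • y + x))
    rw [norm_sub_rev x y] at h2
    have hL2' : (0 : ℝ) ≤ L2 := L2.2
    have n0 := norm_nonneg (w - y)
    have n1 := norm_nonneg (y - x)
    have n2 := norm_nonneg (w - (2 : ℝ) • y + x)
    have k1 : L2 * ‖w - y‖ ^ 2 + L2 * ‖y - x‖ ^ 2 ≤ L2 * (‖w - y‖ + ‖y - x‖) ^ 2 := by
      nlinarith [mul_nonneg hL2' (mul_nonneg n0 n1)]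
    have k2 : L1 * ‖w - (2 : ℝ) • y + x‖ ≤ |L1| * ‖w - (2 : ℝ) • y + x‖ := by
      gcongr; exact le_abs_self _
    have k3 : 0 ≤ (|L0| + |L1|) * (‖w - y‖ + ‖y - x‖) ^ 2 := by positivity
    have k4 : 0 ≤ (|L0| + L2) * ‖w - (2 : ℝ) • y + x‖ := by positivity
    nlinarith

end SecondOrder

/-! ### Gronwall estimates for the integral equation -/

section IntegralEquation

variable {E W : Type*} [NormedAddCommGroup E] [NormedSpace ℝ E] [NormedAddCommGroup W]
  [NormedSpace ℝ W]

/-- `ξ` solves `ξ' = B(ξ) u` on `[a, b]`, in integral form. -/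
structure SolvesOn (B : E → W →L[ℝ] E) (u : ℝ → W) (a b : ℝ) (ξ : ℝ → E) : Prop where
  continuousOn : ContinuousOn ξ (Icc a b)
  eq : ∀ t ∈ Icc a b, ξ t = ξ a + ∫ s in a..t, B (ξ s) (u s)

/-- A Gronwall estimate on an interval so short that no exponential is needed. -/
theorem le_two_mul_of_le_add_integral {e m : ℝ → ℝ} {a b A : ℝ} (hab : a ≤ b)
    (he : ContinuousOn e (Icc a b)) (he0 : ∀ t, 0 ≤ e t) (hm0 : ∀ t, 0 ≤ m t)
    (hm : IntervalIntegrable m volume a b) (hm1 : ∫ s in a..b, m s ≤ 1 / 2)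
    (h : ∀ t ∈ Icc a b, e t ≤ A + ∫ s in a..t, m s * e s) : ∀ t ∈ Icc a b, e t ≤ 2 * A := by
  obtain ⟨t0, ht0, hmax⟩ := isCompact_Icc.exists_isMaxOn (nonempty_Icc.2 hab) he
  have hsub : uIcc a t0 ⊆ uIcc a b := uIcc_subset_uIcc left_mem_uIcc
    (by rw [uIcc_of_le hab]; exact ht0)
  have hm' := hm.mono_set hsub
  have h1 : ∫ s in a..t0, m s * e s ≤ ∫ s in a..t0, m s * e t0 := by
    refine intervalIntegral.integral_mono_on ht0.1
      (hm'.mul_continuousOn (he.mono (by rw [uIcc_of_le ht0.1]; exact Icc_subset_Icc le_rfl ht0.2)))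
      (hm'.mul_const _) fun s hs => ?_
    exact mul_le_mul_of_nonneg_left (hmax ⟨hs.1, hs.2.trans ht0.2⟩) (hm0 s)
  have h2 : ∫ s in a..t0, m s ≤ 1 / 2 := le_trans
    (intervalIntegral.integral_mono_interval le_rfl ht0.1 ht0.2 (ae_of_all _ fun s => hm0 s) hm) hm1
  rw [intervalIntegral.integral_mul_const] at h1
  have h3 := h t0 ht0
  have h4 : e t0 ≤ 2 * A := by nlinarith [he0 t0]
  exact fun t ht => (hmax ht).trans h4

variable {B : E → W →L[ℝ] E} {K : Set E} {L : ℝ}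

theorem SolvesOn.intervalIntegrable {u v : ℝ → W} {a b : ℝ} {ξ : ℝ → E} (hab : a ≤ b)
    (hB : ContinuousOn B K) (h : SolvesOn B u a b ξ) (hK : ∀ t ∈ Icc a b, ξ t ∈ K)
    (hv : IntervalIntegrable v volume a b) {t : ℝ} (ht : t ∈ Icc a b) :
    IntervalIntegrable (fun s => B (ξ s) (v s)) volume a t :=
  (intervalIntegrable_clm_apply hab (hB.comp h.continuousOn hK) hv).mono_set
    (uIcc_subset_uIcc left_mem_uIcc (by rwa [uIcc_of_le hab]))

theorem SolvesOn.norm_sub_le {u : ℝ → W} {a b : ℝ} {ξ : ℝ → E} (hab : a ≤ b)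
    (hB : ∀ x ∈ K, ‖B x‖ ≤ L) (h : SolvesOn B u a b ξ) (hK : ∀ t ∈ Icc a b, ξ t ∈ K)
    (hu : IntervalIntegrable u volume a b) : ‖ξ b - ξ a‖ ≤ L * ∫ s in a..b, ‖u s‖ := by
  rw [h.eq b (right_mem_Icc.2 hab), add_sub_cancel_left, ← intervalIntegral.integral_const_mul]
  refine intervalIntegral.norm_integral_le_of_norm_le hab (ae_of_all _ fun s hs => ?_)
    (hu.norm.const_mul L)
  refine ((B (ξ s)).le_opNorm _).trans ?_
  gcongr
  exact hB _ (hK s ⟨hs.1.le, hs.2⟩)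

/-- Write `B(ξ') u' - B(ξ) u = (B(ξ') - B(ξ)) u' + B(ξ) (u' - u)`. The first term goes into
Gronwall; the second is measured only through its integrals along the fixed curve `ξ`. This form is
what makes weak closeness of `u'` to `u` sufficient. -/
theorem SolvesOn.norm_sub_le_of_integral_le {u u' : ℝ → W} {a b η : ℝ} {ξ ξ' : ℝ → E}
    (hab : a ≤ b) (hL : 0 ≤ L) (hB : SecondOrderBounded B K L) (h : SolvesOn B u a b ξ)
    (h' : SolvesOn B u' a b ξ') (hK : ∀ t ∈ Icc a b, ξ t ∈ K) (hK' : ∀ t ∈ Icc a b, ξ' t ∈ K)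
    (hu : IntervalIntegrable u volume a b) (hu' : IntervalIntegrable u' volume a b)
    (hsmall : L * ∫ s in a..b, ‖u' s‖ ≤ 1 / 2)
    (hη : ∀ t ∈ Icc a b, ‖∫ s in a..t, B (ξ s) (u' s - u s)‖ ≤ η) :
    ∀ t ∈ Icc a b, ‖ξ' t - ξ t‖ ≤ 2 * (‖ξ' a - ξ a‖ + η) := by
  refine le_two_mul_of_le_add_integral (m := fun s => L * ‖u' s‖) hab
    (h'.continuousOn.sub h.continuousOn).norm (fun t => norm_nonneg _) (fun t => by positivity)
    (hu'.norm.const_mul L) (by rwa [intervalIntegral.integral_const_mul]) fun t ht => ?_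
  have hBc := hB.continuousOn
  have i1 := h'.intervalIntegrable hab hBc hK' hu' ht
  have i2 := h.intervalIntegrable hab hBc hK hu ht
  have i3 := h.intervalIntegrable hab hBc hK hu' ht
  have i4 := h.intervalIntegrable hab hBc hK (hu'.sub hu) ht
  have i5 : IntervalIntegrable (fun s => L * ‖u' s‖ * ‖ξ' s - ξ s‖) volume a t := by
    refine ((hu'.norm.const_mul L).mono_set ?_).mul_continuousOn ?_
    · exact uIcc_subset_uIcc left_mem_uIcc (by rwa [uIcc_of_le hab])
    · rw [uIcc_of_le ht.1]
      exact ((h'.continuousOn.sub h.continuousOn).norm).mono (Icc_subset_Icc le_rfl ht.2)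
  have e : ξ' t - ξ t = (ξ' a - ξ a) + (∫ s in a..t, (B (ξ' s) (u' s) - B (ξ s) (u' s))) +
      ∫ s in a..t, B (ξ s) (u' s - u s) := by
    rw [h'.eq t ht, h.eq t ht, intervalIntegral.integral_sub i1 i3]
    simp only [map_sub]
    rw [intervalIntegral.integral_sub i3 i2]
    abel
  rw [e]
  refine norm_add₃_le.trans ?_
  have k1 : ‖∫ s in a..t, (B (ξ' s) (u' s) - B (ξ s) (u' s))‖ ≤
      ∫ s in a..t, L * ‖u' s‖ * ‖ξ' s - ξ s‖ := by
    refine intervalIntegral.norm_integral_le_of_norm_le ht.1 (ae_of_all _ fun s hs => ?_) i5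
    have hs' : s ∈ Icc a b := ⟨hs.1.le, hs.2.trans ht.2⟩
    rw [← _root_.sub_apply]
    refine ((B (ξ' s) - B (ξ s)).le_opNorm _).trans ?_
    calc _ ≤ L * ‖ξ' s - ξ s‖ * ‖u' s‖ := by
          gcongr
          exact hB.lipschitz _ (hK' s hs') _ (hK s hs')
      _ = _ := by ring
  linarith [hη t ht]

/-- For controls in arithmetic progression the second difference of `B(ξ) u` is `(B(ξ₂) - 2 B(ξ₁) +
B(ξ₀)) u₁ + (B(ξ₂) - B(ξ₀)) (u₂ - u₁)`. The first term is linear in the second difference of the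
curves up to `O(D ^ 2)`, the other is `O(D)` times `‖u₂ - u₁‖`, and Gronwall concludes. If `D` and
the control increment are `O(σ)`, the source terms are `O(σ ^ 2)`. -/
theorem SolvesOn.norm_second_difference_le {u₀ u₁ u₂ : ℝ → W} {a b D : ℝ} {ξ₀ ξ₁ ξ₂ : ℝ → E}
    (hab : a ≤ b) (hL : 0 ≤ L) (hB : SecondOrderBounded B K L) (h₀ : SolvesOn B u₀ a b ξ₀)
    (h₁ : SolvesOn B u₁ a b ξ₁) (h₂ : SolvesOn B u₂ a b ξ₂) (hK₀ : ∀ t ∈ Icc a b, ξ₀ t ∈ K)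
    (hK₁ : ∀ t ∈ Icc a b, ξ₁ t ∈ K) (hK₂ : ∀ t ∈ Icc a b, ξ₂ t ∈ K)
    (hu₀ : IntervalIntegrable u₀ volume a b) (hu₁ : IntervalIntegrable u₁ volume a b)
    (hu₂ : IntervalIntegrable u₂ volume a b)
    (hu : ∀ᵐ s, s ∈ uIoc a b → u₁ s - u₀ s = u₂ s - u₁ s)
    (hsmall : L * ∫ s in a..b, ‖u₁ s‖ ≤ 1 / 2)
    (hD : ∀ t ∈ Icc a b, ‖ξ₁ t - ξ₀ t‖ ≤ D) (hD' : ∀ t ∈ Icc a b, ‖ξ₂ t - ξ₁ t‖ ≤ D) :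
    ‖ξ₂ b - (2 : ℝ) • ξ₁ b + ξ₀ b‖ ≤ 2 * (‖ξ₂ a - (2 : ℝ) • ξ₁ a + ξ₀ a‖ +
      (2 * D ^ 2 + 2 * L * D * ∫ s in a..b, ‖u₂ s - u₁ s‖)) := by
  have hD0 : 0 ≤ D := (norm_nonneg _).trans (hD a (left_mem_Icc.2 hab))
  have hcont : ContinuousOn (fun t => ξ₂ t - (2 : ℝ) • ξ₁ t + ξ₀ t) (Icc a b) :=
    (h₂.continuousOn.sub (h₁.continuousOn.const_smul 2)).add h₀.continuousOn
  refine le_two_mul_of_le_add_integral (m := fun s => L * ‖u₁ s‖) hab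
    hcont.norm (fun t => norm_nonneg _) (fun t => by positivity)
    (hu₁.norm.const_mul L) (by rwa [intervalIntegral.integral_const_mul]) (fun t ht => ?_) b
    (right_mem_Icc.2 hab)
  have hBc := hB.continuousOn
  have hsub : uIcc a t ⊆ uIcc a b :=
    uIcc_subset_uIcc left_mem_uIcc (by rwa [uIcc_of_le hab])
  have i0 := h₀.intervalIntegrable hab hBc hK₀ hu₀ ht
  have i1 := h₁.intervalIntegrable hab hBc hK₁ hu₁ ht
  have i2 := h₂.intervalIntegrable hab hBc hK₂ hu₂ ht
  have i5 : IntervalIntegrable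
      (fun s => L * ‖u₁ s‖ * ‖ξ₂ s - (2 : ℝ) • ξ₁ s + ξ₀ s‖) volume a t := by
    refine ((hu₁.norm.const_mul L).mono_set hsub).mul_continuousOn ?_
    rw [uIcc_of_le ht.1]
    exact hcont.norm.mono (Icc_subset_Icc le_rfl ht.2)
  have i6 : IntervalIntegrable (fun s => 4 * D ^ 2 * (L * ‖u₁ s‖)) volume a b :=
    (hu₁.norm.const_mul L).const_mul _
  have i7 : IntervalIntegrable (fun s => 2 * L * D * ‖u₂ s - u₁ s‖) volume a b :=
    (hu₂.sub hu₁).norm.const_mul _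
  have e : ξ₂ t - (2 : ℝ) • ξ₁ t + ξ₀ t = (ξ₂ a - (2 : ℝ) • ξ₁ a + ξ₀ a) +
      ∫ s in a..t, (B (ξ₂ s) (u₂ s) - (2 : ℝ) • B (ξ₁ s) (u₁ s) + B (ξ₀ s) (u₀ s)) := by
    have i1' : IntervalIntegrable (fun s => (2 : ℝ) • B (ξ₁ s) (u₁ s)) volume a t :=
      i1.smul (2 : ℝ)
    have i21 : IntervalIntegrable (fun s => B (ξ₂ s) (u₂ s) - (2 : ℝ) • B (ξ₁ s) (u₁ s))
      volume a t := i2.sub i1'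
    rw [intervalIntegral.integral_add i21 i0, intervalIntegral.integral_sub i2 i1', intervalIntegral.integral_smul,
      h₂.eq t ht, h₁.eq t ht, h₀.eq t ht]
    module
  rw [e]
  refine (norm_add_le _ _).trans ?_
  rw [add_assoc]
  refine add_le_add le_rfl ?_
  have k1 : ‖∫ s in a..t, (B (ξ₂ s) (u₂ s) - (2 : ℝ) • B (ξ₁ s) (u₁ s) + B (ξ₀ s) (u₀ s))‖ ≤
      ∫ s in a..t, (L * ‖u₁ s‖ * ‖ξ₂ s - (2 : ℝ) • ξ₁ s + ξ₀ s‖ +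
        (4 * D ^ 2 * (L * ‖u₁ s‖) + 2 * L * D * ‖u₂ s - u₁ s‖)) := by
    refine intervalIntegral.norm_integral_le_of_norm_le ht.1 ?_
      (i5.add ((i6.mono_set hsub).add (i7.mono_set hsub)))
    filter_upwards [hu] with s hsu hs
    have hs' : s ∈ Icc a b := ⟨hs.1.le, hs.2.trans ht.2⟩
    have hsu' := hsu (by rw [uIoc_of_le hab]; exact ⟨hs.1, hs.2.trans ht.2⟩)
    have e2 : B (ξ₂ s) (u₂ s) - (2 : ℝ) • B (ξ₁ s) (u₁ s) + B (ξ₀ s) (u₀ s) =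
        (B (ξ₂ s) - (2 : ℝ) • B (ξ₁ s) + B (ξ₀ s)) (u₁ s) +
          (B (ξ₂ s) - B (ξ₀ s)) (u₂ s - u₁ s) := by
      have : u₀ s = u₁ s - (u₂ s - u₁ s) := by rw [← hsu']; abel
      rw [this]
      simp only [_root_.add_apply, _root_.sub_apply,
        _root_.smul_apply, map_sub]
      module
    rw [e2]
    have q1 : ‖ξ₂ s - ξ₁ s‖ + ‖ξ₁ s - ξ₀ s‖ ≤ 2 * D := by linarith [hD s hs', hD' s hs']
    have n1 : ‖(B (ξ₂ s) - (2 : ℝ) • B (ξ₁ s) + B (ξ₀ s)) (u₁ s)‖ ≤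
        L * (‖ξ₂ s - (2 : ℝ) • ξ₁ s + ξ₀ s‖ + (2 * D) ^ 2) * ‖u₁ s‖ := by
      refine (ContinuousLinearMap.le_opNorm _ _).trans ?_
      gcongr
      refine (hB.second _ (hK₀ s hs') _ (hK₁ s hs') _ (hK₂ s hs')).trans ?_
      gcongr
    have n2 : ‖(B (ξ₂ s) - B (ξ₀ s)) (u₂ s - u₁ s)‖ ≤ L * (2 * D) * ‖u₂ s - u₁ s‖ := by
      refine (ContinuousLinearMap.le_opNorm _ _).trans ?_
      gcongr
      refine (hB.lipschitz _ (hK₂ s hs') _ (hK₀ s hs')).trans ?_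
      gcongr
      have : ξ₂ s - ξ₀ s = (ξ₂ s - ξ₁ s) + (ξ₁ s - ξ₀ s) := by abel
      rw [this]
      exact (norm_add_le _ _).trans q1
    refine (norm_add_le _ _).trans ((add_le_add n1 n2).trans_eq ?_)
    ring
  refine k1.trans ?_
  rw [intervalIntegral.integral_add i5 ((i6.mono_set hsub).add (i7.mono_set hsub)),
    intervalIntegral.integral_add (i6.mono_set hsub) (i7.mono_set hsub), add_comm]
  refine add_le_add (add_le_add ?_ ?_) le_rfl
  · have := intervalIntegral.integral_mono_interval le_rfl ht.1 ht.2
      (ae_of_all _ fun s => by positivity) i6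
    refine this.trans ?_
    rw [intervalIntegral.integral_const_mul, intervalIntegral.integral_const_mul]
    nlinarith [sq_nonneg D]
  · have := intervalIntegral.integral_mono_interval le_rfl ht.1 ht.2
      (ae_of_all _ fun s => by positivity) i7
    exact this.trans_eq (intervalIntegral.integral_const_mul _ _)

end IntegralEquation

/-! ### The control system in charts and changes of coordinates -/

section ChartFields

variable {n d : ℕ} {M : Type*} [TopologicalSpace M] [ChartedSpace (EuclideanSpace ℝ (Fin n)) M]

/-- The differential at `q` of the chart at `c`, as an endomorphism of the model space. -/
noncomputable def chartDifferential (c q : M) :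
    EuclideanSpace ℝ (Fin n) →L[ℝ] EuclideanSpace ℝ (Fin n) :=
  mfderiv (𝓡 n) 𝓘(ℝ, EuclideanSpace ℝ (Fin n)) (extChartAt (𝓡 n) c) q

/-- The value at `q` of a vector field, as an element of the model space. -/
def fieldValue (V : (q : M) → TangentSpace (𝓡 n) q) (q : M) : EuclideanSpace ℝ (Fin n) := V q

/-- The velocity `X₀ + ∑ i, v i • X i` of the system at `q`, as an element of the model space. -/
noncomputable def systemVelocity (X₀ : (q : M) → TangentSpace (𝓡 n) q)
    (X : Fin d → (q : M) → TangentSpace (𝓡 n) q) (q : M) (v : EuclideanSpace ℝ (Fin d)) :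
    EuclideanSpace ℝ (Fin n) :=
  fieldValue X₀ q + ∑ i, v i • fieldValue (X i) q

/-- The coordinate expression of a vector field in the chart at `c`. -/
noncomputable def chartField (V : (q : M) → TangentSpace (𝓡 n) q) (c : M)
    (z : EuclideanSpace ℝ (Fin n)) : EuclideanSpace ℝ (Fin n) :=
  chartDifferential c ((extChartAt (𝓡 n) c).symm z) (fieldValue V ((extChartAt (𝓡 n) c).symm z))

theorem chartField_apply (V : (q : M) → TangentSpace (𝓡 n) q) {c q : M}
    (hq : q ∈ (chartAt (EuclideanSpace ℝ (Fin n)) c).source) :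
    chartField V c (extChartAt (𝓡 n) c q) = chartDifferential c q (fieldValue V q) := by
  unfold chartField
  rw [(extChartAt (𝓡 n) c).left_inv (by rwa [extChartAt_source])]

/-- In the trivialisation of the tangent bundle at `c`, the coordinate of a vector is the chart
differential applied to it; smoothness of the section is then read off there and composed with the
inverse chart. -/
theorem contDiffOn_chartField [IsManifold (𝓡 n) ∞ M] {V : (q : M) → TangentSpace (𝓡 n) q}
    (hV : IsSmoothField V) (c : M) :
    ContDiffOn ℝ ∞ (chartField V c) (extChartAt (𝓡 n) c).target := by
  rw [← contMDiffOn_iff_contDiffOn]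
  have h1 : ContMDiffOn (𝓡 n) 𝓘(ℝ, EuclideanSpace ℝ (Fin n)) ∞
      (fun q : M => chartDifferential c q (fieldValue V q))
      (chartAt (EuclideanSpace ℝ (Fin n)) c).source := by
    intro q hq
    have hbase : q ∈ (trivializationAt (EuclideanSpace ℝ (Fin n))
        (TangentSpace (𝓡 n) : M → Type _) c).baseSet := by simpa using hq
    have h2 := (Bundle.Trivialization.contMDiffAt_section_iff
      (trivializationAt (EuclideanSpace ℝ (Fin n)) (TangentSpace (𝓡 n) : M → Type _) c)
      hbase).1 (hV q)
    refine (h2.congr_of_eventuallyEq ?_).contMDiffWithinAt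
    filter_upwards [(chartAt (EuclideanSpace ℝ (Fin n)) c).open_source.mem_nhds hq] with q' hq'
    have hbase' : q' ∈ (trivializationAt (EuclideanSpace ℝ (Fin n))
        (TangentSpace (𝓡 n) : M → Type _) c).baseSet := by simpa using hq'
    have h3 := congrFun (Bundle.Trivialization.coe_linearMapAt_of_mem (R := ℝ) _ hbase') (V q')
    exact (DFunLike.congr_fun (TangentBundle.continuousLinearMapAt_trivializationAt
      (I := 𝓡 n) hq') (V q')).symm.trans h3
  refine h1.comp (contMDiffOn_extChartAt_symm c) fun z hz => ?_
  rw [← extChartAt_source (𝓡 n)]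
  exact (extChartAt (𝓡 n) c).map_target hz

/-- The system in the chart at `c`, driven by extended controls `(1, u)`. -/
noncomputable def systemField (X₀ : (q : M) → TangentSpace (𝓡 n) q)
    (X : Fin d → (q : M) → TangentSpace (𝓡 n) q) (c : M) (z : EuclideanSpace ℝ (Fin n)) :
    ℝ × EuclideanSpace ℝ (Fin d) →L[ℝ] EuclideanSpace ℝ (Fin n) :=
  (ContinuousLinearMap.toSpanSingleton ℝ (chartField X₀ c z)).comp
      (ContinuousLinearMap.fst ℝ ℝ (EuclideanSpace ℝ (Fin d))) +
    ∑ i, (ContinuousLinearMap.toSpanSingleton ℝ (chartField (X i) c z)).comp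
      ((EuclideanSpace.proj i : EuclideanSpace ℝ (Fin d) →L[ℝ] ℝ).comp
        (ContinuousLinearMap.snd ℝ ℝ (EuclideanSpace ℝ (Fin d))))

theorem systemField_apply (X₀ : (q : M) → TangentSpace (𝓡 n) q)
    (X : Fin d → (q : M) → TangentSpace (𝓡 n) q) (c : M) (z : EuclideanSpace ℝ (Fin n))
    (w : ℝ × EuclideanSpace ℝ (Fin d)) : systemField X₀ X c z w =
      w.1 • chartField X₀ c z + ∑ i, w.2 i • chartField (X i) c z := by
  simp [systemField]

theorem systemField_extChartAt (X₀ : (q : M) → TangentSpace (𝓡 n) q)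
    (X : Fin d → (q : M) → TangentSpace (𝓡 n) q) {c q : M}
    (hq : q ∈ (chartAt (EuclideanSpace ℝ (Fin n)) c).source) (v : EuclideanSpace ℝ (Fin d)) :
    systemField X₀ X c (extChartAt (𝓡 n) c q) ((1 : ℝ), v) =
      chartDifferential c q (systemVelocity X₀ X q v) := by
  simp only [systemField_apply, chartField_apply _ hq, one_smul, systemVelocity, map_add, map_sum,
    map_smul]

theorem contDiffOn_systemField [IsManifold (𝓡 n) ∞ M] {X₀ : (q : M) → TangentSpace (𝓡 n) q}
    {X : Fin d → (q : M) → TangentSpace (𝓡 n) q} (hX₀ : IsSmoothField X₀)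
    (hX : ∀ i, IsSmoothField (X i)) (c : M) :
    ContDiffOn ℝ ∞ (systemField X₀ X c) (extChartAt (𝓡 n) c).target := by
  have key : ∀ (L : ℝ × EuclideanSpace ℝ (Fin d) →L[ℝ] ℝ) (f : EuclideanSpace ℝ (Fin n) →
      EuclideanSpace ℝ (Fin n)), ContDiffOn ℝ ∞ f (extChartAt (𝓡 n) c).target →
      ContDiffOn ℝ ∞ (fun z => (ContinuousLinearMap.toSpanSingleton ℝ (f z)).comp L)
        (extChartAt (𝓡 n) c).target := by
    intro L f hf
    have : (fun z => (ContinuousLinearMap.toSpanSingleton ℝ (f z)).comp L) =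
        fun z => ContinuousLinearMap.smulRightL ℝ _ _ L (f z) := by
      funext z
      exact ContinuousLinearMap.ext fun w => by simp
    rw [this]
    exact (ContinuousLinearMap.contDiff _).comp_contDiffOn hf
  unfold systemField
  refine (key _ _ (contDiffOn_chartField hX₀ c)).add (ContDiffOn.sum fun i _ => ?_)
  exact key _ _ (contDiffOn_chartField (hX i) c)

/-- The change of coordinates between the charts at `c` and `c'`. -/
noncomputable def coordChange (c c' : M) (z : EuclideanSpace ℝ (Fin n)) :
    EuclideanSpace ℝ (Fin n) :=
  extChartAt (𝓡 n) c' ((extChartAt (𝓡 n) c).symm z)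

/-- The domain of the change of coordinates between the charts at `c` and `c'`. -/
def coordDomain (c c' : M) : Set (EuclideanSpace ℝ (Fin n)) :=
  (extChartAt (𝓡 n) c).target ∩
    (extChartAt (𝓡 n) c).symm ⁻¹' (chartAt (EuclideanSpace ℝ (Fin n)) c').source

theorem isOpen_coordDomain (c c' : M) :
    IsOpen (coordDomain c c' : Set (EuclideanSpace ℝ (Fin n))) :=
  (continuousOn_extChartAt_symm c).isOpen_inter_preimage (isOpen_extChartAt_target c)
    (chartAt _ c').open_source

theorem coordChange_apply {c c' q : M}
    (hq : q ∈ (chartAt (EuclideanSpace ℝ (Fin n)) c).source) :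
    coordChange c c' (extChartAt (𝓡 n) c q) = extChartAt (𝓡 n) c' q := by
  unfold coordChange
  rw [(extChartAt (𝓡 n) c).left_inv (by rwa [extChartAt_source])]

theorem extChartAt_mem_coordDomain {c c' q : M}
    (hq : q ∈ (chartAt (EuclideanSpace ℝ (Fin n)) c).source)
    (hq' : q ∈ (chartAt (EuclideanSpace ℝ (Fin n)) c').source) :
    extChartAt (𝓡 n) c q ∈ coordDomain c c' := by
  refine ⟨(extChartAt (𝓡 n) c).map_source (by rwa [extChartAt_source]), ?_⟩
  rw [mem_preimage, (extChartAt (𝓡 n) c).left_inv (by rwa [extChartAt_source])]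
  exact hq'

theorem contDiffOn_coordChange [IsManifold (𝓡 n) ∞ M] (c c' : M) :
    ContDiffOn ℝ ∞ (coordChange c c' : EuclideanSpace ℝ (Fin n) → _) (coordDomain c c') := by
  rw [← contMDiffOn_iff_contDiffOn]
  exact (contMDiffOn_extChartAt (I := 𝓡 n) (x := c')).comp
    ((contMDiffOn_extChartAt_symm c).mono inter_subset_left) fun z hz => hz.2

/-- The chain rule: near a point of both domains the chart at `c'` is the coordinate change composed
with the chart at `c`. -/
theorem systemField_coordChange [IsManifold (𝓡 n) ∞ M] (X₀ : (q : M) → TangentSpace (𝓡 n) q)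
    (X : Fin d → (q : M) → TangentSpace (𝓡 n) q) {c c' : M} {z : EuclideanSpace ℝ (Fin n)}
    (hz : z ∈ coordDomain c c') (v : EuclideanSpace ℝ (Fin d)) :
    systemField X₀ X c' (coordChange c c' z) ((1 : ℝ), v) =
      fderiv ℝ (coordChange c c') z (systemField X₀ X c z ((1 : ℝ), v)) := by
  set q := (extChartAt (𝓡 n) c).symm z with hq
  have hqs : q ∈ (chartAt (EuclideanSpace ℝ (Fin n)) c).source := by
    rw [← extChartAt_source (𝓡 n)]; exact (extChartAt (𝓡 n) c).map_target hz.1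
  have hqs' : q ∈ (chartAt (EuclideanSpace ℝ (Fin n)) c').source := hz.2
  have hzq : z = extChartAt (𝓡 n) c q := ((extChartAt (𝓡 n) c).right_inv hz.1).symm
  have hd : HasMFDerivAt 𝓘(ℝ, EuclideanSpace ℝ (Fin n)) 𝓘(ℝ, EuclideanSpace ℝ (Fin n))
      (coordChange c c') (extChartAt (𝓡 n) c q) (fderiv ℝ (coordChange c c') z) := by
    rw [← hzq, hasMFDerivAt_iff_hasFDerivAt]
    exact (((contDiffOn_coordChange c c').contDiffAt
      ((isOpen_coordDomain c c').mem_nhds hz)).differentiableAt (by simp)).hasFDerivAt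
  have hcomp := hd.comp q (mdifferentiableAt_extChartAt (I := 𝓡 n) hqs).hasMFDerivAt
  have heq : (coordChange c c' ∘ extChartAt (𝓡 n) c) =ᶠ[𝓝 q] extChartAt (𝓡 n) c' := by
    filter_upwards [(chartAt (EuclideanSpace ℝ (Fin n)) c).open_source.mem_nhds hqs] with q' hq'
    exact coordChange_apply hq'
  have h3 := (hcomp.congr_of_eventuallyEq heq.symm).mfderiv
  have h4 : coordChange c c' z = extChartAt (𝓡 n) c' q := rfl
  rw [h4, systemField_extChartAt X₀ X hqs', chartDifferential, h3]
  conv_rhs => enter [2]; rw [hzq]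
  rw [systemField_extChartAt X₀ X hqs]
  rfl

end ChartFields

/-! ### Trajectories as solutions of integral equations -/

section Trajectories

variable {n d : ℕ} {M : Type*} [TopologicalSpace M] [ChartedSpace (EuclideanSpace ℝ (Fin n)) M]
  [IsManifold (𝓡 n) ∞ M] {p : ℝ≥0∞}

/-- The extended control `(1, u)`. -/
noncomputable def extendedControl (u : Control d p) (t : ℝ) : ℝ × EuclideanSpace ℝ (Fin d) :=
  (1, u t)

theorem intervalIntegrable_extendedControl [Fact (1 ≤ p)] (u : Control d p) {a b : ℝ}
    (ha : a ∈ Icc (0 : ℝ) 1) (hb : b ∈ Icc (0 : ℝ) 1) :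
    IntervalIntegrable (extendedControl u) volume a b := by
  have h := intervalIntegrable_control u ha hb
  rw [intervalIntegrable_iff] at h ⊢
  have h1 : IntegrableOn (fun _ => (1 : ℝ)) (uIoc a b) := by
    rw [← intervalIntegrable_iff]; exact intervalIntegrable_const
  exact Integrable.prodMk h1 h

theorem integral_norm_extendedControl_le [Fact (1 ≤ p)] (hp_top : p ≠ ⊤) (u : Control d p)
    {a b : ℝ} (ha : 0 ≤ a) (hab : a ≤ b) (hb : b ≤ 1) :
    ∫ t in a..b, ‖extendedControl u t‖ ≤ (b - a) + (b - a) ^ (1 - p.toReal⁻¹) * ‖u‖ := by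
  have haI : a ∈ Icc (0 : ℝ) 1 := ⟨ha, hab.trans hb⟩
  have hbI : b ∈ Icc (0 : ℝ) 1 := ⟨ha.trans hab, hb⟩
  have h1 := (intervalIntegrable_control u haI hbI).norm
  calc ∫ t in a..b, ‖extendedControl u t‖ ≤ ∫ t in a..b, (1 + ‖u t‖) := by
        refine intervalIntegral.integral_mono_on hab
          (intervalIntegrable_extendedControl u haI hbI).norm
          (intervalIntegrable_const.add h1) fun t _ => ?_
        rw [extendedControl, Prod.norm_mk, norm_one]
        exact max_le (by linarith [norm_nonneg (u t)]) (by linarith)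
    _ = (b - a) + ∫ t in a..b, ‖u t‖ := by
        rw [intervalIntegral.integral_add intervalIntegrable_const h1]; simp
    _ ≤ _ := by
        gcongr
        exact integral_norm_control_le hp_top u ha hab hb

/-- `γ` solves the system driven by `u` on `[a, b]`, in integral form in every chart. -/
structure SolvesChartwiseOn (X₀ : (q : M) → TangentSpace (𝓡 n) q)
    (X : Fin d → (q : M) → TangentSpace (𝓡 n) q) (u : Control d p) (a b : ℝ) (γ : ℝ → M) :
    Prop where
  continuousOn : ContinuousOn γ (Icc a b)
  solvesOn : ∀ (c : M) (a' b' : ℝ), a ≤ a' → a' ≤ b' → b' ≤ b →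
    MapsTo γ (Icc a' b') (chartAt (EuclideanSpace ℝ (Fin n)) c).source →
    SolvesOn (systemField X₀ X c) (extendedControl u) a' b' (fun t => extChartAt (𝓡 n) c (γ t))

variable {X₀ : (q : M) → TangentSpace (𝓡 n) q} {X : Fin d → (q : M) → TangentSpace (𝓡 n) q}

/-- The chain rule turns the almost everywhere velocity into that of the coordinate curve, and
absolute continuity allows it to be integrated. All stability estimates use only the resulting
integral equation. -/
theorem IsTrajectory.solvesChartwiseOn [Fact (1 ≤ p)] (hX₀ : IsSmoothField X₀)
    (hX : ∀ i, IsSmoothField (X i)) {x : M} {u : Control d p} {γ : ℝ → M}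
    (h : IsTrajectory X₀ X x u γ) : SolvesChartwiseOn X₀ X u 0 1 γ := by
  refine ⟨h.absolutelyContinuous.1, fun c a b ha hab hb hmaps => ?_⟩
  have hsub : Icc a b ⊆ Icc (0 : ℝ) 1 := Icc_subset_Icc ha hb
  have hcont : ContinuousOn (fun t => extChartAt (𝓡 n) c (γ t)) (Icc a b) :=
    (continuousOn_extChartAt c).comp (h.absolutelyContinuous.1.mono hsub)
      fun t ht => by rw [extChartAt_source]; exact hmaps ht
  refine ⟨hcont, ?_⟩
  have haI : a ∈ Icc (0 : ℝ) 1 := hsub (left_mem_Icc.2 hab)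
  have hbI : b ∈ Icc (0 : ℝ) 1 := hsub (right_mem_Icc.2 hab)
  have hfield : ContinuousOn (fun t => systemField X₀ X c (extChartAt (𝓡 n) c (γ t))) (Icc a b) :=
    (contDiffOn_systemField hX₀ hX c).continuousOn.comp hcont fun t ht =>
      (extChartAt (𝓡 n) c).map_source (by rw [extChartAt_source]; exact hmaps ht)
  refine eq_add_integral_of_absolutelyContinuous hab
    (h.absolutelyContinuous.2 c a b hab hsub hmaps)
    (intervalIntegrable_clm_apply hab hfield (intervalIntegrable_extendedControl u haI hbI)) ?_
  filter_upwards [(ae_restrict_iff' measurableSet_Icc).1 h.velocity] with t ht htab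
  have htI : t ∈ Icc a b := Ioo_subset_Icc_self htab
  have hcomp := (mdifferentiableAt_extChartAt (I := 𝓡 n) (hmaps htI)).hasMFDerivAt.comp t
    (ht (hsub htI))
  have hder : HasFDerivAt (extChartAt (𝓡 n) c ∘ γ) ((chartDifferential c (γ t)).comp
      (ContinuousLinearMap.toSpanSingleton ℝ (systemVelocity X₀ X (γ t) (u t)))) t :=
    hasMFDerivAt_iff_hasFDerivAt.1 hcomp
  have he : ((chartDifferential c (γ t)).comp (ContinuousLinearMap.toSpanSingleton ℝ
      (systemVelocity X₀ X (γ t) (u t)))) (1 : ℝ) =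
      chartDifferential c (γ t) (systemVelocity X₀ X (γ t) (u t)) := by simp
  rw [extendedControl, systemField_extChartAt X₀ X (hmaps htI), ← he]
  exact hder.hasDerivAt

end Trajectories

/-- Induction along a compact interval: a property of points which propagates forward locally
propagates to the whole interval. -/
theorem forall_mem_Icc_of_local_step {α β : ℝ} {P : ℝ → Prop} (h0 : P α)
    (hstep : ∀ t₀ ∈ Icc α β, ∃ ε > 0, ∀ a ∈ Icc α β, ∀ b ∈ Icc α β, |a - t₀| < ε → |b - t₀| < ε →
      a ≤ b → P a → P b) : ∀ t ∈ Icc α β, P t := by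
  intro T hT
  choose! ε hε hP using hstep
  -- The local step sizes give an open cover of `[α, T]`; a monotone subdivision with each piece
  -- inside one member, eventually equal to `T`, carries `P` along in finitely many steps.
  let c : Icc α T → Set (Icc α T) := fun s => {t | |(t : ℝ) - s| < ε s}
  have hIcc : ∀ s : Icc α T, (s : ℝ) ∈ Icc α β := fun s => ⟨s.2.1, s.2.2.trans hT.2⟩
  obtain ⟨t, ht0, hmono, ⟨m, hm⟩, hsub⟩ := exists_monotone_Icc_subset_open_cover_Icc hT.1 (c := c)
    (fun s => isOpen_lt (by fun_prop) continuous_const)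
    (fun s _ => mem_iUnion.2 ⟨s, by simpa [c] using hε s (hIcc s)⟩)
  have hind : ∀ k : ℕ, P (t k) := by
    intro k
    induction k with
    | zero => rw [ht0]; exact h0
    | succ k ih =>
      obtain ⟨s, hs⟩ := hsub k
      exact hP s (hIcc s) _ (hIcc _) _ (hIcc _) (hs (left_mem_Icc.2 (hmono k.le_succ)))
        (hs (right_mem_Icc.2 (hmono k.le_succ))) (hmono k.le_succ) ih
  have := hind m
  rwa [hm m le_rfl] at this

/-! ### Weak continuity of solutions with respect to the control -/

section Stability

variable {n d : ℕ} {M : Type*} [TopologicalSpace M] [ChartedSpace (EuclideanSpace ℝ (Fin n)) M]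
  {p : ℝ≥0∞} [Fact (1 ≤ p)] {X₀ : (q : M) → TangentSpace (𝓡 n) q}
  {X : Fin d → (q : M) → TangentSpace (𝓡 n) q}

theorem SolvesChartwiseOn.mono {u : Control d p} {a b a' b' : ℝ} {γ : ℝ → M}
    (h : SolvesChartwiseOn X₀ X u a b γ) (ha : a ≤ a') (hb : b' ≤ b) :
    SolvesChartwiseOn X₀ X u a' b' γ :=
  ⟨h.continuousOn.mono (Icc_subset_Icc ha hb),
    fun c s t hs hst ht hm => h.solvesOn c s t (ha.trans hs) hst (ht.trans hb) hm⟩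

/-- A solution which starts close to the centre of a coordinate ball does not leave it in a short
time. -/
theorem SolvesChartwiseOn.mem_closedBall [T2Space M] {u : Control d p} {a b r L : ℝ} {γ : ℝ → M}
    {c : M} {z : EuclideanSpace ℝ (Fin n)} (ha : 0 ≤ a) (hb : b ≤ 1)
    (h : SolvesChartwiseOn X₀ X u a b γ) (hL : 0 ≤ L)
    (hball : Metric.closedBall z (2 * r) ⊆ (extChartAt (𝓡 n) c).target)
    (hB : ∀ w ∈ Metric.closedBall z (2 * r), ‖systemField X₀ X c w‖ ≤ L)
    (hsmall : L * ∫ t in a..b, ‖extendedControl u t‖ < r)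
    (hsrc : γ a ∈ (chartAt (EuclideanSpace ℝ (Fin n)) c).source)
    (hinit : extChartAt (𝓡 n) c (γ a) ∈ Metric.ball z r) :
    ∀ t ∈ Icc a b, γ t ∈ (chartAt (EuclideanSpace ℝ (Fin n)) c).source ∧
      extChartAt (𝓡 n) c (γ t) ∈ Metric.closedBall z (2 * r) := by
  have hr : 0 < r := (dist_nonneg).trans_lt (Metric.mem_ball.1 hinit)
  set U : Set M := (extChartAt (𝓡 n) c).source ∩
    extChartAt (𝓡 n) c ⁻¹' Metric.ball z (2 * r) with hU
  have hUopen : IsOpen U := (continuousOn_extChartAt c).isOpen_inter_preimage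
    (isOpen_extChartAt_source c) Metric.isOpen_ball
  -- As the image of a compact ball in a Hausdorff space, `K` is closed. Hence at the first exit
  -- time `T` from `U` the curve is still in the chart domain, where the displacement bound, less
  -- than `r`, puts it back in `U`.
  set K : Set M := (extChartAt (𝓡 n) c).symm '' Metric.closedBall z (2 * r) with hK
  have hKclosed : IsClosed K :=
    ((isCompact_closedBall z (2 * r)).image_of_continuousOn
      ((continuousOn_extChartAt_symm c).mono hball)).isClosed
  have hUK : U ⊆ K := fun q hq => ⟨extChartAt (𝓡 n) c q, Metric.ball_subset_closedBall hq.2,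
    (extChartAt (𝓡 n) c).left_inv hq.1⟩
  have hKprop : ∀ q ∈ K, q ∈ (chartAt (EuclideanSpace ℝ (Fin n)) c).source ∧
      extChartAt (𝓡 n) c q ∈ Metric.closedBall z (2 * r) := by
    rintro _ ⟨w, hw, rfl⟩
    rw [(extChartAt (𝓡 n) c).right_inv (hball hw), ← extChartAt_source (𝓡 n)]
    exact ⟨(extChartAt (𝓡 n) c).map_target (hball hw), hw⟩
  suffices hin : ∀ t ∈ Icc a b, γ t ∈ U from fun t ht => hKprop _ (hUK (hin t ht))
  by_contra hcon
  push Not at hcon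
  have hclosed : IsClosed (Icc a b ∩ γ ⁻¹' Uᶜ) :=
    h.continuousOn.preimage_isClosed_of_isClosed isClosed_Icc hUopen.isClosed_compl
  have hcpt : IsCompact (Icc a b ∩ γ ⁻¹' Uᶜ) :=
    isCompact_Icc.of_isClosed_subset hclosed inter_subset_left
  obtain ⟨T, ⟨hT, hTU⟩, hleast⟩ := hcpt.exists_isLeast (by
    obtain ⟨t, ht, htU⟩ := hcon
    exact ⟨t, ht, htU⟩)
  have hbefore : ∀ t ∈ Ico a T, γ t ∈ U := by
    intro t ht
    by_contra htU
    exact absurd (hleast ⟨⟨ht.1, ht.2.le.trans hT.2⟩, htU⟩) (not_le.2 ht.2)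
  have haU : γ a ∈ U := ⟨by rwa [extChartAt_source],
    Metric.ball_subset_ball (by linarith) hinit⟩
  have haT : a < T := lt_of_le_of_ne hT.1 (by rintro rfl; exact hTU haU)
  have hTK : γ T ∈ K := by
    have hcw : ContinuousWithinAt γ (Ico a T) T :=
      (h.continuousOn T hT).mono fun t ht => ⟨ht.1, ht.2.le.trans hT.2⟩
    have := hcw.mem_closure (t := K) (by rw [closure_Ico haT.ne]; exact right_mem_Icc.2 haT.le)
      fun t ht => hUK (hbefore t ht)
    rwa [hKclosed.closure_eq] at this
  have hmaps : ∀ t ∈ Icc a T, γ t ∈ K := by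
    intro t ht
    rcases ht.2.eq_or_lt with rfl | hlt
    · exact hTK
    · exact hUK (hbefore t ⟨ht.1, hlt⟩)
  have hsol := h.solvesOn c a T le_rfl haT.le hT.2 fun t ht => (hKprop _ (hmaps t ht)).1
  have haI : a ∈ Icc (0 : ℝ) 1 := ⟨ha, hT.1.trans (hT.2.trans hb)⟩
  have hbI : b ∈ Icc (0 : ℝ) 1 := ⟨ha.trans (hT.1.trans hT.2), hb⟩
  have hTI : T ∈ Icc (0 : ℝ) 1 := ⟨ha.trans hT.1, hT.2.trans hb⟩
  have hest := hsol.norm_sub_le haT.le hB (fun t ht => (hKprop _ (hmaps t ht)).2)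
    (intervalIntegrable_extendedControl u haI hTI)
  have hmonoI : ∫ t in a..T, ‖extendedControl u t‖ ≤ ∫ t in a..b, ‖extendedControl u t‖ :=
    intervalIntegral.integral_mono_interval le_rfl hT.1 hT.2
      (ae_of_all _ fun t => norm_nonneg _) (intervalIntegrable_extendedControl u haI hbI).norm
  apply hTU
  refine ⟨by rw [extChartAt_source]; exact (hKprop _ hTK).1, ?_⟩
  rw [mem_preimage, Metric.mem_ball]
  have h1 := Metric.mem_ball.1 hinit
  have h2 := dist_triangle (extChartAt (𝓡 n) c (γ T)) (extChartAt (𝓡 n) c (γ a)) z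
  rw [← dist_eq_norm] at hest
  have h3 := mul_le_mul_of_nonneg_left hmonoI hL
  linarith

variable [IsManifold (𝓡 n) ∞ M]

/-- A coordinate ball around `q` with uniform bounds for the system, and a time during which all
controls of norm at most `R` have a small effect. -/
theorem exists_uniform_ball (hp : 1 < p) (hp_top : p ≠ ⊤) (hX₀ : IsSmoothField X₀)
    (hX : ∀ i, IsSmoothField (X i)) (q : M) (R : ℝ) :
    ∃ r > 0, ∃ L, 0 ≤ L ∧ ∃ ε > 0,
      Metric.closedBall (extChartAt (𝓡 n) q q) (2 * r) ⊆ (extChartAt (𝓡 n) q).target ∧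
      SecondOrderBounded (systemField X₀ X q)
        (Metric.closedBall (extChartAt (𝓡 n) q q) (2 * r)) L ∧
      ∀ u : Control d p, ‖u‖ ≤ R → ∀ a b, 0 ≤ a → a ≤ b → b ≤ 1 → b - a ≤ ε →
        L * (∫ t in a..b, ‖extendedControl u t‖) ≤ 1 / 2 ∧
        L * (∫ t in a..b, ‖extendedControl u t‖) < r := by
  obtain ⟨r', hr', hsub⟩ := Metric.nhds_basis_closedBall.mem_iff.1
    ((isOpen_extChartAt_target (I := 𝓡 n) q).mem_nhds (mem_extChartAt_target q))
  obtain ⟨L, hL, hSB⟩ := exists_secondOrderBounded (isOpen_extChartAt_target (I := 𝓡 n) q)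
    (by exact_mod_cast contDiffOn_infty.1 (contDiffOn_systemField hX₀ hX q) 2) hsub
  have hexp : 0 < 1 - p.toReal⁻¹ := by
    linarith [inv_lt_one_of_one_lt₀ (one_lt_toReal hp hp_top)]
  -- The effect of all controls of norm at most `R` over a time `s` is bounded by this one function,
  -- which vanishes at `s = 0` because `1 - 1/p > 0`.
  have hlim : Tendsto (fun s : ℝ => L * (s + s ^ (1 - p.toReal⁻¹) * |R|)) (𝓝 0) (𝓝 0) := by
    have h1 : Tendsto (fun s : ℝ => s ^ (1 - p.toReal⁻¹)) (𝓝 0) (𝓝 0) := by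
      have := (Real.continuousAt_rpow_const 0 (1 - p.toReal⁻¹) (Or.inr hexp.le)).tendsto
      rwa [Real.zero_rpow hexp.ne'] at this
    have h2 := ((tendsto_id (x := 𝓝 (0 : ℝ))).add (h1.mul_const |R|)).const_mul L
    simpa using h2
  have hev := hlim.eventually (gt_mem_nhds (show 0 < min (1 / 2) (r' / 2) by positivity))
  obtain ⟨ε, hε, hεball⟩ := Metric.eventually_nhds_iff.1 hev
  refine ⟨r' / 2, by positivity, L, hL, ε / 2, by positivity, ?_, ?_, ?_⟩
  · rwa [mul_div_cancel₀ _ (two_ne_zero)]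
  · rwa [mul_div_cancel₀ _ (two_ne_zero)]
  · intro u hu a b ha hab hb hle
    have h1 := integral_norm_extendedControl_le hp_top u ha hab hb
    have h2 : L * (∫ t in a..b, ‖extendedControl u t‖) ≤
        L * ((b - a) + (b - a) ^ (1 - p.toReal⁻¹) * |R|) := by
      refine mul_le_mul_of_nonneg_left (h1.trans ?_) hL
      have : 0 ≤ (b - a) ^ (1 - p.toReal⁻¹) := Real.rpow_nonneg (by linarith) _
      have := mul_le_mul_of_nonneg_left (hu.trans (le_abs_self R)) this
      linarith
    have h3 := hεball (y := b - a) (by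
      rw [Real.dist_eq, sub_zero, abs_of_nonneg (by linarith)]; linarith)
    have h4 := lt_min_iff.1 h3
    exact ⟨(h2.trans_lt h4.1).le, h2.trans_lt h4.2⟩

theorem ae_extendedControl_sub (u v : Control d p) {a b : ℝ} (ha : a ∈ Icc (0 : ℝ) 1)
    (hb : b ∈ Icc (0 : ℝ) 1) : ∀ᵐ s, s ∈ uIoc a b → extendedControl u s - extendedControl v s =
      ContinuousLinearMap.inr ℝ ℝ (EuclideanSpace ℝ (Fin d)) ((u - v) s) := by
  filter_upwards [ae_interval_of_ae_restrict ha hb (Lp.coeFn_sub u v)] with s hs hmem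
  rw [hs hmem]
  simp [extendedControl]

theorem integral_norm_extendedControl_sub_le (hp_top : p ≠ ⊤) (u v : Control d p) {a b : ℝ}
    (ha : 0 ≤ a) (hab : a ≤ b) (hb : b ≤ 1) :
    ∫ s in a..b, ‖extendedControl u s - extendedControl v s‖ ≤ ‖u - v‖ := by
  refine le_trans (le_of_eq ?_) (integral_norm_control_le_norm hp_top (u - v) ha hab hb)
  apply intervalIntegral.integral_congr_ae
  filter_upwards [ae_extendedControl_sub u v ⟨ha, hab.trans hb⟩ ⟨ha.trans hab, hb⟩] with s hs hmem
  rw [hs hmem]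
  simp [Prod.norm_def]

/-- The drift component `1` cancels in the difference of extended controls, which is thus bounded in
`L¹` by `2 * R` and has small primitives; `exists_norm_integral_clm_apply_le` applies. The primitive
from `a` is a difference of two primitives from `0`, whence `κ / 2`. -/
theorem PrimitiveTendsto.eventually_norm_integral_le {ι : Type*} {l : Filter ι}
    (hp_top : p ≠ ⊤) {u : ι → Control d p} {v : Control d p} {R : ℝ} (hu : ∀ i, ‖u i‖ ≤ R)
    (hv : ‖v‖ ≤ R) (h : PrimitiveTendsto l u v) {F : Type*} [NormedAddCommGroup F]
    [NormedSpace ℝ F] [CompleteSpace F] {A : ℝ → ℝ × EuclideanSpace ℝ (Fin d) →L[ℝ] F}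
    {a b : ℝ} (ha : 0 ≤ a) (hab : a ≤ b) (hb : b ≤ 1) (hA : ContinuousOn A (Icc a b)) {ε : ℝ}
    (hε : 0 < ε) : ∀ᶠ i in l, ∀ t ∈ Icc a b,
      ‖∫ s in a..t, A s (extendedControl (u i) s - extendedControl v s)‖ ≤ ε := by
  have hR : 0 ≤ R := (norm_nonneg _).trans hv
  obtain ⟨κ, hκ, hκA⟩ := exists_norm_integral_clm_apply_le hab hA hε
    (show 0 ≤ 2 * R by positivity)
  have h0 : (0 : ℝ) ∈ Icc (0 : ℝ) 1 := by simp
  have haI : a ∈ Icc (0 : ℝ) 1 := ⟨ha, hab.trans hb⟩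
  have hbI : b ∈ Icc (0 : ℝ) 1 := ⟨ha.trans hab, hb⟩
  filter_upwards [h (κ / 2) (by positivity)] with i hi
  refine hκA _ ((intervalIntegrable_extendedControl (u i) haI hbI).sub
    (intervalIntegrable_extendedControl v haI hbI)) ?_ ?_
  · refine (integral_norm_extendedControl_sub_le hp_top (u i) v ha hab hb).trans ?_
    linarith [norm_sub_le (u i) v, hu i]
  · intro t ht
    have htI : t ∈ Icc (0 : ℝ) 1 := ⟨ha.trans ht.1, ht.2.trans hb⟩
    rw [intervalIntegral.integral_congr_ae (ae_extendedControl_sub (u i) v haI htI),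
      ContinuousLinearMap.intervalIntegral_comp_comm _ (intervalIntegrable_control _ haI htI)]
    have h1 := hi t htI
    have h2 := hi a haI
    rw [primitive] at h1 h2
    have h3 := intervalIntegral.integral_interval_sub_left
      (intervalIntegrable_control (u i - v) h0 htI) (intervalIntegrable_control (u i - v) h0 haI)
    rw [← h3]
    simp only [ContinuousLinearMap.inr_apply, Prod.norm_def, norm_zero]
    refine max_le hκ.le ((_root_.norm_sub_le _ _).trans ?_)
    linarith

/-- Along a curve, short pieces lie in coordinate balls with uniform bounds for the system, and
solutions starting near the piece stay in the ball. -/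
theorem exists_tube [T2Space M] (hp : 1 < p) (hp_top : p ≠ ⊤) (hX₀ : IsSmoothField X₀)
    (hX : ∀ i, IsSmoothField (X i)) (R : ℝ) {γ₀ : ℝ → M} (hγ₀ : ContinuousOn γ₀ (Icc 0 1)) {t₀ : ℝ}
    (ht₀ : t₀ ∈ Icc (0 : ℝ) 1) :
    ∃ r L, 0 ≤ L ∧ SecondOrderBounded (systemField X₀ X (γ₀ t₀))
        (Metric.closedBall (extChartAt (𝓡 n) (γ₀ t₀) (γ₀ t₀)) (2 * r)) L ∧
      ∃ ε > 0, ∀ a ∈ Icc (0 : ℝ) 1, ∀ b ∈ Icc (0 : ℝ) 1, |a - t₀| < ε → |b - t₀| < ε → a ≤ b →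
        (∀ t ∈ Icc a b, γ₀ t ∈ (chartAt (EuclideanSpace ℝ (Fin n)) (γ₀ t₀)).source ∧
          extChartAt (𝓡 n) (γ₀ t₀) (γ₀ t) ∈
            Metric.closedBall (extChartAt (𝓡 n) (γ₀ t₀) (γ₀ t₀)) (2 * r)) ∧
        (∀ u : Control d p, ‖u‖ ≤ R → L * (∫ t in a..b, ‖extendedControl u t‖) ≤ 1 / 2) ∧
        ∀ᶠ m in 𝓝 (γ₀ a), ∀ (u : Control d p) (γ : ℝ → M), ‖u‖ ≤ R →
          SolvesChartwiseOn X₀ X u 0 1 γ → γ a = m → ∀ t ∈ Icc a b,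
            γ t ∈ (chartAt (EuclideanSpace ℝ (Fin n)) (γ₀ t₀)).source ∧
            extChartAt (𝓡 n) (γ₀ t₀) (γ t) ∈
              Metric.closedBall (extChartAt (𝓡 n) (γ₀ t₀) (γ₀ t₀)) (2 * r) := by
  set q := γ₀ t₀ with hq
  obtain ⟨r, hr, L, hL, ε, hε, hball, hSB, hsmall⟩ :=
    exists_uniform_ball (X₀ := X₀) (X := X) hp hp_top hX₀ hX q R
  set z := extChartAt (𝓡 n) q q with hz
  set U : Set M := (extChartAt (𝓡 n) q).source ∩
    extChartAt (𝓡 n) q ⁻¹' Metric.ball z r with hU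
  have hUopen : IsOpen U := (continuousOn_extChartAt q).isOpen_inter_preimage
    (isOpen_extChartAt_source q) Metric.isOpen_ball
  have hqU : γ₀ t₀ ∈ U := ⟨mem_extChartAt_source q, Metric.mem_ball_self hr⟩
  have hnear := (hγ₀ t₀ ht₀).eventually (hUopen.mem_nhds hqU)
  obtain ⟨ε', hε', hnear'⟩ := Metric.eventually_nhds_iff.1 (eventually_nhdsWithin_iff.1 hnear)
  refine ⟨r, L, hL, hSB, min (ε / 2) ε', by positivity, fun a ha b hb hat hbt hab => ?_⟩
  have hba : b - a ≤ ε := by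
    have h1 := abs_lt.1 (lt_of_lt_of_le hat (min_le_left _ _))
    have h2 := abs_lt.1 (lt_of_lt_of_le hbt (min_le_left _ _))
    linarith [h1.1, h2.2]
  have hin : ∀ t ∈ Icc a b, γ₀ t ∈ U := by
    intro t ht
    refine hnear' ?_ ⟨ha.1.trans ht.1, ht.2.trans hb.2⟩
    have h1 := abs_lt.1 (lt_of_lt_of_le hat (min_le_right _ _))
    have h2 := abs_lt.1 (lt_of_lt_of_le hbt (min_le_right _ _))
    rw [Real.dist_eq, abs_lt]
    exact ⟨by linarith [h1.1, ht.1], by linarith [h2.2, ht.2]⟩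
  have hsub : Metric.ball z r ⊆ Metric.closedBall z (2 * r) :=
    (Metric.ball_subset_ball (by linarith)).trans Metric.ball_subset_closedBall
  refine ⟨fun t ht => ⟨by rw [← extChartAt_source (𝓡 n)]; exact (hin t ht).1, hsub (hin t ht).2⟩,
    fun u hu => (hsmall u hu a b ha.1 hab hb.2 hba).1, ?_⟩
  filter_upwards [hUopen.mem_nhds (hin a (left_mem_Icc.2 hab))] with m hm u γ hu hγ hγa
  subst hγa
  exact (hγ.mono ha.1 hb.2).mem_closedBall ha.1 hb.2 hL hball hSB.bound
    (hsmall u hu a b ha.1 hab hb.2 hba).2 (by rw [← extChartAt_source (𝓡 n)]; exact hm.1) hm.2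

/-- Solutions depend continuously on the control, for the weak topology on bounded sets. -/
theorem tendsto_solution [T2Space M] (hp : 1 < p) (hp_top : p ≠ ⊤) (hX₀ : IsSmoothField X₀)
    (hX : ∀ i, IsSmoothField (X i)) {ι : Type*} {l : Filter ι} {u : ι → Control d p}
    {v : Control d p} {R : ℝ} (hu : ∀ i, ‖u i‖ ≤ R) (hv : ‖v‖ ≤ R) (h : PrimitiveTendsto l u v)
    {γ : ι → ℝ → M} {γ₀ : ℝ → M} (hγ : ∀ i, SolvesChartwiseOn X₀ X (u i) 0 1 (γ i))
    (hγ₀ : SolvesChartwiseOn X₀ X v 0 1 γ₀) (hinit : ∀ i, γ i 0 = γ₀ 0) :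
    ∀ t ∈ Icc (0 : ℝ) 1, Tendsto (fun i => γ i t) l (𝓝 (γ₀ t)) := by
  refine forall_mem_Icc_of_local_step (by simp only [hinit]; exact tendsto_const_nhds)
    fun t₀ ht₀ => ?_
  obtain ⟨r, L, hL, hSB, ε, hε, htube⟩ :=
    exists_tube (X₀ := X₀) (X := X) hp hp_top hX₀ hX R hγ₀.continuousOn ht₀
  set q := γ₀ t₀ with hq
  refine ⟨ε, hε, fun a ha b hb hat hbt hab hPa => ?_⟩
  obtain ⟨hin, hsmall, hnear⟩ := htube a ha b hb hat hbt hab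
  have hsol₀ := hγ₀.solvesOn q a b ha.1 hab hb.2 fun t ht => (hin t ht).1
  have hA : ContinuousOn (fun t => systemField X₀ X q (extChartAt (𝓡 n) q (γ₀ t))) (Icc a b) :=
    hSB.continuousOn.comp hsol₀.continuousOn fun t ht => (hin t ht).2
  have hstay := (hPa.eventually hnear).mono fun i hi => hi (u i) (γ i) (hu i) (hγ i) rfl
  have hsrc : ∀ t ∈ Icc a b, γ₀ t ∈ (extChartAt (𝓡 n) q).source := fun t ht => by
    rw [extChartAt_source]; exact (hin t ht).1
  have hξa : Tendsto (fun i => extChartAt (𝓡 n) q (γ i a)) l (𝓝 (extChartAt (𝓡 n) q (γ₀ a))) :=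
    ((continuousAt_extChartAt' (I := 𝓡 n) (hsrc a (left_mem_Icc.2 hab))).tendsto).comp hPa
  have hξb : Tendsto (fun i => extChartAt (𝓡 n) q (γ i b)) l (𝓝 (extChartAt (𝓡 n) q (γ₀ b))) := by
    rw [tendsto_iff_norm_sub_tendsto_zero] at hξa ⊢
    rw [tendsto_order]
    refine ⟨fun x hx => Eventually.of_forall fun i => hx.trans_le (norm_nonneg _), fun η hη => ?_⟩
    filter_upwards [hstay, hξa.eventually (gt_mem_nhds (show 0 < η / 8 by positivity)),
      h.eventually_norm_integral_le hp_top hu hv ha.1 hab hb.2 hA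
        (show 0 < η / 8 by positivity)] with i h1 h2 h3
    have hsol := (hγ i).solvesOn q a b ha.1 hab hb.2 fun t ht => (h1 t ht).1
    -- The kernel is evaluated along the fixed limit curve, so convergence of primitives controls
    -- the perturbation; the estimate gives `2 * (η / 8 + η / 8) < η`.
    have := hsol₀.norm_sub_le_of_integral_le hab hL hSB hsol (fun t ht => (hin t ht).2)
      (fun t ht => (h1 t ht).2) (intervalIntegrable_extendedControl v ha hb)
      (intervalIntegrable_extendedControl (u i) ha hb) (hsmall (u i) (hu i)) h3 b
      (right_mem_Icc.2 hab)
    linarith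
  have hbU := hsrc b (right_mem_Icc.2 hab)
  have hsymm := ((continuousAt_extChartAt_symm' (I := 𝓡 n) hbU).tendsto).comp hξb
  rw [(extChartAt (𝓡 n) q).left_inv hbU] at hsymm
  refine hsymm.congr' ?_
  filter_upwards [hstay] with i hi
  exact (extChartAt (𝓡 n) q).left_inv
    (by rw [extChartAt_source]; exact (hi b (right_mem_Icc.2 hab)).1)

end Stability

/-! ### Uniform second differences of the endpoint -/

section SecondDifferences

variable {n d : ℕ} {M : Type*} [TopologicalSpace M] [ChartedSpace (EuclideanSpace ℝ (Fin n)) M]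
  {ι : Type*} {l : Filter ι} {σ : ι → ℝ}

/-- Along `l`, the first differences of three families of points of `M`, in the chart at `c`, are
`O(σ)` and their second difference is `O(σ ^ 2)`. -/
def SmallDifferencesAt (n : ℕ) {M : Type*} [TopologicalSpace M]
    [ChartedSpace (EuclideanSpace ℝ (Fin n)) M] (l : Filter ι) (σ : ι → ℝ) (c : M) (m : Fin 3 → ι → M) : Prop :=
  ∃ C, 0 ≤ C ∧ ∀ᶠ i in l,
    ‖extChartAt (𝓡 n) c (m 1 i) - extChartAt (𝓡 n) c (m 0 i)‖ ≤ C * σ i ∧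
    ‖extChartAt (𝓡 n) c (m 2 i) - extChartAt (𝓡 n) c (m 1 i)‖ ≤ C * σ i ∧
    ‖extChartAt (𝓡 n) c (m 2 i) - (2 : ℝ) • extChartAt (𝓡 n) c (m 1 i) +
      extChartAt (𝓡 n) c (m 0 i)‖ ≤ C * σ i ^ 2

/-- Makes the estimate independent of the chart, so that it can be propagated along a trajectory
crossing several charts. It holds because the coordinate change is `C²` near the common limit point
`q`, hence `SecondOrderBounded` there. -/
theorem SmallDifferencesAt.change_chart [IsManifold (𝓡 n) ∞ M] {c c' q : M} {m : Fin 3 → ι → M}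
    (h : SmallDifferencesAt n l σ c m) (hm : ∀ j, Tendsto (m j) l (𝓝 q))
    (hq : q ∈ (chartAt (EuclideanSpace ℝ (Fin n)) c).source)
    (hq' : q ∈ (chartAt (EuclideanSpace ℝ (Fin n)) c').source) :
    SmallDifferencesAt n l σ c' m := by
  obtain ⟨C, hC, hev⟩ := h
  obtain ⟨r, hr, hball⟩ := Metric.nhds_basis_closedBall.mem_iff.1
    ((isOpen_coordDomain c c').mem_nhds (extChartAt_mem_coordDomain hq hq'))
  obtain ⟨L, hL, hSB⟩ := exists_secondOrderBounded (isOpen_coordDomain c c')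
    (by exact_mod_cast contDiffOn_infty.1 (contDiffOn_coordChange c c') 2) hball
  have hmem : ∀ j, ∀ᶠ i in l, m j i ∈ (chartAt (EuclideanSpace ℝ (Fin n)) c).source ∧
      extChartAt (𝓡 n) c (m j i) ∈ Metric.closedBall (extChartAt (𝓡 n) c q) r := by
    intro j
    have hc := (continuousAt_extChartAt' (I := 𝓡 n) (x := c) (x' := q)
      (by rwa [extChartAt_source])).tendsto.comp (hm j)
    exact ((hm j).eventually ((chartAt _ c).open_source.mem_nhds hq)).and
      (hc.eventually (Metric.closedBall_mem_nhds _ hr))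
  refine ⟨L * (C + (2 * C) ^ 2) + L * C, by positivity, ?_⟩
  filter_upwards [hev, hmem 0, hmem 1, hmem 2] with i ⟨h1, h2, h3⟩ k0 k1 k2
  rw [← coordChange_apply (c' := c') k0.1, ← coordChange_apply (c' := c') k1.1,
    ← coordChange_apply (c' := c') k2.1]
  have hσ : 0 ≤ C * σ i := (norm_nonneg _).trans h1
  have hbig : L * C * σ i ≤ (L * (C + (2 * C) ^ 2) + L * C) * σ i := by
    have : 0 ≤ (L * (1 + 4 * C)) * (C * σ i) := by positivity
    linarith
  refine ⟨?_, ?_, ?_⟩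
  · refine (hSB.lipschitz _ k1.2 _ k0.2).trans (le_trans ?_ hbig)
    rw [mul_assoc]; gcongr
  · refine (hSB.lipschitz _ k2.2 _ k1.2).trans (le_trans ?_ hbig)
    rw [mul_assoc]; gcongr
  · refine (hSB.second _ k0.2 _ k1.2 _ k2.2).trans ?_
    calc _ ≤ L * (C * σ i ^ 2 + (C * σ i + C * σ i) ^ 2) := by gcongr
      _ ≤ _ := by
        have : 0 ≤ L * C * σ i ^ 2 := by positivity
        linarith

variable [IsManifold (𝓡 n) ∞ M] {p : ℝ≥0∞} [Fact (1 ≤ p)] {X₀ : (q : M) → TangentSpace (𝓡 n) q}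
  {X : Fin d → (q : M) → TangentSpace (𝓡 n) q}

/-- The endpoint map has bounded second differences, uniformly along weakly convergent families of
controls. -/
theorem smallDifferencesAt_solution [T2Space M] (hp : 1 < p) (hp_top : p ≠ ⊤)
    (hX₀ : IsSmoothField X₀) (hX : ∀ i, IsSmoothField (X i)) {u : Fin 3 → ι → Control d p}
    {v : Control d p} {R : ℝ} (hu : ∀ j i, ‖u j i‖ ≤ R) (hv : ‖v‖ ≤ R)
    (h : ∀ j, PrimitiveTendsto l (u j) v) (hdiff : ∀ i, u 1 i - u 0 i = u 2 i - u 1 i)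
    (hσ : ∀ i, ‖u 1 i - u 0 i‖ ≤ R * σ i) {γ : Fin 3 → ι → ℝ → M} {γ₀ : ℝ → M}
    (hγ : ∀ j i, SolvesChartwiseOn X₀ X (u j i) 0 1 (γ j i))
    (hγ₀ : SolvesChartwiseOn X₀ X v 0 1 γ₀) (hinit : ∀ j i, γ j i 0 = γ₀ 0) :
    ∀ t ∈ Icc (0 : ℝ) 1, SmallDifferencesAt n l σ (γ₀ t) (fun j i => γ j i t) := by
  have hlim : ∀ j, ∀ t ∈ Icc (0 : ℝ) 1, Tendsto (fun i => γ j i t) l (𝓝 (γ₀ t)) := fun j =>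
    tendsto_solution hp hp_top hX₀ hX (hu j) hv (h j) (hγ j) hγ₀ (hinit j)
  have hR : 0 ≤ R := (norm_nonneg _).trans hv
  refine forall_mem_Icc_of_local_step ?_ fun t₀ ht₀ => ?_
  · refine ⟨0, le_rfl, Eventually.of_forall fun i => ?_⟩
    simp only [hinit, sub_self, norm_zero, zero_mul, le_refl, true_and]
    rw [two_smul]; simp
  obtain ⟨r, L, hL, hSB, ε, hε, htube⟩ :=
    exists_tube (X₀ := X₀) (X := X) hp hp_top hX₀ hX R hγ₀.continuousOn ht₀
  set q := γ₀ t₀ with hq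
  refine ⟨ε, hε, fun a ha b hb hat hbt hab hPa => ?_⟩
  obtain ⟨hin, hsmall, hnear⟩ := htube a ha b hb hat hbt hab
  -- The propagated property refers to the chart at `γ₀ t`, which moves with `t`. At `a` it is
  -- transferred to the chart at `q`, and at `b` it is transferred back.
  obtain ⟨C, hC, hev⟩ := hPa.change_chart (hlim · a ha) (mem_chart_source _ _)
    (hin a (left_mem_Icc.2 hab)).1
  have hstay : ∀ j, ∀ᶠ i in l, ∀ t ∈ Icc a b,
      γ j i t ∈ (chartAt (EuclideanSpace ℝ (Fin n)) q).source ∧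
      extChartAt (𝓡 n) q (γ j i t) ∈ Metric.closedBall (extChartAt (𝓡 n) q q) (2 * r) := fun j =>
    ((hlim j a ha).eventually hnear).mono fun i hi => hi (u j i) (γ j i) (hu j i) (hγ j i) rfl
  refine SmallDifferencesAt.change_chart (c := q) ?_ (hlim · b hb)
    (hin b (right_mem_Icc.2 hab)).1 (mem_chart_source _ _)
  -- Gronwall with initial error `C * σ` and perturbation `L * R * σ` bounds first differences by
  -- `C1 * σ`; this is the value of `D` in the second-difference estimate.
  set C1 := 2 * (C + L * R) with hC1
  refine ⟨C1 + 2 * (C + (2 * C1 ^ 2 + 2 * L * C1 * R)), by positivity, ?_⟩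
  filter_upwards [hev, hstay 0, hstay 1, hstay 2] with i ⟨e1, e2, e3⟩ k0 k1 k2
  have hsol : ∀ j, (∀ t ∈ Icc a b, γ j i t ∈ (chartAt (EuclideanSpace ℝ (Fin n)) q).source ∧
      extChartAt (𝓡 n) q (γ j i t) ∈ Metric.closedBall (extChartAt (𝓡 n) q q) (2 * r)) →
      SolvesOn (systemField X₀ X q) (extendedControl (u j i)) a b
        (fun t => extChartAt (𝓡 n) q (γ j i t)) := fun j hj =>
    (hγ j i).solvesOn q a b ha.1 hab hb.2 fun t ht => (hj t ht).1
  have hint := fun j => intervalIntegrable_extendedControl (u j i) ha hb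
  have hRσ : 0 ≤ R * σ i := (norm_nonneg _).trans (hσ i)
  have hCσ : 0 ≤ C * σ i := (norm_nonneg _).trans e1
  have hfirst : ∀ j j' : Fin 3, ‖u j' i - u j i‖ ≤ R * σ i →
      ‖extChartAt (𝓡 n) q (γ j' i a) - extChartAt (𝓡 n) q (γ j i a)‖ ≤ C * σ i →
      (∀ t ∈ Icc a b, γ j i t ∈ (chartAt (EuclideanSpace ℝ (Fin n)) q).source ∧
        extChartAt (𝓡 n) q (γ j i t) ∈ Metric.closedBall (extChartAt (𝓡 n) q q) (2 * r)) →
      (∀ t ∈ Icc a b, γ j' i t ∈ (chartAt (EuclideanSpace ℝ (Fin n)) q).source ∧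
        extChartAt (𝓡 n) q (γ j' i t) ∈ Metric.closedBall (extChartAt (𝓡 n) q q) (2 * r)) →
      ∀ t ∈ Icc a b, ‖extChartAt (𝓡 n) q (γ j' i t) - extChartAt (𝓡 n) q (γ j i t)‖ ≤
        C1 * σ i := by
    intro j j' hjj hCj hj hj' t ht
    have := (hsol j hj).norm_sub_le_of_integral_le hab hL hSB (hsol j' hj')
      (fun t ht => (hj t ht).2) (fun t ht => (hj' t ht).2) (hint j) (hint j')
      (hsmall _ (hu j' i)) (η := L * (R * σ i)) (fun t ht => ?_) t ht
    · refine this.trans ?_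
      rw [hC1]
      linarith
    · have h1 := ((hint j').sub (hint j)).norm.const_mul L
      have h2 : uIcc a t ⊆ uIcc a b :=
        uIcc_subset_uIcc left_mem_uIcc (by rwa [uIcc_of_le hab])
      refine (intervalIntegral.norm_integral_le_of_norm_le ht.1
        (ae_of_all _ fun s hs => ?_) (h1.mono_set h2)).trans ?_
      · refine (ContinuousLinearMap.le_opNorm _ _).trans ?_
        gcongr
        exact hSB.bound _ (hj s ⟨hs.1.le, hs.2.trans ht.2⟩).2
      · rw [intervalIntegral.integral_const_mul]
        gcongr
        exact (integral_norm_extendedControl_sub_le hp_top _ _ ha.1 ht.1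
          (ht.2.trans hb.2)).trans hjj
  have hσ' : ‖u 2 i - u 1 i‖ ≤ R * σ i := by rw [← hdiff]; exact hσ i
  have f1 := hfirst 0 1 (hσ i) e1 k0 k1
  have f2 := hfirst 1 2 hσ' e2 k1 k2
  have hC1σ : 0 ≤ C1 * σ i := (norm_nonneg _).trans (f1 a (left_mem_Icc.2 hab))
  have hae : ∀ᵐ s, s ∈ uIoc a b → extendedControl (u 1 i) s - extendedControl (u 0 i) s =
      extendedControl (u 2 i) s - extendedControl (u 1 i) s := by
    filter_upwards [ae_extendedControl_sub (u 1 i) (u 0 i) ha hb,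
      ae_extendedControl_sub (u 2 i) (u 1 i) ha hb] with s h1 h2 hs
    rw [h1 hs, h2 hs, hdiff]
  have hsec := SolvesOn.norm_second_difference_le hab hL hSB (hsol 0 k0) (hsol 1 k1) (hsol 2 k2)
    (fun t ht => (k0 t ht).2) (fun t ht => (k1 t ht).2) (fun t ht => (k2 t ht).2) (hint 0) (hint 1)
    (hint 2) hae (hsmall _ (hu 1 i)) f1 f2
  have hI := (integral_norm_extendedControl_sub_le hp_top (u 2 i) (u 1 i) ha.1 hab hb.2).trans hσ'
  have hrest : 0 ≤ (2 * (C + (2 * C1 ^ 2 + 2 * L * C1 * R))) * σ i := by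
    have h1 : 0 ≤ 4 * C1 * (C1 * σ i) := by positivity
    have h2 : 0 ≤ 4 * L * R * (C1 * σ i) := by positivity
    linarith
  have hb' := right_mem_Icc.2 hab
  refine ⟨(f1 b hb').trans ?_, (f2 b hb').trans ?_, hsec.trans ?_⟩
  · linarith
  · linarith
  · have h4 : 2 * L * (C1 * σ i) * ∫ s in a..b,
        ‖extendedControl (u 2 i) s - extendedControl (u 1 i) s‖ ≤
        2 * L * (C1 * σ i) * (R * σ i) := by gcongr
    have h5 : 0 ≤ C1 * σ i ^ 2 := by positivity
    linarith [e3]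

end SecondDifferences

/-- If the second differences `φ (2 s) - 2 φ s + φ 0` are `O(s ^ 2)`, then so is the remainder of
the first order Taylor expansion of `φ` at `0`, with the same constant. -/
theorem norm_sub_smul_le_of_second_difference {E : Type*} [NormedAddCommGroup E] [NormedSpace ℝ E]
    {φ : ℝ → E} {a : E} {C s₀ : ℝ} (hφ : HasDerivAt φ a 0)
    (h : ∀ s ∈ Ioo 0 s₀, ‖φ (2 * s) - (2 : ℝ) • φ s + φ 0‖ ≤ C * s ^ 2) {s : ℝ}
    (hs : s ∈ Ioo 0 s₀) : ‖s⁻¹ • (φ s - φ 0) - a‖ ≤ C * s := by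
  -- For difference quotients, `D (2 t) - D t` is the second difference divided by `2 t`, hence at
  -- most `C t / 2`. Summing over `s / 2 ^ k` gives a geometric series, and `D (s / 2 ^ k)` tends to
  -- the derivative.
  set D : ℝ → E := fun t => t⁻¹ • (φ t - φ 0) with hD
  have hstep : ∀ t ∈ Ioo 0 s₀, ‖D (2 * t) - D t‖ ≤ C * t / 2 := by
    intro t ht
    have ht0 : t ≠ 0 := ht.1.ne'
    have e : D (2 * t) - D t = (2 * t)⁻¹ • (φ (2 * t) - (2 : ℝ) • φ t + φ 0) := by
      simp only [hD, smul_sub, smul_add, smul_smul]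
      have : (2 * t)⁻¹ * 2 = t⁻¹ := by field_simp
      rw [this]
      have : φ 0 = (2 : ℝ) • (2 : ℝ)⁻¹ • φ 0 := by simp
      have h2 : t⁻¹ • φ 0 = (2 * t)⁻¹ • φ 0 + (2 * t)⁻¹ • φ 0 := by
        rw [← add_smul]; congr 1; field_simp; norm_num
      rw [h2]
      abel
    rw [e, norm_smul, Real.norm_of_nonneg (by have := ht.1; positivity)]
    have := ht.1
    calc _ ≤ (2 * t)⁻¹ * (C * t ^ 2) := by gcongr; exact h t ht
      _ = _ := by field_simp
  have hC : 0 ≤ C := by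
    have := (norm_nonneg _).trans (hstep s hs)
    by_contra hneg
    have h1 := hs.1
    nlinarith
  have hpow : ∀ k : ℕ, s / 2 ^ k ∈ Ioo 0 s₀ := fun k => ⟨by have := hs.1; positivity,
    (div_le_self hs.1.le (one_le_pow₀ (by norm_num))).trans_lt hs.2⟩
  have hsum : ∀ k : ℕ, ‖D s - D (s / 2 ^ k)‖ ≤ C * s * (1 - 1 / 2 ^ k) := by
    intro k
    induction k with
    | zero => simp
    | succ k ih =>
      have h1 := hstep _ (hpow (k + 1))
      have h2 : 2 * (s / 2 ^ (k + 1)) = s / 2 ^ k := by rw [pow_succ]; field_simp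
      rw [h2] at h1
      have h3 : C * (s / 2 ^ (k + 1)) / 2 ≤ C * s * (1 / 2 ^ k - 1 / 2 ^ (k + 1)) := by
        have h4 : C * s * (1 / 2 ^ k - 1 / 2 ^ (k + 1)) = C * (s / 2 ^ (k + 1)) := by
          rw [pow_succ]; field_simp; norm_num
        rw [h4]
        exact half_le_self (mul_nonneg hC (hpow _).1.le)
      calc _ ≤ ‖D s - D (s / 2 ^ k)‖ + ‖D (s / 2 ^ k) - D (s / 2 ^ (k + 1))‖ :=
            norm_sub_le_norm_sub_add_norm_sub _ _ _
        _ ≤ _ := by linarith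
  have hto : Tendsto (fun k : ℕ => s / 2 ^ k) atTop (𝓝[≠] 0) := by
    refine tendsto_nhdsWithin_iff.2 ⟨?_, Eventually.of_forall fun k => (hpow k).1.ne'⟩
    have := (tendsto_pow_atTop_nhds_zero_of_lt_one (r := (1 / 2 : ℝ)) (by norm_num)
      (by norm_num)).const_mul s
    simpa [div_eq_mul_inv] using this
  have hDa : Tendsto (fun k : ℕ => D (s / 2 ^ k)) atTop (𝓝 a) := by
    have := (hasDerivAt_iff_tendsto_slope.1 hφ).comp hto
    refine this.congr fun k => ?_
    simp [slope_def_module, hD]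
  refine le_of_tendsto ((tendsto_const_nhds.sub hDa).norm) (Eventually.of_forall fun k =>
    (hsum k).trans ?_)
  have h1 : (0 : ℝ) ≤ 1 / 2 ^ k := by positivity
  have h2 : 0 ≤ C * s := mul_nonneg hC hs.1.le
  nlinarith

/-! ### The endpoint map and its differential -/

section Endpoint

variable {n d : ℕ} {M : Type*} [TopologicalSpace M] [ChartedSpace (EuclideanSpace ℝ (Fin n)) M]
  {p : ℝ≥0∞} {X₀ : (q : M) → TangentSpace (𝓡 n) q}
  {X : Fin d → (q : M) → TangentSpace (𝓡 n) q} {x : M}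

theorem exists_isTrajectory_endpoint {u : Control d p} (hu : u ∈ admissible p X₀ X x) :
    ∃ γ, IsTrajectory X₀ X x u γ ∧ γ 1 = endpoint X₀ X x u := by
  have hu' : ∃ γ : ℝ → M, IsTrajectory X₀ X x u γ := hu
  refine ⟨hu'.choose, hu'.choose_spec, ?_⟩
  rw [endpoint, dif_pos hu']

variable [Fact (1 ≤ p)]

/-- The differential of the endpoint map, with values in the model space. -/
noncomputable def endpointDerivative (X₀ : (q : M) → TangentSpace (𝓡 n) q)
    (X : Fin d → (q : M) → TangentSpace (𝓡 n) q) (x : M) (u : Control d p) :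
    Control d p →L[ℝ] EuclideanSpace ℝ (Fin n) :=
  endpointDifferential X₀ X x u

/-- Regularity supplies the differentiability of `F`: where `F` is not differentiable, `mfderiv` is
zero by convention, so surjectivity forces the model space to be trivial and the claim is empty of
content. -/
theorem hasFDerivAt_endpoint {u : Control d p}
    (hu : Function.Surjective (endpointDifferential X₀ X x u)) :
    HasFDerivAt (fun w => extChartAt (𝓡 n) (endpoint X₀ X x u) (endpoint X₀ X x w))
      (endpointDerivative X₀ X x u) u := by
  by_cases h : MDifferentiableAt 𝓘(ℝ, Control d p) (𝓡 n) (endpoint X₀ X x : Control d p → M) u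
  · have h2 := h.hasMFDerivAt.2
    rw [ModelWithCorners.range_eq_univ] at h2
    exact hasFDerivWithinAt_univ.1 h2
  · have h0 : ∀ w, endpointDerivative X₀ X x u w = 0 := by
      intro w
      change mfderiv 𝓘(ℝ, Control d p) (𝓡 n) (endpoint X₀ X x : Control d p → M) u w = 0
      rw [mfderiv_zero_of_not_mdifferentiableAt h]
      rfl
    have hsub : ∀ e : EuclideanSpace ℝ (Fin n), e = 0 := fun e => by
      obtain ⟨w, hw⟩ := hu e
      exact hw.symm.trans (h0 w)
    have e1 : (fun w => extChartAt (𝓡 n) (endpoint X₀ X x u) (endpoint X₀ X x w)) =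
      fun _ : Control d p => (0 : EuclideanSpace ℝ (Fin n)) := funext fun w => hsub _
    have e2 : endpointDerivative X₀ X x u = 0 := ContinuousLinearMap.ext h0
    rw [e1, e2]
    exact hasFDerivAt_const _ _

variable [IsManifold (𝓡 n) ∞ M] [T2Space M] {ι : Type*} {l : Filter ι}

/-- `tendsto_solution` holds for arbitrary solutions with the common initial point, so the choice of
trajectory made in `endpoint` plays no role. -/
theorem tendsto_endpoint (hp : 1 < p) (hp_top : p ≠ ⊤)
    (hX₀ : IsSmoothField X₀) (hX : ∀ i, IsSmoothField (X i))
    (hall : ∀ u : Control d p, u ∈ admissible p X₀ X x) {u : ι → Control d p} {v : Control d p}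
    {R : ℝ} (hu : ∀ i, ‖u i‖ ≤ R) (hv : ‖v‖ ≤ R) (h : PrimitiveTendsto l u v) :
    Tendsto (fun i => endpoint X₀ X x (u i)) l (𝓝 (endpoint X₀ X x v)) := by
  choose γ hγ hγ1 using fun u => exists_isTrajectory_endpoint (hall u)
  have := tendsto_solution hp hp_top hX₀ hX hu hv h
    (fun i => (hγ (u i)).solvesChartwiseOn hX₀ hX) ((hγ v).solvesChartwiseOn hX₀ hX)
    (fun i => (hγ (u i)).initial.trans (hγ v).initial.symm) 1 (by simp)
  simpa only [hγ1] using this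

theorem continuous_endpoint (hp : 1 < p) (hp_top : p ≠ ⊤)
    (hX₀ : IsSmoothField X₀) (hX : ∀ i, IsSmoothField (X i))
    (hall : ∀ u : Control d p, u ∈ admissible p X₀ X x) :
    Continuous (endpoint X₀ X x : Control d p → M) := by
  refine SeqContinuous.continuous fun u v huv => ?_
  obtain ⟨R, hR⟩ := huv.norm.bddAbove_range
  exact tendsto_endpoint hp hp_top hX₀ hX hall (R := max R ‖v‖)
    (fun k => (hR (mem_range_self k)).trans (le_max_left _ _)) (le_max_right _ _)
    (PrimitiveTendsto.of_tendsto hp_top huv)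

/-- The estimate must hold for all small steps `s` simultaneously, uniformly in `i`; the step is
therefore made part of the index, along the filter `l ×ˢ 𝓝 0`. The directions `w i` need only be
bounded. -/
theorem exists_second_difference_endpoint_le (hp : 1 < p) (hp_top : p ≠ ⊤)
    (hX₀ : IsSmoothField X₀) (hX : ∀ i, IsSmoothField (X i))
    (hall : ∀ u : Control d p, u ∈ admissible p X₀ X x) {u w : ι → Control d p} {v : Control d p}
    {R : ℝ} (hu : ∀ i, ‖u i‖ ≤ R) (hw : ∀ i, ‖w i‖ ≤ R) (hv : ‖v‖ ≤ R)
    (h : PrimitiveTendsto l u v) :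
    ∃ C, ∃ s₀ > 0, ∀ᶠ i in l, ∀ s ∈ Ioo 0 s₀,
      ‖extChartAt (𝓡 n) (endpoint X₀ X x v) (endpoint X₀ X x (u i + (2 * s) • w i)) -
        (2 : ℝ) • extChartAt (𝓡 n) (endpoint X₀ X x v) (endpoint X₀ X x (u i + s • w i)) +
        extChartAt (𝓡 n) (endpoint X₀ X x v) (endpoint X₀ X x (u i + (0 : ℝ) • w i))‖ ≤
        C * s ^ 2 := by
  choose γ hγ hγ1 using fun u => exists_isTrajectory_endpoint (hall u)
  have hR : 0 ≤ R := (norm_nonneg _).trans hv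
  -- Truncation keeps the controls `u + c * ρ(s) • w`, with `c ≤ 2`, bounded by `3 * R` for every
  -- index, as `smallDifferencesAt_solution` demands; for `0 < s < 1` it changes nothing.
  set ρ : ℝ → ℝ := fun s => min |s| 1 with hρ
  have hρ0 : ∀ s, 0 ≤ ρ s := fun s => le_min (abs_nonneg s) zero_le_one
  have hρ1 : ∀ s, ρ s ≤ 1 := fun s => min_le_right _ _
  have hρt : Tendsto ρ (𝓝 0) (𝓝 0) := by
    have : Continuous ρ := by fun_prop
    simpa [hρ] using this.tendsto 0
  let c : Fin 3 → ℝ := fun j => (j : ℕ)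
  have hc0 : ∀ j, 0 ≤ c j := fun j => Nat.cast_nonneg _
  have hc2 : ∀ j, c j ≤ 2 := fun j => by
    have : (j : ℕ) ≤ 2 := by omega
    show ((j : ℕ) : ℝ) ≤ 2
    exact_mod_cast this
  let U : Fin 3 → ι × ℝ → Control d p := fun j i => u i.1 + (c j * ρ i.2) • w i.1
  have hsm : ∀ j (i : ι × ℝ), ‖(c j * ρ i.2) • w i.1‖ ≤ 2 * ρ i.2 * R := fun j i => by
    rw [norm_smul, Real.norm_of_nonneg (mul_nonneg (hc0 j) (hρ0 _))]
    have := hρ0 i.2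
    gcongr
    · exact hc2 j
    · exact hw _
  have hsmall := smallDifferencesAt_solution (l := l ×ˢ 𝓝 (0 : ℝ)) (σ := fun i => ρ i.2)
    (u := U) (v := v) (R := 3 * R) (γ := fun j i => γ (U j i)) (γ₀ := γ v) hp hp_top hX₀ hX
    (fun j i => by
      refine (norm_add_le _ _).trans ?_
      have h1 := hsm j i
      have h2 := hu i.1
      have h3 := mul_le_mul_of_nonneg_right (hρ1 i.2) hR
      linarith)
    (by linarith)
    (fun j => by
      have h1 : PrimitiveTendsto (l ×ˢ 𝓝 (0 : ℝ)) (fun i => u i.1) v := h.comp tendsto_fst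
      have h2 : PrimitiveTendsto (l ×ˢ 𝓝 (0 : ℝ)) (fun i => (c j * ρ i.2) • w i.1) 0 := by
        refine PrimitiveTendsto.of_tendsto hp_top ?_
        refine squeeze_zero_norm (hsm j) ?_
        have := (((hρt.comp tendsto_snd).const_mul 2).mul_const R :
          Tendsto (fun i : ι × ℝ => 2 * ρ i.2 * R) (l ×ˢ 𝓝 (0 : ℝ)) _)
        simpa using this
      simpa using h1.add h2)
    (fun i => by
      simp only [U, c]
      norm_num
      module)
    (fun i => by
      have : U 1 i - U 0 i = ρ i.2 • w i.1 := by simp [U, c]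
      rw [this, norm_smul, Real.norm_of_nonneg (hρ0 _)]
      have h1 := mul_le_mul_of_nonneg_left (hw i.1) (hρ0 i.2)
      have h2 := mul_nonneg (hρ0 i.2) hR
      linarith)
    (fun j i => (hγ _).solvesChartwiseOn hX₀ hX) ((hγ v).solvesChartwiseOn hX₀ hX)
    (fun j i => (hγ _).initial.trans (hγ v).initial.symm) 1 (by simp)
  obtain ⟨C, -, hev⟩ := hsmall
  simp only [hγ1] at hev
  obtain ⟨P, hP, Q, hQ, hPQ⟩ := eventually_prod_iff.1 hev
  obtain ⟨s₀, hs₀, hball⟩ := Metric.eventually_nhds_iff.1 hQ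
  refine ⟨C, min s₀ 1, by positivity, ?_⟩
  filter_upwards [hP] with i hi s hs
  have hs1 : ρ s = s := by
    simp only [hρ]
    rw [abs_of_pos hs.1, min_eq_left (hs.2.le.trans (min_le_right _ _))]
  have := (hPQ hi (hball (y := s) (by
    rw [Real.dist_eq, sub_zero, abs_of_pos hs.1]
    exact hs.2.trans_le (min_le_left _ _)))).2.2
  simpa [U, c, hs1] using this

/-- The derivative of the endpoint map is sequentially continuous for weak convergence of both the
control and the direction. -/
theorem tendsto_endpointDerivative [l.NeBot] (hp : 1 < p) (hp_top : p ≠ ⊤)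
    (hX₀ : IsSmoothField X₀) (hX : ∀ i, IsSmoothField (X i))
    (hall : ∀ u : Control d p, u ∈ admissible p X₀ X x) {y : M} (hy : IsRegularValue p X₀ X x y)
    {u w : ι → Control d p} {v z : Control d p} {R : ℝ} (hu : ∀ i, ‖u i‖ ≤ R)
    (hw : ∀ i, ‖w i‖ ≤ R) (huy : ∀ i, endpoint X₀ X x (u i) = y) (h : PrimitiveTendsto l u v)
    (h' : PrimitiveTendsto l w z) :
    Tendsto (fun i => endpointDerivative X₀ X x (u i) (w i)) l
      (𝓝 (endpointDerivative X₀ X x v z)) := by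
  obtain ⟨R', hR, hvR, hzR⟩ : ∃ R', R ≤ R' ∧ ‖v‖ ≤ R' ∧ ‖z‖ ≤ R' :=
    ⟨max R (max ‖v‖ ‖z‖), le_max_left _ _, (le_max_left _ _).trans (le_max_right _ _),
      (le_max_right _ _).trans (le_max_right _ _)⟩
  replace hu : ∀ i, ‖u i‖ ≤ R' := fun i => (hu i).trans hR
  replace hw : ∀ i, ‖w i‖ ≤ R' := fun i => (hw i).trans hR
  have hR0 : 0 ≤ R' := (norm_nonneg _).trans hvR
  have hvy : endpoint X₀ X x v = y := by
    have := tendsto_endpoint hp hp_top hX₀ hX hall hu hvR h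
    simp only [huy] at this
    exact tendsto_nhds_unique this tendsto_const_nhds
  set Φ : Control d p → EuclideanSpace ℝ (Fin n) :=
    fun u => extChartAt (𝓡 n) y (endpoint X₀ X x u) with hΦ
  have hder : ∀ u w : Control d p, endpoint X₀ X x u = y →
      HasDerivAt (fun s : ℝ => Φ (u + s • w)) (endpointDerivative X₀ X x u w) 0 := by
    intro u w huy
    have h1 := hasFDerivAt_endpoint (hy u ⟨hall u, huy⟩)
    rw [huy] at h1
    have h2 : HasDerivAt (fun s : ℝ => u + s • w) w 0 := by
      simpa using ((hasDerivAt_id (0 : ℝ)).smul_const w).const_add u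
    have h3 : HasFDerivAt Φ (endpointDerivative X₀ X x u) (u + (0 : ℝ) • w) := by
      rw [zero_smul, add_zero]
      exact h1
    exact h3.comp_hasDerivAt 0 h2
  obtain ⟨C, s₀, hs₀, hev⟩ :=
    exists_second_difference_endpoint_le hp hp_top hX₀ hX hall hu hw hvR h
  obtain ⟨C', s₀', hs₀', hev'⟩ := exists_second_difference_endpoint_le (l := l)
    (u := fun _ => v) (w := fun _ => z) hp hp_top hX₀ hX hall (fun _ => hvR) (fun _ => hzR) hvR
    (PrimitiveTendsto.of_tendsto hp_top tendsto_const_nhds)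
  rw [hvy] at hev hev'
  obtain ⟨-, hev'⟩ := hev'.exists
  -- For a fixed small step, weak continuity of `F` gives convergence of the displaced endpoints;
  -- `s` is taken small enough for the limit endpoint to lie in the chart at `y`.
  have hlim : ∀ᶠ s : ℝ in 𝓝[>] 0, Tendsto (fun i => Φ (u i + s • w i)) l (𝓝 (Φ (v + s • z))) := by
    have hz : Tendsto (fun s : ℝ => endpoint X₀ X x (v + s • z)) (𝓝 0) (𝓝 y) := by
      have h1 : Continuous fun s : ℝ => v + s • z := by fun_prop
      have := ((continuous_endpoint hp hp_top hX₀ hX hall).comp h1).tendsto 0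
      rw [Function.comp_apply, zero_smul, add_zero, hvy] at this
      exact this
    filter_upwards [nhdsWithin_le_nhds (hz.eventually (extChartAt_source_mem_nhds (I := 𝓡 n) y)),
      Ioo_mem_nhdsGT (zero_lt_one (α := ℝ))] with s hs hs1
    have hbd : ∀ u w : Control d p, ‖u‖ ≤ R' → ‖w‖ ≤ R' → ‖u + s • w‖ ≤ 2 * R' := by
      intro u w hu hw
      refine (norm_add_le _ _).trans ?_
      rw [norm_smul, Real.norm_of_nonneg hs1.1.le]
      nlinarith [hs1.1, hs1.2, norm_nonneg w]
    exact (continuousAt_extChartAt' hs).tendsto.comp (tendsto_endpoint hp hp_top hX₀ hX hall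
      (fun i => hbd _ _ (hu i) (hw i)) (hbd _ _ hvR hzR) (h.add (h'.const_smul s)))
  have hlim0 : Tendsto (fun i => Φ (u i)) l (𝓝 (Φ v)) := by
    simp only [hΦ, huy, hvy]
    exact tendsto_const_nhds
  rw [Metric.tendsto_nhds]
  intro ε hε
  have hsmall : ∀ᶠ s : ℝ in 𝓝[>] 0, (C + C') * s < ε / 2 := by
    have : Tendsto (fun s : ℝ => (C + C') * s) (𝓝[>] 0) (𝓝 0) := by
      have : Tendsto (fun s : ℝ => (C + C') * s) (𝓝 0) (𝓝 ((C + C') * 0)) :=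
        tendsto_id.const_mul _
      rw [mul_zero] at this
      exact this.mono_left nhdsWithin_le_nhds
    exact this.eventually (gt_mem_nhds (by positivity))
  -- The step `s` is fixed before `i`: replacing both derivatives by difference quotients costs at
  -- most `(C + C') * s < ε / 2`, uniformly in `i`, and the quotients are then compared along `l`.
  obtain ⟨s, hs1, hs2, hs3⟩ := (hlim.and (hsmall.and (Ioo_mem_nhdsGT
    (lt_min hs₀ hs₀')))).exists
  have hsC : s ∈ Ioo 0 s₀ := ⟨hs3.1, hs3.2.trans_le (min_le_left _ _)⟩
  have hsC' : s ∈ Ioo 0 s₀' := ⟨hs3.1, hs3.2.trans_le (min_le_right _ _)⟩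
  have hD : Tendsto (fun i => s⁻¹ • (Φ (u i + s • w i) - Φ (u i))) l
      (𝓝 (s⁻¹ • (Φ (v + s • z) - Φ v))) := (hs1.sub hlim0).const_smul _
  filter_upwards [hev, Metric.tendsto_nhds.1 hD (ε / 2) (by positivity)] with i h1 h2
  have e1 := norm_sub_smul_le_of_second_difference (hder (u i) (w i) (huy i)) h1 hsC
  have e2 := norm_sub_smul_le_of_second_difference (hder v z hvy) hev' hsC'
  simp only [zero_smul, add_zero] at e1 e2
  rw [dist_eq_norm] at h2 ⊢
  set D1 := s⁻¹ • (Φ (u i + s • w i) - Φ (u i))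
  set D2 := s⁻¹ • (Φ (v + s • z) - Φ v)
  set A1 := endpointDerivative X₀ X x (u i) (w i)
  set A2 := endpointDerivative X₀ X x v z
  have e3 : A1 - A2 = -(D1 - A1) + (D2 - A2) + (D1 - D2) := by abel
  rw [e3]
  refine norm_add₃_le.trans_lt ?_
  rw [norm_neg]
  linarith

end Endpoint

/-- If operators `A k` converge pointwise to a surjective operator onto a finite dimensional space,
then `A k z = e` is eventually solvable with uniform bounds. -/
theorem exists_uniform_preimage {Z E : Type*} [NormedAddCommGroup Z] [NormedSpace ℝ Z]
    [NormedAddCommGroup E] [NormedSpace ℝ E] [FiniteDimensional ℝ E] {κ : Type*} {l : Filter κ}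
    {A : κ → Z →L[ℝ] E} {A₀ : Z →L[ℝ] E} (hA₀ : Function.Surjective A₀)
    (hA : ∀ z, Tendsto (fun k => A k z) l (𝓝 (A₀ z))) :
    ∃ C, 0 ≤ C ∧ ∀ᶠ k in l, ∀ e, ∃ z, A k z = e ∧ ‖z‖ ≤ C * ‖e‖ := by
  -- With `S` a right inverse of `A₀`, the maps `A k ∘ S` tend to the identity on a basis, hence in
  -- operator norm. Within distance `1 / 2` of the identity they are invertible with inverse of norm
  -- at most `2`, which explains the constant `‖S‖ * 2`.
  obtain ⟨S', hS'⟩ := A₀.toLinearMap.exists_rightInverse_of_surjective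
    (LinearMap.range_eq_top.2 hA₀)
  set S : E →L[ℝ] Z := LinearMap.toContinuousLinearMap S' with hS
  have hAS : ∀ e, A₀ (S e) = e := fun e => LinearMap.congr_fun hS' e
  let b := Module.finBasis ℝ E
  obtain ⟨B, hB, hBle⟩ := b.exists_opNorm_le (F := E)
  refine ⟨‖S‖ * 2, by positivity, ?_⟩
  have hev : ∀ᶠ k in l, ∀ i, ‖(A k (S (b i))) - b i‖ ≤ 1 / (2 * B) := by
    refine eventually_all.2 fun i => ?_
    have h1 := hA (S (b i))
    rw [hAS] at h1
    have h2 := (tendsto_iff_norm_sub_tendsto_zero.1 h1).eventually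
      (gt_mem_nhds (show 0 < 1 / (2 * B) by positivity))
    exact h2.mono fun k hk => hk.le
  filter_upwards [hev] with k hk e
  set T : E →L[ℝ] E := (A k).comp S with hT
  have h1 : ‖T - ContinuousLinearMap.id ℝ E‖ ≤ 1 / 2 := by
    refine (hBle (M := 1 / (2 * B)) (by positivity) fun i => hk i).trans (le_of_eq ?_)
    field_simp
  have h2 : ∀ f, ‖f‖ ≤ 2 * ‖T f‖ := by
    intro f
    have h3 := (T - ContinuousLinearMap.id ℝ E).le_of_opNorm_le h1 f
    have h4 : f = T f - (T - ContinuousLinearMap.id ℝ E) f := by simp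
    have h5 := _root_.norm_sub_le (T f) ((T - ContinuousLinearMap.id ℝ E) f)
    rw [← h4] at h5
    linarith
  have hinj : Function.Injective T.toLinearMap := by
    rw [injective_iff_map_eq_zero]
    intro f hf
    have := h2 f
    have hf' : T f = 0 := hf
    rw [hf', norm_zero, mul_zero] at this
    exact norm_le_zero_iff.1 this
  obtain ⟨f, hf⟩ := LinearMap.injective_iff_surjective.1 hinj e
  have hf' : T f = e := hf
  refine ⟨S f, hf', (S.le_opNorm f).trans ?_⟩
  rw [mul_assoc]
  gcongr
  rw [← hf']
  exact h2 f

theorem energy_midpoint_le {d : ℕ} {p : ℝ≥0∞} [Fact (1 ≤ p)] (hp : 1 < p) (hp_top : p ≠ ⊤)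
    (u v : Control d p) :
    energy u / 2 + energy v / 2 - energy ((2⁻¹ : ℝ) • (u + v)) ≤
      (fderiv ℝ energy u (u - v) - fderiv ℝ energy v (u - v)) / 4 := by
  have hd := differentiable_energy (d := d) hp hp_top
  have h1 := add_apply_sub_le_of_convexOn (X := Control d p) (f := energy) (convexOn_energy hp hp_top) (hd u).hasFDerivAt
    ((2⁻¹ : ℝ) • (u + v))
  have h2 := add_apply_sub_le_of_convexOn (X := Control d p) (f := energy) (convexOn_energy hp hp_top) (hd v).hasFDerivAt
    ((2⁻¹ : ℝ) • (u + v))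
  have e1 : (2⁻¹ : ℝ) • (u + v) - u = (-2⁻¹ : ℝ) • (u - v) := by module
  have e2 : (2⁻¹ : ℝ) • (u + v) - v = (2⁻¹ : ℝ) • (u - v) := by module
  rw [e1, map_smul, smul_eq_mul] at h1
  rw [e2, map_smul, smul_eq_mul] at h2
  linarith

/-- By convexity the differential on the ball of radius `R` is bounded by the values of the energy
on the ball of radius `R + 1`. -/
theorem exists_norm_fderiv_energy_le {d : ℕ} {p : ℝ≥0∞} [Fact (1 ≤ p)] (hp : 1 < p)
    (hp_top : p ≠ ⊤) (R : ℝ) :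
    ∃ C, ∀ u : Control d p, ‖u‖ ≤ R → ‖fderiv ℝ energy u‖ ≤ C := by
  refine ⟨d * (R + 1) ^ p.toReal, fun u hu => ?_⟩
  refine norm_le_of_convexOn (X := Control d p) (f := energy) (convexOn_energy hp hp_top)
    (differentiable_energy hp hp_top u).hasFDerivAt fun w hw => ?_
  have h1 := energy_le_of_norm_le hp hp_top (show ‖u + w‖ ≤ R + 1 by
    linarith [norm_add_le u w])
  have h2 := energy_nonneg u
  linarith

/-! ### The Palais–Smale argument -/

section PalaisSmale

variable {n d : ℕ} {M : Type*} [TopologicalSpace M] [T2Space M]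
  [ChartedSpace (EuclideanSpace ℝ (Fin n)) M] [IsManifold (𝓡 n) ∞ M]
  {p : ℝ≥0∞} [Fact (1 ≤ p)] {X₀ : (q : M) → TangentSpace (𝓡 n) q}
  {X : Fin d → (q : M) → TangentSpace (𝓡 n) q} {x y : M}

/-- Along a weakly convergent Palais-Smale sequence, the differential of the energy vanishes
asymptotically on differences. -/
theorem tendsto_fderiv_energy_sub (hp : 1 < p) (hp_top : p ≠ ⊤) (hX₀ : IsSmoothField X₀)
    (hX : ∀ i, IsSmoothField (X i)) (hall : ∀ u : Control d p, u ∈ admissible p X₀ X x)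
    (hy : IsRegularValue p X₀ X x y) {u : ℕ → Control d p} {v : Control d p} {R : ℝ}
    (hu : ∀ k, ‖u k‖ ≤ R) (huy : ∀ k, endpoint X₀ X x (u k) = y) (huv : PrimitiveTendsto atTop u v)
    (hvy : endpoint X₀ X x v = y)
    (hdiff : Tendsto (fun k => ‖restrictedEnergyDifferential X₀ X x (u k)‖) atTop (𝓝 0)) :
    Tendsto (fun i : ℕ × ℕ => fderiv ℝ energy (u i.1) (u i.1 - u i.2)) (atTop ×ˢ atTop) (𝓝 0) := by
  have hδ : ∀ i : ℕ × ℕ, ‖u i.1 - u i.2‖ ≤ 2 * R := fun i =>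
    (_root_.norm_sub_le _ _).trans (by linarith [hu i.1, hu i.2])
  have hR : 0 ≤ R := (norm_nonneg _).trans (hu 0)
  -- Along the double index the differences converge weakly to `v - v = 0` while the base points
  -- converge weakly to `v`.
  have hAδ : Tendsto (fun i : ℕ × ℕ => endpointDerivative X₀ X x (u i.1) (u i.1 - u i.2))
      (atTop ×ˢ atTop) (𝓝 0) := by
    have := tendsto_endpointDerivative (l := (atTop : Filter ℕ) ×ˢ (atTop : Filter ℕ)) (R := 2 * R)
      hp hp_top hX₀ hX hall hy (u := fun i => u i.1) (fun i => by linarith [hu i.1]) hδ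
      (fun i => huy i.1) (huv.comp tendsto_fst)
      ((huv.comp tendsto_fst).sub (huv.comp tendsto_snd))
    simpa using this
  -- Surjectivity at the weak limit `v`, together with pointwise convergence of the derivatives,
  -- gives corrections with a constant independent of `k`.
  obtain ⟨C, hC, hpre⟩ := exists_uniform_preimage (l := atTop)
    (A := fun k => endpointDerivative X₀ X x (u k)) (hy v ⟨hall v, hvy⟩) fun z =>
      tendsto_endpointDerivative (R := max R ‖z‖) hp hp_top hX₀ hX hall hy
        (fun i => (hu i).trans (le_max_left _ _)) (fun _ => le_max_right _ _) huy huv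
        (PrimitiveTendsto.of_tendsto hp_top tendsto_const_nhds)
  obtain ⟨D, hD⟩ := exists_norm_fderiv_energy_le (d := d) hp hp_top R
  set r : ℕ × ℕ → ℝ := fun i => ‖endpointDerivative X₀ X x (u i.1) (u i.1 - u i.2)‖
  have hr : Tendsto r (atTop ×ˢ atTop) (𝓝 0) := tendsto_zero_iff_norm_tendsto_zero.1 hAδ
  -- The difference is a kernel vector of norm at most `2 * R + C * r`, on which the Palais–Smale
  -- hypothesis acts, plus a correction of norm at most `C * r`, on which the bound `D` of the full
  -- differential acts.
  refine squeeze_zero_norm' (a := fun i => ‖restrictedEnergyDifferential X₀ X x (u i.1)‖ *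
    (2 * R + C * r i) + D * (C * r i)) ?_ ?_
  · filter_upwards [tendsto_fst.eventually hpre] with i hi
    obtain ⟨z, hz, hzle⟩ := hi (endpointDerivative X₀ X x (u i.1) (u i.1 - u i.2))
    have hker : u i.1 - u i.2 - z ∈ tangentFiber X₀ X x (u i.1) := by
      have : endpointDerivative X₀ X x (u i.1) (u i.1 - u i.2 - z) = 0 := by
        rw [map_sub, hz, sub_self]
      exact this
    have h1 := (restrictedEnergyDifferential X₀ X x (u i.1)).le_opNorm ⟨_, hker⟩
    have h2 : ‖fderiv ℝ energy (u i.1) (u i.1 - u i.2 - z)‖ ≤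
        ‖restrictedEnergyDifferential X₀ X x (u i.1)‖ * ‖u i.1 - u i.2 - z‖ := h1
    have h3 := (fderiv ℝ energy (u i.1)).le_of_opNorm_le (hD _ (hu i.1)) z
    have h4 := norm_add_le (fderiv ℝ energy (u i.1) (u i.1 - u i.2 - z))
      (fderiv ℝ energy (u i.1) z)
    rw [← map_add, sub_add_cancel] at h4
    have hD0 : 0 ≤ D := (norm_nonneg _).trans (hD _ (hu i.1))
    refine h4.trans (add_le_add (h2.trans ?_) (h3.trans ?_))
    · gcongr
      exact (_root_.norm_sub_le _ _).trans (add_le_add (hδ i) hzle)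
    · gcongr
  · have h1 : Tendsto (fun i : ℕ × ℕ => ‖restrictedEnergyDifferential X₀ X x (u i.1)‖)
      (atTop ×ˢ atTop) (𝓝 0) := hdiff.comp tendsto_fst
    have h2 := (h1.mul ((hr.const_mul C).const_add (2 * R))).add ((hr.const_mul C).const_mul D)
    simpa using h2

theorem exists_subseq_tendsto_of_forall_admissible (hp : 1 < p) (hp_top : p ≠ ⊤)
    (hX₀ : IsSmoothField X₀) (hX : ∀ i, IsSmoothField (X i))
    (hall : ∀ u : Control d p, u ∈ admissible p X₀ X x)
    (hy : IsRegularValue p X₀ X x y) {u : ℕ → Control d p} (hu : ∀ k, u k ∈ fiber p X₀ X x y)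
    {C : ℝ} (hbound : ∀ k, |energy (u k)| ≤ C)
    (hdiff : Tendsto (fun k => ‖restrictedEnergyDifferential X₀ X x (u k)‖) atTop (𝓝 0)) :
    ∃ v ∈ fiber p X₀ X x y, ∃ φ : ℕ → ℕ, StrictMono φ ∧
      Tendsto (fun k => u (φ k)) atTop (𝓝 v) := by
  obtain ⟨R, hR⟩ := exists_norm_le_of_energy_le (d := d) hp hp_top C
  have huR : ∀ k, ‖u k‖ ≤ R := fun k => hR _ ((le_abs_self _).trans (hbound k))
  obtain ⟨v, φ, hφ, hv⟩ := exists_subseq_primitiveTendsto hp hp_top huR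
  have hvy : endpoint X₀ X x v = y := by
    have := tendsto_endpoint hp hp_top hX₀ hX hall (R := max R ‖v‖)
      (fun i => (huR (φ i)).trans (le_max_left _ _)) (le_max_right _ _) hv
    simp only [fun k => (hu k).2] at this
    exact tendsto_nhds_unique this tendsto_const_nhds
  have hsub := tendsto_fderiv_energy_sub hp hp_top hX₀ hX hall hy (fun k => huR (φ k))
    (fun k => (hu (φ k)).2) hv hvy (hdiff.comp hφ.tendsto_atTop)
  -- Exchanging the two indices gives the term with the differential taken at the other control, up
  -- to sign.
  have hsub' := hsub.comp (tendsto_snd.prodMk tendsto_fst)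
  have hdist := tendsto_norm_sub_of_energy_midpoint hp hp_top (R := R)
    (l := (atTop : Filter ℕ) ×ˢ (atTop : Filter ℕ)) (u := fun i => u (φ i.1))
    (v := fun i => u (φ i.2)) (fun i => huR _) (fun i => huR _) fun ε hε => by
      filter_upwards [hsub.eventually (gt_mem_nhds hε), hsub'.eventually (gt_mem_nhds hε)]
        with i h1 h2
      refine (energy_midpoint_le hp hp_top _ _).trans ?_
      have h3 : fderiv ℝ energy (u (φ i.2)) (u (φ i.2) - u (φ i.1)) < ε := h2
      rw [← neg_sub, map_neg] at h3
      linarith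
  have hcauchy : CauchySeq fun k => u (φ k) := by
    rw [cauchySeq_iff_tendsto_dist_atTop_0, ← prod_atTop_atTop_eq]
    simpa only [dist_eq_norm] using hdist
  obtain ⟨v', hv'⟩ := cauchySeq_tendsto_of_complete hcauchy
  -- The strong limit need not be compared with the weak limit `v`: continuity of `F` puts it in the
  -- fibre directly.
  refine ⟨v', ⟨hall v', ?_⟩, φ, hφ, hv'⟩
  have := ((continuous_endpoint hp hp_top hX₀ hX hall).tendsto v').comp hv'
  have h2 : (endpoint X₀ X x ∘ fun k => u (φ k)) = fun _ => y := funext fun k => (hu (φ k)).2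
  rw [h2] at this
  exact tendsto_nhds_unique this tendsto_const_nhds

end PalaisSmale

/-! ### Local existence by Picard iteration -/

section LocalExistence

variable {E W : Type*} [NormedAddCommGroup E] [NormedSpace ℝ E] [CompleteSpace E]
  [NormedAddCommGroup W] [NormedSpace ℝ W]

/-- Local existence for `ξ' = B(ξ) u` in a ball, on an interval on which `u` is small in `L¹`. -/
theorem exists_solvesOn {B : E → W →L[ℝ] E} {u : ℝ → W} {z x₀ : E} {a b r L : ℝ} (hab : a ≤ b)
    (hL : 0 ≤ L) (hB : SecondOrderBounded B (Metric.closedBall z (2 * r)) L)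
    (hu : IntervalIntegrable u volume a b) (hsmall : L * ∫ t in a..b, ‖u t‖ ≤ 1 / 2)
    (hsmall' : L * ∫ t in a..b, ‖u t‖ ≤ r) (hx₀ : x₀ ∈ Metric.closedBall z r) :
    ∃ ξ : ℝ → E, ξ a = x₀ ∧ SolvesOn B u a b ξ ∧
      ∀ t ∈ Icc a b, ξ t ∈ Metric.closedBall z (2 * r) := by
  set K := Metric.closedBall z (2 * r) with hK
  have hr : 0 ≤ r := dist_nonneg.trans (Metric.mem_closedBall.1 hx₀)
  -- The complete space for the contraction argument: continuous curves with values in the ball. The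
  -- bound by `r` makes the Picard map preserve it, and the bound by `1 / 2` is the contraction
  -- factor.
  let S : Set C(Icc a b, E) := {ξ | ∀ t, ξ t ∈ K}
  have hSclosed : IsClosed S := by
    have : S = ⋂ t, (fun ξ : C(Icc a b, E) => ξ t) ⁻¹' K := by ext; simp [S]
    rw [this]
    exact isClosed_iInter fun t => Metric.isClosed_closedBall.preimage
      (continuous_eval_const t)
  have : CompleteSpace S := hSclosed.completeSpace_coe
  let ext : S → ℝ → E := fun ξ => IccExtend hab ξ.1
  have hextc : ∀ ξ, Continuous (ext ξ) := fun ξ => ξ.1.continuous.Icc_extend'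
  have hextK : ∀ ξ t, ext ξ t ∈ K := fun ξ t => ξ.2 _
  have hint : ∀ ξ, IntervalIntegrable (fun s => B (ext ξ s) (u s)) volume a b := fun ξ =>
    intervalIntegrable_clm_apply hab
      (hB.continuousOn.comp (hextc ξ).continuousOn fun t _ => hextK ξ t) hu
  have hsubt : ∀ t ∈ Icc a b, uIcc a t ⊆ uIcc a b := fun t ht =>
    uIcc_subset_uIcc left_mem_uIcc (by rwa [uIcc_of_le hab])
  have hmono : ∀ t ∈ Icc a b, ∫ s in a..t, ‖u s‖ ≤ ∫ s in a..b, ‖u s‖ := fun t ht =>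
    intervalIntegral.integral_mono_interval le_rfl ht.1 ht.2
      (ae_of_all _ fun s => norm_nonneg _) hu.norm
  let P : S → ℝ → E := fun ξ t => x₀ + ∫ s in a..t, B (ext ξ s) (u s)
  have hPc : ∀ ξ, ContinuousOn (P ξ) (Icc a b) := fun ξ => by
    have := intervalIntegral.continuousOn_primitive_interval' (hint ξ) left_mem_uIcc
    rw [uIcc_of_le hab] at this
    exact continuousOn_const.add this
  have hPK : ∀ ξ, ∀ t ∈ Icc a b, P ξ t ∈ K := by
    intro ξ t ht
    have h1 : ‖∫ s in a..t, B (ext ξ s) (u s)‖ ≤ ∫ s in a..t, L * ‖u s‖ :=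
      intervalIntegral.norm_integral_le_of_norm_le ht.1 (ae_of_all _ fun s _ =>
        (B (ext ξ s)).le_of_opNorm_le (hB.bound _ (hextK ξ s)) _)
        ((hu.norm.const_mul L).mono_set (hsubt t ht))
    rw [intervalIntegral.integral_const_mul] at h1
    have h2 := mul_le_mul_of_nonneg_left (hmono t ht) hL
    have h3 := Metric.mem_closedBall.1 hx₀
    rw [hK, Metric.mem_closedBall]
    calc dist (P ξ t) z ≤ dist (P ξ t) x₀ + dist x₀ z := dist_triangle _ _ _
      _ ≤ r + r := by
        refine add_le_add ?_ h3
        rw [dist_eq_norm]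
        simp only [P, add_sub_cancel_left]
        linarith
      _ = 2 * r := by ring
  let Γ : S → S := fun ξ => ⟨⟨fun t => P ξ t, (hPc ξ).comp_continuous continuous_subtype_val
    fun t => t.2⟩, fun t => hPK ξ t t.2⟩
  have hΓ : ContractingWith (1 / 2) Γ := by
    refine ⟨by
      rw [← NNReal.coe_lt_coe]
      norm_num, LipschitzWith.of_dist_le_mul fun ξ η => ?_⟩
    rw [Subtype.dist_eq, ContinuousMap.dist_le (by positivity)]
    intro t
    have hdist : ∀ s, ‖ext ξ s - ext η s‖ ≤ dist ξ η := fun s => by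
      rw [← dist_eq_norm, Subtype.dist_eq]
      exact ContinuousMap.dist_apply_le_dist _
    have h0 : dist (P ξ t) (P η t) = ‖∫ s in a..(t : ℝ), (B (ext ξ s) - B (ext η s)) (u s)‖ := by
      simp only [P, dist_eq_norm, _root_.sub_apply, add_sub_add_left_eq_sub]
      rw [intervalIntegral.integral_sub ((hint ξ).mono_set (hsubt t t.2))
        ((hint η).mono_set (hsubt t t.2))]
    have h1 : ‖∫ s in a..(t : ℝ), (B (ext ξ s) - B (ext η s)) (u s)‖ ≤
        ∫ s in a..(t : ℝ), (L * dist ξ η) * ‖u s‖ :=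
      intervalIntegral.norm_integral_le_of_norm_le t.2.1 (ae_of_all _ fun s _ => by
        refine (B (ext ξ s) - B (ext η s)).le_of_opNorm_le
          ((hB.lipschitz _ (hextK ξ s) _ (hextK η s)).trans ?_) _
        gcongr
        exact hdist s) ((hu.norm.const_mul _).mono_set (hsubt t t.2))
    rw [intervalIntegral.integral_const_mul] at h1
    have h2 := mul_le_mul_of_nonneg_left ((mul_le_mul_of_nonneg_left (hmono t t.2) hL).trans hsmall)
      (dist_nonneg (x := ξ) (y := η))
    change dist (P ξ t) (P η t) ≤ _
    rw [h0]
    refine h1.trans ?_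
    push_cast
    linarith
  have : Nonempty S := ⟨⟨ContinuousMap.const _ x₀, fun _ =>
    Metric.closedBall_subset_closedBall (by linarith) hx₀⟩⟩
  set ξ := ContractingWith.fixedPoint Γ hΓ with hξ
  have hfix : Γ ξ = ξ := hΓ.fixedPoint_isFixedPt
  have heq : ∀ t ∈ Icc a b, ext ξ t = P ξ t := by
    intro t ht
    have h1 : ext ξ t = ξ.1 ⟨t, ht⟩ := IccExtend_of_mem hab _ ht
    have h2 : (Γ ξ).1 ⟨t, ht⟩ = P ξ t := rfl
    rw [h1, ← h2, hfix]
  have ha : ext ξ a = x₀ := by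
    rw [heq a (left_mem_Icc.2 hab)]
    simp [P]
  refine ⟨ext ξ, ha, ⟨(hextc ξ).continuousOn, fun t ht => ?_⟩, fun t _ => hextK ξ t⟩
  rw [ha]
  exact heq t ht

end LocalExistence

/-! ### Gluing solutions and changing charts -/

section Concatenation

variable {n d : ℕ} {M : Type*} [TopologicalSpace M] [ChartedSpace (EuclideanSpace ℝ (Fin n)) M]
  [IsManifold (𝓡 n) ∞ M] {p : ℝ≥0∞} [Fact (1 ≤ p)] {X₀ : (q : M) → TangentSpace (𝓡 n) q}
  {X : Fin d → (q : M) → TangentSpace (𝓡 n) q}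

theorem intervalIntegrable_systemField (hX₀ : IsSmoothField X₀) (hX : ∀ i, IsSmoothField (X i))
    (u : Control d p) {c : M} {ξ : ℝ → EuclideanSpace ℝ (Fin n)} {a b : ℝ}
    (ha : 0 ≤ a) (hab : a ≤ b) (hb : b ≤ 1) (hξ : ContinuousOn ξ (Icc a b))
    (hmaps : MapsTo ξ (Icc a b) (extChartAt (𝓡 n) c).target) :
    IntervalIntegrable (fun s => systemField X₀ X c (ξ s) (extendedControl u s)) volume a b :=
  intervalIntegrable_clm_apply hab ((contDiffOn_systemField hX₀ hX c).continuousOn.comp hξ hmaps)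
    (intervalIntegrable_extendedControl u ⟨ha, hab.trans hb⟩ ⟨ha.trans hab, hb⟩)

theorem SolvesChartwiseOn.congr {u : Control d p} {a b : ℝ} {γ γ' : ℝ → M}
    (h : SolvesChartwiseOn X₀ X u a b γ) (heq : EqOn γ' γ (Icc a b)) :
    SolvesChartwiseOn X₀ X u a b γ' := by
  refine ⟨h.continuousOn.congr heq, fun c a' b' ha hab hb hm => ?_⟩
  have heq' : EqOn γ' γ (Icc a' b') := heq.mono (Icc_subset_Icc ha hb)
  have hs := h.solvesOn c a' b' ha hab hb fun t ht => by rw [← heq' ht]; exact hm ht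
  refine ⟨hs.continuousOn.congr fun t ht => by simp only [heq' ht], fun t ht => ?_⟩
  rw [heq' ht, heq' (left_mem_Icc.2 hab), hs.eq t ht]
  congr 1
  refine intervalIntegral.integral_congr fun s hs => ?_
  rw [uIcc_of_le ht.1] at hs
  simp only [heq' ⟨hs.1, hs.2.trans ht.2⟩]

theorem SolvesChartwiseOn.append (hX₀ : IsSmoothField X₀) (hX : ∀ i, IsSmoothField (X i))
    {u : Control d p} {a b c : ℝ} {γ : ℝ → M} (ha : 0 ≤ a) (hc : c ≤ 1) (hab : a ≤ b) (hbc : b ≤ c)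
    (h : SolvesChartwiseOn X₀ X u a b γ) (h' : SolvesChartwiseOn X₀ X u b c γ) :
    SolvesChartwiseOn X₀ X u a c γ := by
  have hcont : ContinuousOn γ (Icc a c) := by
    rw [← Icc_union_Icc_eq_Icc hab hbc]
    exact h.continuousOn.union_of_isClosed h'.continuousOn isClosed_Icc isClosed_Icc
  refine ⟨hcont, fun q a' b' ha' hab' hb' hm => ?_⟩
  have hξ : ContinuousOn (fun t => extChartAt (𝓡 n) q (γ t)) (Icc a' b') :=
    (continuousOn_extChartAt q).comp (hcont.mono (Icc_subset_Icc ha' hb')) fun t ht => by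
      rw [extChartAt_source]; exact hm ht
  have hξm : MapsTo (fun t => extChartAt (𝓡 n) q (γ t)) (Icc a' b') (extChartAt (𝓡 n) q).target :=
    fun t ht => (extChartAt (𝓡 n) q).map_source (by rw [extChartAt_source]; exact hm ht)
  rcases le_total b' b with hb'b | hbb'
  · exact h.solvesOn q a' b' ha' hab' hb'b hm
  rcases le_total b a' with hba' | ha'b
  · exact h'.solvesOn q a' b' hba' hab' hb' hm
  have hs := h.solvesOn q a' b ha' ha'b le_rfl (hm.mono_left (Icc_subset_Icc le_rfl hbb'))
  have hs' := h'.solvesOn q b b' le_rfl hbb' hb' (hm.mono_left (Icc_subset_Icc ha'b le_rfl))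
  refine ⟨hξ, fun t ht => ?_⟩
  rcases le_total t b with htb | hbt
  · exact hs.eq t ⟨ht.1, htb⟩
  have hint := fun s s' (h1 : a' ≤ s) (h2 : s ≤ s') (h3 : s' ≤ b') =>
    intervalIntegrable_systemField hX₀ hX u (ha.trans (ha'.trans h1)) h2 (h3.trans (hb'.trans hc))
      (hξ.mono (Icc_subset_Icc h1 h3)) (hξm.mono_left (Icc_subset_Icc h1 h3))
  rw [hs'.eq t ⟨hbt, ht.2⟩, hs.eq b (right_mem_Icc.2 ha'b), add_assoc,
    intervalIntegral.integral_add_adjacent_intervals (hint a' b le_rfl ha'b hbb')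
      (hint b t ha'b hbt ht.2)]

/-- A solution in one chart is a solution in every chart. -/
theorem SolvesOn.solvesChartwiseOn (hX₀ : IsSmoothField X₀) (hX : ∀ i, IsSmoothField (X i))
    {u : Control d p} {a b : ℝ} (ha : 0 ≤ a) (hb : b ≤ 1) {c : M}
    {ξ : ℝ → EuclideanSpace ℝ (Fin n)}
    (h : SolvesOn (systemField X₀ X c) (extendedControl u) a b ξ)
    (hmaps : MapsTo ξ (Icc a b) (extChartAt (𝓡 n) c).target) :
    SolvesChartwiseOn X₀ X u a b (fun t => (extChartAt (𝓡 n) c).symm (ξ t)) := by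
  have hcont : ContinuousOn (fun t => (extChartAt (𝓡 n) c).symm (ξ t)) (Icc a b) :=
    (continuousOn_extChartAt_symm c).comp h.continuousOn hmaps
  refine ⟨hcont, fun c' a' b' ha' hab' hb' hm => ?_⟩
  have hsub : Icc a' b' ⊆ Icc a b := Icc_subset_Icc ha' hb'
  have hdom : MapsTo ξ (Icc a' b') (coordDomain c c') := fun t ht => ⟨hmaps (hsub ht), hm ht⟩
  change SolvesOn _ _ _ _ (fun t => coordChange c c' (ξ t))
  have hξc : ContinuousOn ξ (Icc a' b') := h.continuousOn.mono hsub
  have hcc : ContinuousOn (fun t => coordChange c c' (ξ t)) (Icc a' b') :=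
    (contDiffOn_coordChange c c').continuousOn.comp hξc hdom
  have hcm : MapsTo (fun t => coordChange c c' (ξ t)) (Icc a' b') (extChartAt (𝓡 n) c').target :=
    fun t ht => (extChartAt (𝓡 n) c').map_source (by
      rw [extChartAt_source]; exact (hdom ht).2)
  have hint' := fun s s' (h1 : a' ≤ s) (h2 : s ≤ s') (h3 : s' ≤ b') =>
    intervalIntegrable_systemField hX₀ hX u (ha.trans (ha'.trans h1)) h2 (h3.trans (hb'.trans hb))
      (hcc.mono (Icc_subset_Icc h1 h3)) (hcm.mono_left (Icc_subset_Icc h1 h3))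
  have hint := fun s s' (h1 : a ≤ s) (h2 : s ≤ s') (h3 : s' ≤ b) =>
    intervalIntegrable_systemField hX₀ hX u (ha.trans h1) h2 (h3.trans hb)
      (h.continuousOn.mono (Icc_subset_Icc h1 h3)) (hmaps.mono_left (Icc_subset_Icc h1 h3))
  -- Near each time the coordinate change is Lipschitz on a ball around `ξ t₀`, which preserves
  -- absolute continuity and allows the transformed velocity to be integrated; the pieces are added
  -- by induction along the interval.
  refine ⟨hcc, forall_mem_Icc_of_local_step (by simp) fun t₀ ht₀ => ?_⟩
  obtain ⟨r, hr, hball⟩ := Metric.nhds_basis_closedBall.mem_iff.1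
    ((isOpen_coordDomain c c').mem_nhds (hdom ht₀))
  obtain ⟨L, hL, hSB⟩ := exists_secondOrderBounded (isOpen_coordDomain c c')
    (by exact_mod_cast contDiffOn_infty.1 (contDiffOn_coordChange c c') 2) hball
  obtain ⟨ε, hε, hnear⟩ := Metric.eventually_nhds_iff.1 (eventually_nhdsWithin_iff.1
    ((hξc t₀ ht₀).eventually (Metric.closedBall_mem_nhds _ hr)))
  refine ⟨ε, hε, fun s hs s' hs' hst hst' hss hPs => ?_⟩
  have hin : ∀ t ∈ Icc s s', ξ t ∈ Metric.closedBall (ξ t₀) r := by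
    intro t ht
    refine hnear ?_ ⟨hs.1.trans ht.1, ht.2.trans hs'.2⟩
    have h1 := abs_lt.1 hst
    have h2 := abs_lt.1 hst'
    rw [Real.dist_eq, abs_lt]
    exact ⟨by linarith [h1.1, ht.1], by linarith [h2.2, ht.2]⟩
  have hmem : ∀ t ∈ Icc s s', t ∈ Icc a b := fun t ht =>
    hsub ⟨hs.1.trans ht.1, ht.2.trans hs'.2⟩
  have hint0 := hint s s' (ha'.trans hs.1) hss (hs'.2.trans hb')
  have heq : ∀ t ∈ Icc s s', ξ t = ξ s +
      ∫ τ in s..t, systemField X₀ X c (ξ τ) (extendedControl u τ) := by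
    intro t ht
    have hta := hmem t ht
    have hsa := hmem s (left_mem_Icc.2 hss)
    rw [h.eq t hta, h.eq s hsa, add_assoc, intervalIntegral.integral_add_adjacent_intervals
      (hint a s le_rfl hsa.1 hsa.2) (hint s t hsa.1 ht.1 hta.2)]
  have hac : AbsolutelyContinuousOnInterval (fun t => coordChange c c' (ξ t)) s s' := by
    refine absolutelyContinuous_of_dist_le (C := L) (absolutelyContinuous_integral hint0) ?_
    intro t ht t' ht'
    rw [uIcc_of_le hss] at ht ht'
    have := hSB.lipschitz _ (hin t ht) _ (hin t' ht')
    rw [← dist_eq_norm, ← dist_eq_norm] at this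
    rw [heq t ht, heq t' ht', dist_add_left, ← heq t ht, ← heq t' ht'] at this
    exact this
  have hder : ∀ᵐ t, t ∈ Ioo s s' → HasDerivAt (fun t => coordChange c c' (ξ t))
      (systemField X₀ X c' (coordChange c c' (ξ t)) (extendedControl u t)) t := by
    filter_upwards [hint0.ae_hasDerivAt_integral] with t ht hts
    have hts' : t ∈ Icc s s' := Ioo_subset_Icc_self hts
    have h1 := ht (by rw [uIcc_of_le hss]; exact hts') s left_mem_uIcc
    have h2 : HasDerivAt ξ (systemField X₀ X c (ξ t) (extendedControl u t)) t := by
      refine (h1.const_add (ξ s)).congr_of_eventuallyEq ?_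
      filter_upwards [Ioo_mem_nhds hts.1 hts.2] with τ hτ
      exact heq τ (Ioo_subset_Icc_self hτ)
    have hdt := hball (hin t hts')
    rw [extendedControl, systemField_coordChange X₀ X hdt]
    exact (((contDiffOn_coordChange c c').contDiffAt
      ((isOpen_coordDomain c c').mem_nhds hdt)).differentiableAt
        (by simp)).hasFDerivAt.comp_hasDerivAt t h2
  have hint1 := hint' s s' hs.1 hss hs'.2
  rw [eq_add_integral_of_absolutelyContinuous hss hac hint1 hder s' (right_mem_Icc.2 hss), hPs,
    add_assoc, intervalIntegral.integral_add_adjacent_intervals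
      (hint' a' s le_rfl hs.1 hs.2) hint1]

end Concatenation

/-! ### Admissibility of all controls on a compact manifold -/

section Compact

variable {n d : ℕ} {M : Type*} [TopologicalSpace M] [ChartedSpace (EuclideanSpace ℝ (Fin n)) M]
  [IsManifold (𝓡 n) ∞ M] {p : ℝ≥0∞} [Fact (1 ≤ p)] {X₀ : (q : M) → TangentSpace (𝓡 n) q}
  {X : Fin d → (q : M) → TangentSpace (𝓡 n) q}

/-- If the coordinate expression of a curve has the velocity of the system, so does the curve. -/
theorem hasMFDerivAt_of_hasDerivAt_chart {c : M} {γ : ℝ → M} {t : ℝ}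
    {v : EuclideanSpace ℝ (Fin d)}
    (hγ : ∀ᶠ s in 𝓝 t, γ s ∈ (chartAt (EuclideanSpace ℝ (Fin n)) c).source)
    (h : HasDerivAt (fun s => extChartAt (𝓡 n) c (γ s))
      (systemField X₀ X c (extChartAt (𝓡 n) c (γ t)) ((1 : ℝ), v)) t) :
    HasMFDerivAt 𝓘(ℝ, ℝ) (𝓡 n) γ t
      (ContinuousLinearMap.toSpanSingleton ℝ (X₀ (γ t) + ∑ i : Fin d, v i • X i (γ t))) := by
  have ht := hγ.self_of_nhds
  have ht' : γ t ∈ (extChartAt (𝓡 n) c).source := by rwa [extChartAt_source]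
  rw [systemField_extChartAt X₀ X ht] at h
  have h1 : HasMFDerivAt 𝓘(ℝ, ℝ) 𝓘(ℝ, EuclideanSpace ℝ (Fin n))
      (fun s => extChartAt (𝓡 n) c (γ s)) t (ContinuousLinearMap.toSpanSingleton ℝ
        (chartDifferential c (γ t) (systemVelocity X₀ X (γ t) v))) :=
    hasMFDerivAt_iff_hasFDerivAt.2 h.hasFDerivAt
  have h2 := (((contMDiffOn_extChartAt_symm (I := 𝓡 n) (n := ∞) c).contMDiffAt
    ((isOpen_extChartAt_target c).mem_nhds
      ((extChartAt (𝓡 n) c).map_source ht'))).mdifferentiableAt (by simp)).hasMFDerivAt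
  have h3 := h2.comp t h1
  have h4 : (fun s => (extChartAt (𝓡 n) c).symm (extChartAt (𝓡 n) c (γ s))) =ᶠ[𝓝 t] γ := by
    filter_upwards [hγ] with s hs
    exact (extChartAt (𝓡 n) c).left_inv (by rwa [extChartAt_source])
  have h5 := h3.congr_of_eventuallyEq h4.symm
  have h6 := mfderivWithin_extChartAt_symm_comp_mfderiv_extChartAt' (I := 𝓡 n) ht'
  rw [ModelWithCorners.range_eq_univ, mfderivWithin_univ] at h6
  let D : EuclideanSpace ℝ (Fin n) →L[ℝ] EuclideanSpace ℝ (Fin n) :=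
    mfderiv 𝓘(ℝ, EuclideanSpace ℝ (Fin n)) (𝓡 n) (extChartAt (𝓡 n) c).symm
      (extChartAt (𝓡 n) c (γ t))
  have h7 : ∀ w : EuclideanSpace ℝ (Fin n), D (chartDifferential c (γ t) w) = w :=
    fun w => DFunLike.congr_fun h6 w
  have h8 : D.comp (ContinuousLinearMap.toSpanSingleton ℝ
      (chartDifferential c (γ t) (systemVelocity X₀ X (γ t) v))) =
      ContinuousLinearMap.toSpanSingleton ℝ (systemVelocity X₀ X (γ t) v) := by
    rw [ContinuousLinearMap.comp_toSpanSingleton, h7]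
  exact h5.congr_mfderiv h8

/-- The converse of `IsTrajectory.solvesChartwiseOn`: a primitive is absolutely continuous and has
the integrand as derivative almost everywhere. -/
theorem SolvesChartwiseOn.isTrajectory (hX₀ : IsSmoothField X₀) (hX : ∀ i, IsSmoothField (X i))
    {x : M} {u : Control d p} {γ : ℝ → M} (h : SolvesChartwiseOn X₀ X u 0 1 γ) (h0 : γ 0 = x) :
    IsTrajectory X₀ X x u γ := by
  have hint : ∀ (c : M) (a b : ℝ), 0 ≤ a → a ≤ b → b ≤ 1 →
      MapsTo γ (Icc a b) (chartAt (EuclideanSpace ℝ (Fin n)) c).source →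
      IntervalIntegrable (fun s => systemField X₀ X c (extChartAt (𝓡 n) c (γ s))
        (extendedControl u s)) volume a b := fun c a b ha hab hb hm =>
    intervalIntegrable_systemField hX₀ hX u ha hab hb (h.solvesOn c a b ha hab hb hm).continuousOn
      fun t ht => (extChartAt (𝓡 n) c).map_source (by rw [extChartAt_source]; exact hm ht)
  refine ⟨⟨h.continuousOn, fun c a b hab hsub hm => ?_⟩, h0, ?_⟩
  · have ha := (hsub (left_mem_Icc.2 hab)).1
    have hb := (hsub (right_mem_Icc.2 hab)).2
    have hs := h.solvesOn c a b ha hab hb hm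
    refine absolutelyContinuous_of_dist_le (C := 1)
      (absolutelyContinuous_integral (hint c a b ha hab hb hm)) fun s hs1 t ht => ?_
    rw [uIcc_of_le hab] at hs1 ht
    rw [hs.eq s hs1, hs.eq t ht, dist_add_left, one_mul]
  · rw [ae_restrict_iff' measurableSet_Icc]
    -- The almost everywhere statement itself is propagated in `T`; each piece lies in one chart and
    -- discards only one more null set.
    have key : ∀ T ∈ Icc (0 : ℝ) 1, ∀ᵐ t : ℝ, t ∈ Ioo 0 T → HasMFDerivAt 𝓘(ℝ, ℝ) (𝓡 n) γ t
        (ContinuousLinearMap.toSpanSingleton ℝ (X₀ (γ t) + ∑ i : Fin d, u t i • X i (γ t))) := by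
      refine forall_mem_Icc_of_local_step (ae_of_all _ fun t ht => absurd (ht.1.trans ht.2)
        (lt_irrefl _)) fun t₀ ht₀ => ?_
      obtain ⟨ε, hε, hnear⟩ := Metric.eventually_nhds_iff.1 (eventually_nhdsWithin_iff.1
        ((h.continuousOn t₀ ht₀).eventually (chart_source_mem_nhds
          (EuclideanSpace ℝ (Fin n)) (γ t₀))))
      refine ⟨ε, hε, fun a ha b hb hat hbt hab hPa => ?_⟩
      have hm : MapsTo γ (Icc a b) (chartAt (EuclideanSpace ℝ (Fin n)) (γ t₀)).source := by
        intro t ht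
        refine hnear ?_ ⟨ha.1.trans ht.1, ht.2.trans hb.2⟩
        have h1 := abs_lt.1 hat
        have h2 := abs_lt.1 hbt
        rw [Real.dist_eq, abs_lt]
        exact ⟨by linarith [h1.1, ht.1], by linarith [h2.2, ht.2]⟩
      have hs := h.solvesOn (γ t₀) a b ha.1 hab hb.2 hm
      have hne : ∀ᵐ t : ℝ, t ≠ a := by simp [ae_iff]
      filter_upwards [hPa, hne, (hint (γ t₀) a b ha.1 hab hb.2 hm).ae_hasDerivAt_integral]
        with t h1 h2 h3 ht
      rcases lt_or_gt_of_ne h2 with hlt | hgt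
      · exact h1 ⟨ht.1, hlt⟩
      have htab : t ∈ Ioo a b := ⟨hgt, ht.2⟩
      have hev : ∀ᶠ s in 𝓝 t, s ∈ Icc a b :=
        mem_of_superset (Ioo_mem_nhds htab.1 htab.2) Ioo_subset_Icc_self
      refine hasMFDerivAt_of_hasDerivAt_chart (hev.mono hm) ?_
      have h4 := h3 (by rw [uIcc_of_le hab]; exact Ioo_subset_Icc_self htab) a left_mem_uIcc
      refine (h4.const_add (extChartAt (𝓡 n) (γ t₀) (γ a))).congr_of_eventuallyEq ?_
      exact hev.mono fun s hs1 => hs.eq s hs1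
    have hne0 : ∀ᵐ t : ℝ, t ≠ 0 := by simp [ae_iff]
    have hne1 : ∀ᵐ t : ℝ, t ≠ 1 := by simp [ae_iff]
    filter_upwards [key 1 (by simp), hne0, hne1] with t h1 h2 h3 ht
    exact h1 ⟨lt_of_le_of_ne ht.1 h2.symm, lt_of_le_of_ne ht.2 h3⟩

/-- On a compact manifold, solutions exist on intervals of a uniform length. -/
theorem exists_uniform_time [CompactSpace M] (hp : 1 < p) (hp_top : p ≠ ⊤)
    (hX₀ : IsSmoothField X₀) (hX : ∀ i, IsSmoothField (X i)) (u : Control d p) :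
    ∃ ε > 0, ∀ m : M, ∀ a b, 0 ≤ a → a ≤ b → b ≤ 1 → b - a ≤ ε →
      ∃ γ : ℝ → M, γ a = m ∧ SolvesChartwiseOn X₀ X u a b γ := by
  suffices hs : ∃ ε > 0, ∀ m ∈ (univ : Set M), ∀ a b, 0 ≤ a → a ≤ b → b ≤ 1 → b - a ≤ ε →
      ∃ γ : ℝ → M, γ a = m ∧ SolvesChartwiseOn X₀ X u a b γ by simpa using hs
  -- Having a common existence time passes to subsets and to finite unions, so compactness reduces
  -- it to a neighbourhood of each point.
  refine (isCompact_univ (X := M)).induction_on (p := fun S => ∃ ε > 0, ∀ m ∈ S, ∀ a b, 0 ≤ a →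
    a ≤ b → b ≤ 1 → b - a ≤ ε → ∃ γ : ℝ → M, γ a = m ∧ SolvesChartwiseOn X₀ X u a b γ)
    ⟨1, one_pos, by simp⟩ ?_ ?_ fun q _ => ?_
  · rintro S T hST ⟨ε, hε, h⟩
    exact ⟨ε, hε, fun m hm => h m (hST hm)⟩
  · rintro S T ⟨ε, hε, h⟩ ⟨ε', hε', h'⟩
    refine ⟨min ε ε', lt_min hε hε', ?_⟩
    rintro m (hm | hm) a b ha hab hb hba
    · exact h m hm a b ha hab hb (hba.trans (min_le_left _ _))
    · exact h' m hm a b ha hab hb (hba.trans (min_le_right _ _))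
  · obtain ⟨r, hr, L, hL, ε, hε, hball, hSB, hsmall⟩ :=
      exists_uniform_ball (X₀ := X₀) (X := X) hp hp_top hX₀ hX q ‖u‖
    refine ⟨(extChartAt (𝓡 n) q).source ∩
      extChartAt (𝓡 n) q ⁻¹' Metric.ball (extChartAt (𝓡 n) q q) r, mem_nhdsWithin_of_mem_nhds
      (((continuousOn_extChartAt q).isOpen_inter_preimage (isOpen_extChartAt_source q)
        Metric.isOpen_ball).mem_nhds ⟨mem_extChartAt_source q, Metric.mem_ball_self hr⟩),
      ε, hε, fun m hm a b ha hab hb hba => ?_⟩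
    obtain ⟨h1, h2⟩ := hsmall u le_rfl a b ha hab hb hba
    obtain ⟨ξ, hξa, hξ, hξm⟩ := exists_solvesOn hab hL hSB
      (intervalIntegrable_extendedControl u ⟨ha, hab.trans hb⟩ ⟨ha.trans hab, hb⟩) h1 h2.le
      (Metric.ball_subset_closedBall hm.2)
    refine ⟨fun t => (extChartAt (𝓡 n) q).symm (ξ t), ?_,
      hξ.solvesChartwiseOn hX₀ hX ha hb fun t ht => hball (hξm t ht)⟩
    simp only [hξa]
    exact (extChartAt (𝓡 n) q).left_inv hm.1

theorem mem_admissible_of_compactSpace [CompactSpace M] (hp : 1 < p) (hp_top : p ≠ ⊤)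
    (hX₀ : IsSmoothField X₀) (hX : ∀ i, IsSmoothField (X i)) (x : M) (u : Control d p) :
    u ∈ admissible p X₀ X x := by
  obtain ⟨ε, hε, hex⟩ := exists_uniform_time (X₀ := X₀) (X := X) hp hp_top hX₀ hX u
  have key : ∀ T ∈ Icc (0 : ℝ) 1, ∃ γ : ℝ → M, γ 0 = x ∧ SolvesChartwiseOn X₀ X u 0 T γ := by
    -- Restart the solution at `a`: points within `ε / 2` of `t₀` are less than `ε` apart, so the
    -- uniform time covers `[a, b]`.
    refine forall_mem_Icc_of_local_step (hex x 0 0 le_rfl le_rfl zero_le_one (by simpa using hε.le))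
      fun t₀ _ => ⟨ε / 2, by positivity, fun a ha b hb hat hbt hab hPa => ?_⟩
    obtain ⟨γ, hγ0, hγ⟩ := hPa
    have h1 := abs_lt.1 hat
    have h2 := abs_lt.1 hbt
    obtain ⟨γ', hγ'a, hγ'⟩ := hex (γ a) a b ha.1 hab hb.2 (by linarith [h1.1, h2.2])
    refine ⟨fun t => if t ≤ a then γ t else γ' t, by simp [ha.1, hγ0], ?_⟩
    refine SolvesChartwiseOn.append hX₀ hX le_rfl hb.2 ha.1 hab
      (hγ.congr fun t ht => by simp [ht.2]) (hγ'.congr fun t ht => ?_)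
    rcases ht.1.eq_or_lt with rfl | hlt
    · simp [hγ'a]
    · simp [not_le.2 hlt]
  obtain ⟨γ, hγ0, hγ⟩ := key 1 (by simp)
  exact ⟨γ, hγ.isTrajectory hX₀ hX hγ0⟩

end Compact

end ControlSystem

theorem mainTheorem8 {n d : ℕ} {M : Type*} [TopologicalSpace M] [T2Space M]
    [SecondCountableTopology M] [ChartedSpace (EuclideanSpace ℝ (Fin n)) M]
    [IsManifold (𝓡 n) ∞ M]
    (X₀ : (q : M) → TangentSpace (𝓡 n) q) (X : Fin d → (q : M) → TangentSpace (𝓡 n) q)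
    (hX₀ : ControlSystem.IsSmoothField X₀) (hX : ∀ i, ControlSystem.IsSmoothField (X i))
    (p : ℝ≥0∞) [Fact (1 ≤ p)] (hp : 1 < p) (hp_top : p ≠ ⊤)
    (x y : M)
    (hcomplete : CompactSpace M ∨
      ∀ u : ControlSystem.Control d p, u ∈ ControlSystem.admissible p X₀ X x)
    (hy : ControlSystem.IsRegularValue p X₀ X x y)
    (u : ℕ → ControlSystem.Control d p)
    (hu : ∀ k, u k ∈ ControlSystem.fiber p X₀ X x y)
    (hbound : ∃ C : ℝ, ∀ k, |ControlSystem.energy (u k)| ≤ C)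
    (hdiff : Tendsto (fun k => ‖ControlSystem.restrictedEnergyDifferential X₀ X x (u k)‖)
      atTop (𝓝 0)) :
    ∃ v ∈ ControlSystem.fiber p X₀ X x y, ∃ φ : ℕ → ℕ, StrictMono φ ∧
      Tendsto (fun k => u (φ k)) atTop (𝓝 v) := by
  have hall : ∀ u : ControlSystem.Control d p, u ∈ ControlSystem.admissible p X₀ X x := by
    rcases hcomplete with hM | hall
    · exact ControlSystem.mem_admissible_of_compactSpace hp hp_top hX₀ hX x
    · exact hall
  obtain ⟨C, hC⟩ := hbound
  exact ControlSystem.exists_subseq_tendsto_of_forall_admissible hp hp_top hX₀ hX hall hy hu hC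
    hdiff
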